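/- **Setting.** Let $H$ be a finite-dimensional algebra over a field $\mathbf k$ of characteristic zero which is a normalized unimodular quasitriangular ribbon quasi-Hopf algebra. That is: $H$ has a coproduct $\Delta$, counit $\epsilon$, coassociator $\Phi=\sum X\otimes Y\otimes Z$ (with $\Phi^{-1}=\sum\bar X\otimes\bar Y\otimes\bar Z$), antipode $S$ (an algebra anti-automorphism) with elements $\alpha,\beta$, R-matrix $\mathcal R=\sum s\otimes t$ and central invertible ribbon element $v$, satisfying: * $(\mathrm{id}\otimes\Delta)(\Delta(h))\,\Phi=\Phi\,(\Delta\otimes\mathrm{id})(\Delta(h))$, $\ (\mathrm{id}\otimes\mathrm{id}\otimes\Delta)(\Phi)(\Delta\otimes\mathrm{id}\otimes\mathrm{id})(\Phi)=(1\otimes\Phi)(\mathrm{id}\otimes\Delta\otimes\mathrm{id})(\Phi)(\Phi\otimes1)$, $\ (\epsilon\otimes\mathrm{id})\Delta=\mathrm{id}=(\mathrm{id}\otimes\epsilon)\Delta$, $\ (\mathrm{id}\otimes\epsilon\otimes\mathrm{id})(\Phi)=1\otimes1$; * $\sum S(h')\alpha h''=\epsilon(h)\alpha$, $\sum h'\beta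 S(h'')=\epsilon(h)\beta$, $\sum X\beta S(Y)\alpha Z=1=\sum S(\bar X)\alpha\bar Y\beta S(\bar Z)$; * $\Delta^{\rm op}(h)\mathcal R=\mathcal R\Delta(h)$, $\ (\Delta\otimes\mathrm{id})(\mathcal R)=\Phi_{312}\mathcal R_{13}\Phi_{132}^{-1}\mathcal R_{23}\Phi$, $\ (\mathrm{id}\otimes\Delta)(\mathcal R)=\Phi_{231}^{-1}\mathcal R_{13}\Phi_{213}\mathcal R_{12}\Phi^{-1}$, where e.g. $\Phi_{312}=\sum Y\otimes Z\otimes X$; * $v^2=uS(u)$, $S(v)=v$, $\epsilon(v)=1$, $\Delta(uv^{-1})=f^{-1}(S\otimes S)(f_{21})(uv^{-1}\otimes uv^{-1})$. Here $u=\sum S(\bar Y\beta S(\bar Z))S(t)\alpha s\bar X$ and $f=\sum(S\otimes S)(\Delta^{\rm op}(\bar X))\,\gamma\,\Delta(\bar Y\beta S(\bar Z))$, with $\gamma=\sum S(B)\alpha C\otimes S(A)\alpha E$ for $(\Phi\otimes1)(\Delta\otimes\mathrm{id}\otimes\mathrm{id})(\Phi^{-1})=\sum A\otimes B\otimes C\otimes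 E$. Put $G=uv^{-1}$, $\mathcal M=\mathcal R^{\rm op}\mathcal R$, $p_L=\sum YS^{-1}(X\beta)\otimes Z$, $q_L=\sum S(\bar X)\alpha\bar Y\otimes\bar Z$. Let $\lambda\in H^*$ be a right cointegral: $$(\lambda\otimes\mathrm{id})\big((S\otimes S)((p_L)_{21})\,f\,\Delta(h)\,(S^{-1}\otimes S^{-1})(f^{-1}_{21})\,(S^{-1}\otimes S^{-1})((q_L)_{21})\big)=\lambda(h)1\quad\text{for all }h .$$ Assume moreover: every left integral of $H$ is a right integral; $\alpha,\beta$ are invertible with $\epsilon(\alpha)=\epsilon(\beta)=1$; $\lambda(\alpha vS^{-1}(\beta))\,\lambda(\alpha v^{-1}S^{-1}(\beta))=1$; $\lambda(\Lambda)=1$ for some left integral $\Lambda$; and $H^*\to H$, $l\mapsto(\mathrm{id}\otimes l)(\mathcal M)$, is bijective. **Tangles and their evaluation.** Bracketed tangle diagrams are unoriented and blackboard framed, are read from top to bottom, and are built by stacking and juxtaposition from straight strands, changes of brackets, maxima, minima and crossings $c^{\pm1}$. Replace $c$ by a flat crossing with the beads $\mathcal R=\sum s\otimes t$ above it ($s$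 on the left strand), $c^{-1}$ by a flat crossing with the beads $\mathcal R^{-1}$ below it, a maximum by one with bead $\beta$ on its left leg, a minimum by one with bead $\alpha$ on its right leg. Replace a change of brackets by the beads $\Phi$ (from $(AB)C$ to $A(BC)$) or $\Phi^{-1}$, with coproducts, bracketed as the strands are, applied to the factors. Beads are moved along strands by the following rules: $x$ above $y$ is $yx$; a bead $x$ moved from the right leg to the left leg of a maximum, or from the left leg to the right leg of a minimum, becomes $S(x)$; a maximum whose two legs are made to cross each other is a maximum with the bead $G^{-1}$ on its left leg. On the resulting formal sum of flat diagrams, a closed component with a single bead $a$ (on the right-hand side of the circle) is evaluated to $\lambda(a)$. A diagram is even if its top and bottom end points are grouped and bracketed as $(\dots((1^-1^+)(2^-2^+))\dots(m^-m^+))$ and each pair of end points is either joined to itself by a component or joined by two components to one pair at the opposite end. For an even diagram $T$ from $m$ pairs to $n$ pairs, $\Xi(T):H^{\otimes m}\to H^{\otimes n}$ is the following map. Its value at $x_1\otimes\dots\otimes x_m$ is obtained by closing each top pair $(j^-,j^+)$ by a maximum with bead $x_j$ on the left leg (and with no further bead $\beta$), and reading off the beads on the left legs of the resulting $n$ maxima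 at the bottom. In particular an arc with bead $b$ on its left leg at a bottom pair contributes the factor $b$, an arc at a top pair with bead $c$ on its right leg contributes $x\mapsto\lambda(S(x)c)$, and two vertical strands with beads $p,q$ contribute $x\mapsto p\,x\,S(q)$. For a bracketing $A$ of $n\ge0$ points let $\Delta_A:H\to H^{\otimes n}$ be the iterated coproduct bracketed as $A$ ($\Delta_A=\epsilon$ for $n=0$, $\Delta_A=\mathrm{id}$ for $n=1$). For bracketing from the right this is the iterated right-bracketed coproduct. **Fenn–Rourke move.** For a bundle of $n\ge0$ parallel strands with bracketing $A$ and a sign $\pm$, the move replaces, anywhere inside a diagram, * the bundle passing through an unknotted closed component of framing $\pm1$ (for framing $-1$ the crossings of this component with the bundle are $c$, for framing $+1$ they are $c^{-1}$), by * the bundle with a full $2\pi$-twist (negative kinks on the strands for framing $+1$, positive ones for framing $-1$), next to an unlinked unknotted closed component of framing $\pm1$. **Statement.** Write $\Omega=q_L\mathcal M p_L$ and $\tilde\Omega=q_L\mathcal M^{-1}p_L$, with $\Omega=\Omega^1\otimes\Omega^2$, $\tilde\Omega=\tilde\Omega^1\otimes\tilde\Omega^2$ (summation suppressed). 1. $\lambda(v^{-1}\Omega^1)\,\Omega^2=\lambda(\alpha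 v^{-1}S^{-1}(\beta))\,v$ and $\lambda(v\,\tilde\Omega^1)\,\tilde\Omega^2=\lambda(\alpha vS^{-1}(\beta))\,v^{-1}$. 2. Let $a\in H$ be central with $S(a)=a$. If a bundle of strands with bracketing $A$ passes through an unknotted closed component without kinks, with a bead $a$, whose crossings with the bundle are all $c$ (respectively all $c^{-1}$), then evaluating the component leaves the beads $\lambda(a\Omega^1)\,\Delta_A(\Omega^2)$ (respectively $\lambda(a\tilde\Omega^1)\,\Delta_A(\tilde\Omega^2)$) on the strands. 3. Both sides of the move with framing $-1$ (closed component evaluated) leave the beads $\lambda(\alpha v^{-1}S^{-1}(\beta))\,\Delta_A(v)$ on the strands. Both sides of the move with framing $+1$ leave the beads $\lambda(\alpha vS^{-1}(\beta))\,\Delta_A(v^{-1})$. 4. Consequently $\Xi$ is invariant under the Fenn–Rourke move: if even diagrams $T,T'$ from $m$ pairs to $n$ pairs differ by a Fenn–Rourke move, then $\Xi(T)=\Xi(T')$. -/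

import Mathlib

open scoped TensorProduct

/-!  Quasi-Hopf algebras, bracketed tangle diagrams, their decorated flat diagrams, and the
Hennings-type evaluation of such diagrams. -/

namespace Hennings

noncomputable section

/-! ### Quasi-Hopf algebras -/

/-- A quasi-bialgebra structure on the algebra `H`: coproduct, counit and coassociator `Phi`.
Triple tensor products are `H ⊗ (H ⊗ H)`. -/
structure QuasiBialgebra (k H : Type*) [Field k] [Ring H] [Algebra k H] where
  comul : H →ₐ[k] H ⊗[k] H
  counit : H →ₐ[k] k
  Phi : (H ⊗[k] (H ⊗[k] H))ˣ
  /-- `(id ⊗ Δ)(Δ h) Φ = Φ (Δ ⊗ id)(Δ h)` -/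
  quasi_coassoc : ∀ h,
    Algebra.TensorProduct.map (AlgHom.id k H) comul (comul h) * (Phi : H ⊗[k] (H ⊗[k] H)) =
      Phi * Algebra.TensorProduct.assoc k k k H H H
        (Algebra.TensorProduct.map comul (AlgHom.id k H) (comul h))
  /-- `(id ⊗ id ⊗ Δ)(Φ) (Δ ⊗ id ⊗ id)(Φ) = (1 ⊗ Φ) (id ⊗ Δ ⊗ id)(Φ) (Φ ⊗ 1)` -/
  pentagon :
    Algebra.TensorProduct.map (AlgHom.id k H)
        (Algebra.TensorProduct.map (AlgHom.id k H) comul) (Phi : H ⊗[k] (H ⊗[k] H)) *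
      Algebra.TensorProduct.assoc k k k H H (H ⊗[k] H)
        (Algebra.TensorProduct.map comul (AlgHom.id k (H ⊗[k] H)) (Phi : H ⊗[k] (H ⊗[k] H))) =
    ((1 : H) ⊗ₜ[k] (Phi : H ⊗[k] (H ⊗[k] H))) *
      Algebra.TensorProduct.map (AlgHom.id k H)
        (((Algebra.TensorProduct.assoc k k k H H H).toAlgHom).comp
          (Algebra.TensorProduct.map comul (AlgHom.id k H))) (Phi : H ⊗[k] (H ⊗[k] H)) *
      Algebra.TensorProduct.map (AlgHom.id k H)
        (Algebra.TensorProduct.assoc k k k H H H).toAlgHom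
        (Algebra.TensorProduct.assoc k k k H (H ⊗[k] H) H
          ((Phi : H ⊗[k] (H ⊗[k] H)) ⊗ₜ[k] (1 : H)))
  counit_left : ∀ h, Algebra.TensorProduct.lid k H
    (Algebra.TensorProduct.map counit (AlgHom.id k H) (comul h)) = h
  counit_right : ∀ h, Algebra.TensorProduct.rid k k H
    (Algebra.TensorProduct.map (AlgHom.id k H) counit (comul h)) = h
  /-- `(id ⊗ ε ⊗ id)(Φ) = 1 ⊗ 1` -/
  counit_Phi : Algebra.TensorProduct.map (AlgHom.id k H)
    (((Algebra.TensorProduct.lid k H).toAlgHom).comp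
      (Algebra.TensorProduct.map counit (AlgHom.id k H))) (Phi : H ⊗[k] (H ⊗[k] H)) = 1

section Contractions
variable {k H : Type*} [Field k] [Ring H] [Algebra k H]

/-- `x ⊗ y ↦ S(x) α y` -/
def evalAlpha (S : H ≃ₗ[k] H) (α : H) : H ⊗[k] H →ₗ[k] H :=
  LinearMap.mul' k H ∘ₗ TensorProduct.map (LinearMap.mulRight k α ∘ₗ S.toLinearMap) LinearMap.id

/-- `x ⊗ y ↦ x β S(y)` -/
def evalBeta (S : H ≃ₗ[k] H) (β : H) : H ⊗[k] H →ₗ[k] H :=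
  LinearMap.mul' k H ∘ₗ TensorProduct.map (LinearMap.mulRight k β) S.toLinearMap

/-- `(l ⊗ id) : x ⊗ y ↦ l(x) y` -/
def slice (l : H →ₗ[k] k) : H ⊗[k] H →ₗ[k] H :=
  (TensorProduct.lid k H).toLinearMap ∘ₗ TensorProduct.map l LinearMap.id

end Contractions

/-- A quasi-Hopf algebra: a quasi-bialgebra with antipode `(S, α, β)`, where `S` is an
anti-automorphism of the algebra `H`. -/
structure QuasiHopf (k H : Type*) [Field k] [Ring H] [Algebra k H]
    extends QuasiBialgebra k H where
  S : H ≃ₗ[k] H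
  S_one : S 1 = 1
  S_mul : ∀ x y, S (x * y) = S y * S x
  α : H
  β : H
  /-- `S(h') α h'' = ε(h) α` -/
  antipode_left : ∀ h, evalAlpha S α (comul h) = counit h • α
  /-- `h' β S(h'') = ε(h) β` -/
  antipode_right : ∀ h, evalBeta S β (comul h) = counit h • β
  /-- `X β S(Y) α Z = 1` for `Φ = X ⊗ Y ⊗ Z` -/
  zigzag_Phi : LinearMap.mul' k H (TensorProduct.map (LinearMap.mulRight k β) (evalAlpha S α)
    (Phi : H ⊗[k] (H ⊗[k] H))) = 1
  /-- `S(X) α Y β S(Z) = 1` for `Φ⁻¹ = X ⊗ Y ⊗ Z` -/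
  zigzag_Phi_inv : LinearMap.mul' k H
    (TensorProduct.map (LinearMap.mulRight k α ∘ₗ S.toLinearMap) (evalBeta S β)
      ((Phi⁻¹ : (H ⊗[k] (H ⊗[k] H))ˣ) : H ⊗[k] (H ⊗[k] H))) = 1

namespace QuasiHopf
variable {k H : Type*} [Field k] [Ring H] [Algebra k H] (D : QuasiHopf k H)

/-- The coassociator `Φ` as an element. -/
def phi : H ⊗[k] (H ⊗[k] H) := D.Phi

/-- The inverse `Φ⁻¹` as an element. -/
def phiInv : H ⊗[k] (H ⊗[k] H) := ((D.Phi⁻¹ : (H ⊗[k] (H ⊗[k] H))ˣ) : H ⊗[k] (H ⊗[k] H))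

/-- `S ⊗ S` -/
def SS : H ⊗[k] H →ₗ[k] H ⊗[k] H := TensorProduct.map D.S.toLinearMap D.S.toLinearMap

/-- `S⁻¹ ⊗ S⁻¹` -/
def SSinv : H ⊗[k] H →ₗ[k] H ⊗[k] H :=
  TensorProduct.map D.S.symm.toLinearMap D.S.symm.toLinearMap

/-- The flip `x ⊗ y ↦ y ⊗ x`, so that `flip t = t₂₁`. -/
def flip : H ⊗[k] H →ₗ[k] H ⊗[k] H := (TensorProduct.comm k H H).toLinearMap

/-- `γ = S(B) α C ⊗ S(A) α E`, where `A ⊗ B ⊗ C ⊗ E = (Φ ⊗ 1) (Δ ⊗ id ⊗ id)(Φ⁻¹)`. -/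
def gamma : H ⊗[k] H :=
  TensorProduct.map LinearMap.id (evalAlpha D.S D.α)
    (TensorProduct.leftComm k H H H
      (TensorProduct.map LinearMap.id
        (TensorProduct.map (evalAlpha D.S D.α) LinearMap.id ∘ₗ
          (TensorProduct.assoc k H H H).symm.toLinearMap)
        (Algebra.TensorProduct.map (AlgHom.id k H)
            (Algebra.TensorProduct.assoc k k k H H H).toAlgHom
            (Algebra.TensorProduct.assoc k k k H (H ⊗[k] H) H (D.phi ⊗ₜ[k] (1 : H))) *
          Algebra.TensorProduct.assoc k k k H H (H ⊗[k] H)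
            (Algebra.TensorProduct.map D.comul (AlgHom.id k (H ⊗[k] H)) D.phiInv))))

/-- Drinfeld's twist `f = (S ⊗ S)(Δᵒᵖ(X)) γ Δ(Y β S(Z))`, where `Φ⁻¹ = X ⊗ Y ⊗ Z`.
It is an invertible element of `H ⊗ H`. -/
def f : H ⊗[k] H :=
  LinearMap.mul' k (H ⊗[k] H)
    (TensorProduct.map
      (LinearMap.mulRight k D.gamma ∘ₗ D.SS ∘ₗ flip ∘ₗ D.comul.toLinearMap)
      (D.comul.toLinearMap ∘ₗ evalBeta D.S D.β) D.phiInv)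

/-- `p_L = Y S⁻¹(X β) ⊗ Z`, where `Φ = X ⊗ Y ⊗ Z`. -/
def pL : H ⊗[k] H :=
  TensorProduct.map
    (LinearMap.mul' k H ∘ₗ flip ∘ₗ
      TensorProduct.map (D.S.symm.toLinearMap ∘ₗ LinearMap.mulRight k D.β) LinearMap.id)
    LinearMap.id ((TensorProduct.assoc k H H H).symm D.phi)

/-- `q_L = S(X) α Y ⊗ Z`, where `Φ⁻¹ = X ⊗ Y ⊗ Z`. -/
def qL : H ⊗[k] H :=
  TensorProduct.map (evalAlpha D.S D.α) LinearMap.id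
    ((TensorProduct.assoc k H H H).symm D.phiInv)

/-- `Λ` is a left integral: `h Λ = ε(h) Λ`. -/
def IsLeftIntegral (Λ : H) : Prop := ∀ h, h * Λ = D.counit h • Λ

/-- `Λ` is a right integral: `Λ h = ε(h) Λ`. -/
def IsRightIntegral (Λ : H) : Prop := ∀ h, Λ * h = D.counit h • Λ

/-- Every left integral is a right integral. -/
def Unimodular : Prop := ∀ Λ, D.IsLeftIntegral Λ → D.IsRightIntegral Λ

/-- Right cointegrals (of a unimodular quasi-Hopf algebra):
`(l ⊗ id)((S ⊗ S)((p_L)₂₁) f Δ(h) (S⁻¹ ⊗ S⁻¹)((f⁻¹)₂₁) (S⁻¹ ⊗ S⁻¹)((q_L)₂₁)) = l(h) 1`. -/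
def IsRightCointegral (l : H →ₗ[k] k) : Prop :=
  ∀ h, slice l (D.SS (flip D.pL) * D.f * D.comul h * D.SSinv (flip (Ring.inverse D.f)) *
    D.SSinv (flip D.qL)) = l h • (1 : H)

end QuasiHopf

/-- A quasitriangular quasi-Hopf algebra, with R-matrix `R = s ⊗ t`. -/
structure QuasitriangularQuasiHopf (k H : Type*) [Field k] [Ring H] [Algebra k H]
    extends QuasiHopf k H where
  R : (H ⊗[k] H)ˣ
  /-- `Δᵒᵖ(h) R = R Δ(h)` -/
  R_comul : ∀ h, Algebra.TensorProduct.comm k H H (comul h) * (R : H ⊗[k] H) = R * comul h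
  /-- `(Δ ⊗ id)(R) = Φ₃₁₂ R₁₃ (Φ₁₃₂)⁻¹ R₂₃ Φ`. For `Φ = X ⊗ Y ⊗ Z` one has
  `Φ₃₁₂ = Y ⊗ Z ⊗ X` and `Φ₁₃₂ = X ⊗ Z ⊗ Y`. -/
  hexagon_left :
    Algebra.TensorProduct.assoc k k k H H H
        (Algebra.TensorProduct.map comul (AlgHom.id k H) (R : H ⊗[k] H)) =
      Algebra.TensorProduct.assoc k k k H H H
          (Algebra.TensorProduct.comm k H (H ⊗[k] H) (Phi : H ⊗[k] (H ⊗[k] H))) *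
        Algebra.TensorProduct.map (AlgHom.id k H)
          (Algebra.TensorProduct.includeRight : H →ₐ[k] H ⊗[k] H) (R : H ⊗[k] H) *
        Algebra.TensorProduct.map (AlgHom.id k H) (Algebra.TensorProduct.comm k H H).toAlgHom
          ((Phi⁻¹ : (H ⊗[k] (H ⊗[k] H))ˣ) : H ⊗[k] (H ⊗[k] H)) *
        ((1 : H) ⊗ₜ[k] (R : H ⊗[k] H)) * Phi
  /-- `(id ⊗ Δ)(R) = (Φ₂₃₁)⁻¹ R₁₃ Φ₂₁₃ R₁₂ Φ⁻¹`. For `Φ = X ⊗ Y ⊗ Z` one has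
  `Φ₂₃₁ = Z ⊗ X ⊗ Y` and `Φ₂₁₃ = Y ⊗ X ⊗ Z`. -/
  hexagon_right :
    Algebra.TensorProduct.map (AlgHom.id k H) comul (R : H ⊗[k] H) =
      Algebra.TensorProduct.comm k (H ⊗[k] H) H ((Algebra.TensorProduct.assoc k k k H H H).symm
          ((Phi⁻¹ : (H ⊗[k] (H ⊗[k] H))ˣ) : H ⊗[k] (H ⊗[k] H))) *
        Algebra.TensorProduct.map (AlgHom.id k H)
          (Algebra.TensorProduct.includeRight : H →ₐ[k] H ⊗[k] H) (R : H ⊗[k] H) *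
        Algebra.TensorProduct.leftComm k H H H (Phi : H ⊗[k] (H ⊗[k] H)) *
        Algebra.TensorProduct.map (AlgHom.id k H)
          (Algebra.TensorProduct.includeLeft : H →ₐ[k] H ⊗[k] H) (R : H ⊗[k] H) *
        ((Phi⁻¹ : (H ⊗[k] (H ⊗[k] H))ˣ) : H ⊗[k] (H ⊗[k] H))

namespace QuasitriangularQuasiHopf
variable {k H : Type*} [Field k] [Ring H] [Algebra k H] (D : QuasitriangularQuasiHopf k H)

/-- The R-matrix as an element. -/
def r : H ⊗[k] H := D.R

/-- The inverse R-matrix as an element. -/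
def rInv : H ⊗[k] H := ((D.R⁻¹ : (H ⊗[k] H)ˣ) : H ⊗[k] H)

/-- The element `u = S(Y β S(Z)) S(t) α s X`, where `Φ⁻¹ = X ⊗ Y ⊗ Z` and `R = s ⊗ t`. -/
def u : H :=
  LinearMap.mul' k H
    (TensorProduct.map
      (LinearMap.mulRight k (evalAlpha D.S D.α (QuasiHopf.flip D.r)) ∘ₗ D.S.toLinearMap ∘ₗ
        evalBeta D.S D.β)
      LinearMap.id
      (TensorProduct.comm k H (H ⊗[k] H) D.phiInv))

/-- The monodromy element `M = R₂₁ R`. -/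
def M : H ⊗[k] H := QuasiHopf.flip D.r * D.r

/-- Its inverse `M⁻¹ = R⁻¹ (R₂₁)⁻¹`. -/
def Minv : H ⊗[k] H := D.rInv * QuasiHopf.flip D.rInv

/-- `Ω = q_L M p_L` (`true`) and `q_L M⁻¹ p_L` (`false`). -/
def Omega : Bool → H ⊗[k] H
  | true => D.qL * D.M * D.pL
  | false => D.qL * D.Minv * D.pL

/-- `M` is nondegenerate: `l ↦ (id ⊗ l)(M)` is an isomorphism from the dual of `H` to `H`. -/
def NondegenerateM : Prop :=
  Function.Bijective (fun l : H →ₗ[k] k =>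
    TensorProduct.rid k H (TensorProduct.map LinearMap.id l D.M))

end QuasitriangularQuasiHopf

/-- A ribbon quasi-Hopf algebra: a quasitriangular quasi-Hopf algebra with a central invertible
element `v` such that `v² = u S(u)`, `S(v) = v`, `ε(v) = 1` and
`Δ(u v⁻¹) = f⁻¹ (S ⊗ S)(f₂₁) (u v⁻¹ ⊗ u v⁻¹)`. -/
structure RibbonQuasiHopf (k H : Type*) [Field k] [Ring H] [Algebra k H]
    extends QuasitriangularQuasiHopf k H where
  v : Hˣ
  v_central : ∀ h : H, (v : H) * h = h * v
  v_sq : (v : H) * v = toQuasitriangularQuasiHopf.u * S toQuasitriangularQuasiHopf.u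
  S_v : S v = v
  counit_v : counit v = 1
  comul_G : toQuasiHopf.f * comul (toQuasitriangularQuasiHopf.u * ((v⁻¹ : Hˣ) : H)) =
    toQuasiHopf.SS (QuasiHopf.flip toQuasiHopf.f) *
      ((toQuasitriangularQuasiHopf.u * ((v⁻¹ : Hˣ) : H)) ⊗ₜ[k]
        (toQuasitriangularQuasiHopf.u * ((v⁻¹ : Hˣ) : H)))

namespace RibbonQuasiHopf
variable {k H : Type*} [Field k] [Ring H] [Algebra k H] (D : RibbonQuasiHopf k H)

/-- The inverse of the ribbon element, as an element of `H`. -/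
def vInv : H := ((D.v⁻¹ : Hˣ) : H)

/-- `G = u v⁻¹` -/
def G : H := D.u * D.vInv

/-- The inverse of the (invertible) element `G`. -/
def Ginv : H := Ring.inverse D.G

end RibbonQuasiHopf

/-- A normalized unimodular (quasitriangular ribbon) quasi-Hopf algebra, with its right
cointegral `coint`, denoted `λ` in the comments. -/
structure NormalizedUnimodular (k H : Type*) [Field k] [Ring H] [Algebra k H]
    extends RibbonQuasiHopf k H where
  coint : H →ₗ[k] k
  coint_isRightCointegral : toQuasiHopf.IsRightCointegral coint
  unimodular : toQuasiHopf.Unimodular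
  isUnit_α : IsUnit α
  isUnit_β : IsUnit β
  counit_α : counit α = 1
  counit_β : counit β = 1
  coint_mul_coint : coint (α * v * S.symm β) * coint (α * ((v⁻¹ : Hˣ) : H) * S.symm β) = 1
  coint_integral : ∃ Λ, toQuasiHopf.IsLeftIntegral Λ ∧ coint Λ = 1
  nondegenerate_M : toQuasitriangularQuasiHopf.NondegenerateM

/-! ### Bracketed tangle diagrams -/

/-- Bracketed finite sequences of points (`unit` is the empty sequence). -/
inductive Brac : Type
  | unit : Brac
  | pt : Brac
  | tensor : Brac → Brac → Brac

/-- Bracketed (unoriented, blackboard framed) tangle diagrams, read from the top to the bottom,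
built by stacking and juxtaposition from the generators: straight strands, changes of brackets,
the maximum `cap`, the minimum `cup`, and the crossings `cross true = c`,
`cross false = c⁻¹`. -/
inductive Tangle : Brac → Brac → Type
  | id (A : Brac) : Tangle A A
  /-- the first diagram on top of the second one -/
  | comp {A B C : Brac} : Tangle A B → Tangle B C → Tangle A C
  | tensor {A B A' B' : Brac} : Tangle A B → Tangle A' B' → Tangle (.tensor A A') (.tensor B B')
  | assoc (A B C : Brac) : Tangle (.tensor (.tensor A B) C) (.tensor A (.tensor B C))
  | assocInv (A B C : Brac) : Tangle (.tensor A (.tensor B C)) (.tensor (.tensor A B) C)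
  | lunit (A : Brac) : Tangle (.tensor .unit A) A
  | lunitInv (A : Brac) : Tangle A (.tensor .unit A)
  | runit (A : Brac) : Tangle (.tensor A .unit) A
  | runitInv (A : Brac) : Tangle A (.tensor A .unit)
  | cap : Tangle .unit (.tensor .pt .pt)
  | cup : Tangle (.tensor .pt .pt) .unit
  | cross (s : Bool) : Tangle (.tensor .pt .pt) (.tensor .pt .pt)

namespace Tangle

/-- One strand with a kink whose crossing is `c` (`s = true`) or `c⁻¹` (`s = false`):
the twist, respectively the negative twist. -/
def kink (s : Bool) : Tangle .pt .pt :=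
  (runitInv .pt).comp <| ((id .pt).tensor cap).comp <| (assocInv .pt .pt .pt).comp <|
    ((cross s).tensor (id .pt)).comp <| (cup.tensor (id .pt)).comp <| lunit .pt

/-- A strand crossing a bundle `A` of parallel strands from left to right,
all crossings being `cross s`. -/
def crossBundle (s : Bool) : (A : Brac) → Tangle (.tensor .pt A) (.tensor A .pt)
  | .unit => (runit .pt).comp (lunitInv .pt)
  | .pt => cross s
  | .tensor A B =>
    (assocInv .pt A B).comp <| ((crossBundle s A).tensor (id B)).comp <| (assoc A .pt B).comp <|
      ((id A).tensor (crossBundle s B)).comp <| assocInv A B .pt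

/-- A bundle `A` of parallel strands crossing a bundle `B` from left to right,
all crossings being `cross s`. -/
def crossBundles (s : Bool) : (A B : Brac) → Tangle (.tensor A B) (.tensor B A)
  | .unit, B => (lunit B).comp (runitInv B)
  | .pt, B => crossBundle s B
  | .tensor A A', B =>
    (assoc A A' B).comp <| ((id A).tensor (crossBundles s A' B)).comp <|
      (assocInv A B A').comp <| ((crossBundles s A B).tensor (id A')).comp <| assoc B A A'

/-- A bundle `A` of parallel strands with a full `2π`-twist: each strand receives the kink
`kink s`, and any two strands cross each other twice, by crossings of the opposite type. (The
crossing in `kink s` is `cross s` with the two strands running in opposite directions, so that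
`kink s` and two strands crossing twice by `cross (!s)` turn in the same direction.) -/
def fullTwist (s : Bool) : (A : Brac) → Tangle A A
  | .unit => id .unit
  | .pt => kink s
  | .tensor A B =>
    ((fullTwist s A).tensor (fullTwist s B)).comp <|
      (crossBundles (!s) A B).comp (crossBundles (!s) B A)

/-- The top of the diagram in which a circle encircles the bundle `A`:
the maximum of the circle, to the left of the bundle. -/
def circleTop (A : Brac) : Tangle A (.tensor .pt (.tensor .pt A)) :=
  (lunitInv A).comp <| (cap.tensor (id A)).comp <| assoc .pt .pt A

/-- The bottom of the diagram in which a circle encircles the bundle `A`: the right strand of the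
circle crosses the bundle to the right, crosses it back to the left, all crossings
being `cross s`, and joins the left strand of the circle in a minimum. -/
def circleBottom (s : Bool) (A : Brac) : Tangle (.tensor .pt (.tensor .pt A)) A :=
  ((id .pt).tensor (crossBundle s A)).comp <| ((id .pt).tensor (crossBundles s A .pt)).comp <|
    (assocInv .pt .pt A).comp <| (cup.tensor (id A)).comp <| lunit A

/-- The bundle `A` passing through an unknotted circle of framing `+1` (`s = true`) or `-1`
(`s = false`). -/
def encircled (s : Bool) (A : Brac) : Tangle A A :=
  (circleTop A).comp <| ((kink s).tensor (id (.tensor .pt A))).comp <| circleBottom (!s) A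

/-- The bundle `A` with a full twist, the sign being opposite to `s`, next to an unlinked
unknotted circle of framing `+1` (`s = true`) or `-1` (`s = false`). -/
def unlinked (s : Bool) (A : Brac) : Tangle A A :=
  (fullTwist (!s) A).comp <| (runitInv A).comp <| ((id A).tensor cap).comp <|
    ((id A).tensor ((kink s).tensor (id .pt))).comp <| ((id A).tensor cup).comp <| runit A

/-- The Fenn-Rourke move: somewhere in the diagram, strands passing through a closed unknotted
component of framing `±1` receive a full twist and the closed component is unlinked from them. -/
inductive FennRourke : {A B : Brac} → Tangle A B → Tangle A B → Prop
  | move (s : Bool) (A : Brac) : FennRourke (encircled s A) (unlinked s A)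
  | comp_top {A B C : Brac} {T T' : Tangle A B} (U : Tangle B C) :
      FennRourke T T' → FennRourke (T.comp U) (T'.comp U)
  | comp_bottom {A B C : Brac} (U : Tangle A B) {T T' : Tangle B C} :
      FennRourke T T' → FennRourke (U.comp T) (U.comp T')
  | tensor_left {A B A' B' : Brac} {T T' : Tangle A B} (U : Tangle A' B') :
      FennRourke T T' → FennRourke (T.tensor U) (T'.tensor U)
  | tensor_right {A B A' B' : Brac} (U : Tangle A B) {T T' : Tangle A' B'} :
      FennRourke T T' → FennRourke (U.tensor T) (U.tensor T')

end Tangle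

/-- The type of points of a bracketed sequence. -/
@[reducible] def Pts : Brac → Type
  | .unit => Empty
  | .pt => Unit
  | .tensor A B => Pts A ⊕ Pts B

/-! ### Connectivity of flat diagrams -/

/-- A fixed point free involution of `P`. -/
@[ext] structure Matching (P : Type) where
  σ : P → P
  invol : ∀ p, σ (σ p) = p
  ne : ∀ p, σ p ≠ p

namespace Matching

/-- Transport along a bijection. -/
def relabel {P Q : Type} (e : P ≃ Q) (μ : Matching P) : Matching Q where
  σ q := e (μ.σ (e.symm q))
  invol q := by simp [μ.invol]
  ne q h := μ.ne (e.symm q) ((Equiv.eq_symm_apply e).mpr h)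

/-- Two new points, joined to each other. -/
def cap {Q : Type} (μ : Matching Q) : Matching ((Unit ⊕ Unit) ⊕ Q) where
  σ
    | .inl (.inl _) => .inl (.inr ())
    | .inl (.inr _) => .inl (.inl ())
    | .inr q => .inr (μ.σ q)
  invol := by rintro ((_ | _) | q) <;> simp [μ.invol]
  ne := by rintro ((_ | _) | q) <;> simp [μ.ne]

/-- The partner of `q` after the two points of `Unit ⊕ Unit` have been joined by an arc. The
second alternatives of the inner matches do not occur. -/
def cupFun {Q : Type} (μ : Matching ((Unit ⊕ Unit) ⊕ Q)) (q : Q) : Q :=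
  match μ.σ (.inr q) with
  | .inr q' => q'
  | .inl (.inl _) => (match μ.σ (.inl (.inr ())) with | .inr q' => q' | .inl _ => q)
  | .inl (.inr _) => (match μ.σ (.inl (.inl ())) with | .inr q' => q' | .inl _ => q)

/-- Join the two points of `Unit ⊕ Unit` by an arc. -/
def cup {Q : Type} (μ : Matching ((Unit ⊕ Unit) ⊕ Q)) : Matching Q where
  σ := μ.cupFun
  invol q := by
    have h0 := μ.invol (.inr q)
    have ha := μ.invol (.inl (.inl ()))
    have hb := μ.invol (.inl (.inr ()))
    have na := μ.ne (.inl (.inl ()))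
    have nb := μ.ne (.inl (.inr ()))
    unfold cupFun
    rcases h : μ.σ (.inr q) with (⟨⟨⟩⟩ | ⟨⟨⟩⟩) | q' <;> rw [h] at h0
    · rcases h2 : μ.σ (.inl (.inr ())) with (⟨⟨⟩⟩ | ⟨⟨⟩⟩) | q'' <;> rw [h2] at hb <;> simp_all
    · rcases h2 : μ.σ (.inl (.inl ())) with (⟨⟨⟩⟩ | ⟨⟨⟩⟩) | q'' <;> rw [h2] at ha <;> simp_all
    · simp_all
  ne q := by
    have h0 := μ.invol (.inr q)
    have ha := μ.invol (.inl (.inl ()))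
    have hb := μ.invol (.inl (.inr ()))
    have na := μ.ne (.inl (.inl ()))
    have nb := μ.ne (.inl (.inr ()))
    have n0 := μ.ne (.inr q)
    unfold cupFun
    rcases h : μ.σ (.inr q) with (⟨⟨⟩⟩ | ⟨⟨⟩⟩) | q' <;> rw [h] at h0 n0
    · rcases h2 : μ.σ (.inl (.inr ())) with (⟨⟨⟩⟩ | ⟨⟨⟩⟩) | q'' <;> rw [h2] at hb nb
      · simp_all
      · simp_all
      · intro e
        have e' : q'' = q := e
        simp_all
    · rcases h2 : μ.σ (.inl (.inl ())) with (⟨⟨⟩⟩ | ⟨⟨⟩⟩) | q'' <;> rw [h2] at ha na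
      · simp_all
      · simp_all
      · intro e
        have e' : q'' = q := e
        simp_all
    · simpa using n0

end Matching

/-- The bijection of the points below, when two neighbouring strands cross. -/
def swapPts (Q : Type) : (Unit ⊕ Unit) ⊕ Q ≃ (Unit ⊕ Unit) ⊕ Q :=
  Equiv.sumCongr (Equiv.sumComm Unit Unit) (Equiv.refl Q)

/-- `P ⊕ P' ⊕ Q` with the first two summands exchanged. -/
def exchange (P P' Q : Type) : P ⊕ (P' ⊕ Q) ≃ P' ⊕ (P ⊕ Q) :=
  (Equiv.sumAssoc P P' Q).symm.trans
    ((Equiv.sumCongr (Equiv.sumComm P P') (Equiv.refl Q)).trans (Equiv.sumAssoc P' P Q))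

/-- How a tangle diagram connects points: given a matching of the points at its top and of
further points `Q`, the resulting matching of the points at its bottom and of `Q`. -/
def Tangle.conn : {A B : Brac} → Tangle A B → (Q : Type) →
    Matching (Pts A ⊕ Q) → Matching (Pts B ⊕ Q)
  | _, _, .id _, _ => fun μ => μ
  | _, _, .comp T U, Q => fun μ => U.conn Q (T.conn Q μ)
  | _, _, @Tangle.tensor A B A' B' T U, Q => fun μ =>
      ((U.conn (Pts B ⊕ Q) ((T.conn (Pts A' ⊕ Q)
          (μ.relabel (Equiv.sumAssoc (Pts A) (Pts A') Q))).relabel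
        (exchange (Pts B) (Pts A') Q))).relabel (exchange (Pts B') (Pts B) Q)).relabel
        (Equiv.sumAssoc (Pts B) (Pts B') Q).symm
  | _, _, .assoc A B C, Q =>
      Matching.relabel (Equiv.sumCongr (Equiv.sumAssoc (Pts A) (Pts B) (Pts C)) (Equiv.refl Q))
  | _, _, .assocInv A B C, Q =>
      Matching.relabel
        (Equiv.sumCongr (Equiv.sumAssoc (Pts A) (Pts B) (Pts C)).symm (Equiv.refl Q))
  | _, _, .lunit A, Q =>
      Matching.relabel (Equiv.sumCongr (Equiv.emptySum Empty (Pts A)) (Equiv.refl Q))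
  | _, _, .lunitInv A, Q =>
      Matching.relabel (Equiv.sumCongr (Equiv.emptySum Empty (Pts A)).symm (Equiv.refl Q))
  | _, _, .runit A, Q =>
      Matching.relabel (Equiv.sumCongr (Equiv.sumEmpty (Pts A) Empty) (Equiv.refl Q))
  | _, _, .runitInv A, Q =>
      Matching.relabel (Equiv.sumCongr (Equiv.sumEmpty (Pts A) Empty).symm (Equiv.refl Q))
  | _, _, .cap, Q => fun μ => (μ.relabel (Equiv.emptySum Empty Q)).cap
  | _, _, .cup, Q => fun μ => μ.cup.relabel (Equiv.emptySum Empty Q).symm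
  | _, _, .cross _, Q => Matching.relabel (swapPts Q)

/-- The special bracketing `(...((1⁻ 1⁺) (2⁻ 2⁺)) ... (m⁻ m⁺))` of `2m` points. -/
def bar : ℕ → Brac
  | 0 => .unit
  | 1 => .tensor .pt .pt
  | (m + 2) => .tensor (bar (m + 1)) (.tensor .pt .pt)

/-- The point `j⁻` (`false`) or `j⁺` (`true`) of `bar m`. -/
def barPt : (m : ℕ) → Fin m → Bool → Pts (bar m)
  | 0, j, _ => j.elim0
  | 1, _, b => if b then .inr () else .inl ()
  | (m + 2), j, b =>
      Fin.lastCases (motive := fun _ => Pts (bar (m + 2)))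
        (.inr (if b then .inr () else .inl ())) (fun i => .inl (barPt (m + 1) i b)) j

/-- The inverse of `barPt`. -/
def barIx : (m : ℕ) → Pts (bar m) → Fin m × Bool
  | 0, p => Empty.elim p
  | 1, .inl _ => (0, false)
  | 1, .inr _ => (0, true)
  | (m + 2), .inl p => ((barIx (m + 1) p).1.castSucc, (barIx (m + 1) p).2)
  | (m + 2), .inr (.inl _) => (Fin.last (m + 1), false)
  | (m + 2), .inr (.inr _) => (Fin.last (m + 1), true)

theorem barPt_last (m : ℕ) (b : Bool) :
    barPt (m + 2) (Fin.last (m + 1)) b =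
      (.inr (if b then .inr () else .inl ()) : Pts (bar (m + 1)) ⊕ (Unit ⊕ Unit)) :=
  Fin.lastCases_last

theorem barPt_castSucc (m : ℕ) (i : Fin (m + 1)) (b : Bool) :
    barPt (m + 2) i.castSucc b =
      (.inl (barPt (m + 1) i b) : Pts (bar (m + 1)) ⊕ (Unit ⊕ Unit)) :=
  Fin.lastCases_castSucc i

theorem barIx_barPt : ∀ (m : ℕ) (j : Fin m) (b : Bool), barIx m (barPt m j b) = (j, b)
  | 0, j, _ => j.elim0
  | 1, j, b => by
      obtain rfl : j = 0 := Subsingleton.elim _ _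
      cases b <;> rfl
  | (m + 2), j, b => by
      refine Fin.lastCases ?_ (fun i => ?_) j
      · rw [barPt_last]
        cases b <;> rfl
      · rw [barPt_castSucc]
        simp only [barIx, barIx_barPt (m + 1) i b]

theorem barPt_barIx : ∀ (m : ℕ) (p : Pts (bar m)), barPt m (barIx m p).1 (barIx m p).2 = p
  | 0, p => Empty.elim p
  | 1, .inl _ => rfl
  | 1, .inr _ => rfl
  | (m + 2), .inl p => by
      simp only [barIx]
      rw [barPt_castSucc, barPt_barIx (m + 1) p]
  | (m + 2), .inr (.inl _) => by
      simp only [barIx]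
      rw [barPt_last]
      rfl
  | (m + 2), .inr (.inr _) => by
      simp only [barIx]
      rw [barPt_last]
      rfl

/-- `m` pairs joined to each other: `j⁻` is joined to `j⁺`. -/
def capsMatching (m : ℕ) : Matching (Pts (bar m) ⊕ Empty) where
  σ
    | .inl p => .inl (barPt m (barIx m p).1 (!(barIx m p).2))
    | .inr e => e.elim
  invol := by rintro (p | e) <;> [simp [barIx_barPt, barPt_barIx]; exact e.elim]
  ne := by
    rintro (p | e)
    · intro h
      have := congrArg (fun p => (barIx m p).2) (Sum.inl_injective h)
      simp [barIx_barPt] at this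
    · exact e.elim

/-- Every point of `P` is joined to its copy. -/
def doubleMatching (P : Type) : Matching (P ⊕ P) where
  σ := Sum.swap
  invol := by rintro (p | p) <;> rfl
  ne := by rintro (p | p) <;> simp

/-- The connectivity of a tangle diagram between special bracketings: a matching of the points
at its bottom (`inl`) and at its top (`inr`). -/
def endpoints {m n : ℕ} (T : Tangle (bar m) (bar n)) : Matching (Pts (bar n) ⊕ Pts (bar m)) :=
  T.conn (Pts (bar m)) (doubleMatching (Pts (bar m)))

/-- The diagram is even: the end points `(j⁻, j⁺)` of each pair are either joined to each other
or joined to the two end points of one pair at the opposite end. -/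
def IsEven {m n : ℕ} (T : Tangle (bar m) (bar n)) : Prop :=
  (∀ j : Fin m,
    (endpoints T).σ (.inr (barPt m j false)) = .inr (barPt m j true) ∨
    ∃ (i : Fin n) (b : Bool),
      (endpoints T).σ (.inr (barPt m j false)) = .inl (barPt n i b) ∧
      (endpoints T).σ (.inr (barPt m j true)) = .inl (barPt n i (!b))) ∧
  (∀ i : Fin n,
    (endpoints T).σ (.inl (barPt n i false)) = .inl (barPt n i true) ∨
    ∃ (j : Fin m) (b : Bool),
      (endpoints T).σ (.inl (barPt n i false)) = .inr (barPt m j b) ∧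
      (endpoints T).σ (.inl (barPt n i true)) = .inr (barPt m j (!b)))

/-- Bracketed even tangle diagrams. -/
def EvenTangle (m n : ℕ) : Type := {T : Tangle (bar m) (bar n) // IsEven T}

/-! ### Flat diagrams with beads

A flat diagram without closed components, all of whose end points are at the bottom, is up to
the equivalences of flat diagrams a matching of its end points by maxima followed by crossings.
All beads of a component can be collected at either end of it. -/

/-- A flat diagram with beads, with end points `P` at the bottom. The arc from `p` to `σ p` is
described at each of its two ends: `lab p` is the single bead, at the end `p`, of the arc when it
is straightened to a maximum with left leg `p` and right leg `σ p` (whose legs may cross other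
strands and each other below). -/
@[ext] structure Beaded (H : Type*) (P : Type) extends Matching P where
  lab : P → H

namespace Beaded
variable {k H : Type*} [Field k] [Ring H] [Algebra k H] {P Q : Type}

/-- `r` arises from `s` and `t` by the linear combination `a s + b t` of the bead of one arc,
everything else being the same in `r`, `s` and `t`. -/
def Comb (a b : k) (s t r : Beaded H P) : Prop :=
  s.toMatching = r.toMatching ∧ t.toMatching = r.toMatching ∧
  ∃ p, (∀ q, q ≠ p → q ≠ r.σ p → s.lab q = r.lab q ∧ t.lab q = r.lab q) ∧
    ∀ q, (q = p ∨ q = r.σ p) → r.lab q = a • s.lab q + b • t.lab q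

/-- Transport along a bijection of the end points. -/
def relabel (e : P ≃ Q) (s : Beaded H P) : Beaded H Q where
  toMatching := s.toMatching.relabel e
  lab q := s.lab (e.symm q)

open Classical in
/-- Put the bead `h` below the end point `p`. At `p` it comes below the bead of the arc, so that
it is multiplied from the left; at the other end it arrives over the maximum, as `S h`, above the
bead of the arc. -/
def bead (S : H ≃ₗ[k] H) (p : P) (h : H) (s : Beaded H P) : Beaded H P where
  toMatching := s.toMatching
  lab q := if q = p then h * s.lab q else if q = s.σ p then s.lab q * S h else s.lab q

/-- A new maximum without bead. A maximum whose legs are made to cross is a maximum with bead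
`G⁻¹`, which gives the description at the right end. -/
def cap (Ginv : H) (s : Beaded H Q) : Beaded H ((Unit ⊕ Unit) ⊕ Q) where
  toMatching := s.toMatching.cap
  lab
    | .inl (.inl _) => 1
    | .inl (.inr _) => Ginv
    | .inr q => s.lab q

/-- Join two neighbouring points by a minimum, the points being `inl (inl ())` (left) and
`inl (inr ())` (right). If they belong to two different arcs, these are merged and their beads are
multiplied: a zigzag maximum, minimum, maximum from the left to the right straightens to
a maximum, and its mirror image does so with an additional bead `G`. -/
def cup (G : H) (s : Beaded H ((Unit ⊕ Unit) ⊕ Q)) : Beaded H Q where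
  toMatching := s.toMatching.cup
  lab q :=
    match s.σ (.inr q) with
    | .inr _ => s.lab (.inr q)
    | .inl (.inl _) => s.lab (.inr q) * s.lab (.inl (.inr ()))
    | .inl (.inr _) => s.lab (.inr q) * G * s.lab (.inl (.inl ()))

open Classical in
/-- The scalar which arises when two neighbouring points are joined by a minimum: if they are the
ends of one arc, this arc becomes a closed component. Its bead `x` on the left leg is `S x` on the
right leg, so that it is evaluated to `l (S x)`. -/
def cupScalar (S : H ≃ₗ[k] H) (l : H →ₗ[k] k) (s : Beaded H ((Unit ⊕ Unit) ⊕ Q)) : k :=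
  if s.σ (.inl (.inl ())) = .inl (.inr ()) then l (S (s.lab (.inl (.inl ())))) else 1

theorem Comb.relabel (e : P ≃ Q) {a b : k} {s t r : Beaded H P} (h : Comb a b s t r) :
    Comb a b (s.relabel e) (t.relabel e) (r.relabel e) := by
  obtain ⟨h1, h2, p, h3, h4⟩ := h
  refine ⟨by simp [Beaded.relabel, h1], by simp [Beaded.relabel, h2], e p, ?_, ?_⟩
  · intro q hq hq'
    refine h3 (e.symm q) (fun h => hq (by simp [← h])) (fun h => hq' ?_)
    simp [Beaded.relabel, Matching.relabel, ← h]
  · intro q hq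
    refine h4 (e.symm q) ?_
    rcases hq with rfl | rfl
    · simp
    · right
      simp [Beaded.relabel, Matching.relabel]

theorem Comb.bead (S : H ≃ₗ[k] H) (p : P) (h : H) {a b : k} {s t r : Beaded H P}
    (hc : Comb a b s t r) : Comb a b (s.bead S p h) (t.bead S p h) (r.bead S p h) := by
  obtain ⟨μ, ls⟩ := s
  obtain ⟨μ₂, lt⟩ := t
  obtain ⟨μ₃, lr⟩ := r
  obtain ⟨h1, h2, p', h3, h4⟩ := hc
  simp only at h1 h2 h3 h4
  subst h1 h2
  refine ⟨rfl, rfl, p', ?_, ?_⟩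
  · intro q hq hq'
    obtain ⟨e1, e2⟩ := h3 q hq hq'
    simp [Beaded.bead, e1, e2]
  · intro q hq
    have e := h4 q hq
    simp only [Beaded.bead, e]
    split_ifs <;> simp [mul_add, add_mul]

theorem comb_bead (S : H ≃ₗ[k] H) (p : P) (a b : k) (h h' : H) (s : Beaded H P) :
    Comb a b (s.bead S p h) (s.bead S p h') (s.bead S p (a • h + b • h')) := by
  refine ⟨rfl, rfl, p, ?_, ?_⟩
  · intro q hq hq'
    simp only [Beaded.bead] at hq'
    simp [Beaded.bead, hq, hq']
  · intro q hq
    simp only [Beaded.bead] at hq ⊢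
    split_ifs with h1 h2
    · simp [add_mul]
    · simp [mul_add]
    · tauto

theorem Comb.cap (Ginv : H) {a b : k} {s t r : Beaded H Q} (h : Comb a b s t r) :
    Comb a b (s.cap Ginv) (t.cap Ginv) (r.cap Ginv) := by
  obtain ⟨h1, h2, p, h3, h4⟩ := h
  refine ⟨by simp [Beaded.cap, h1], by simp [Beaded.cap, h2], .inr p, ?_, ?_⟩
  · rintro ((_ | _) | q) hq hq'
    · simp [Beaded.cap]
    · simp [Beaded.cap]
    · exact h3 q (fun h => hq (by rw [h])) (fun h => hq' (by rw [h]; rfl))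
  · rintro q (rfl | rfl)
    · exact h4 p (.inl rfl)
    · exact h4 _ (.inr rfl)

theorem Comb.cup (S : H ≃ₗ[k] H) (l : H →ₗ[k] k) (G : H) {a b : k}
    {s t r : Beaded H ((Unit ⊕ Unit) ⊕ Q)} (h : Comb a b s t r) :
    (s.cup G = r.cup G ∧ t.cup G = r.cup G ∧
      r.cupScalar S l = a * s.cupScalar S l + b * t.cupScalar S l) ∨
    (Comb a b (s.cup G) (t.cup G) (r.cup G) ∧ s.cupScalar S l = r.cupScalar S l ∧
      t.cupScalar S l = r.cupScalar S l) := by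
  obtain ⟨μ, ls⟩ := s
  obtain ⟨μ₂, lt⟩ := t
  obtain ⟨μ₃, lr⟩ := r
  obtain ⟨h1, h2, p, h3, h4⟩ := h
  simp only at h1 h2 h3 h4
  subst h1 h2
  have hi := μ₂.invol
  have hn := μ₂.ne
  have key : ∀ p : (Unit ⊕ Unit) ⊕ Q, (∀ q, q ≠ p → q ≠ μ₂.σ p → ls q = lr q ∧ lt q = lr q) →
      (∀ q, (q = p ∨ q = μ₂.σ p) → lr q = a • ls q + b • lt q) → ∀ p₀, p = .inr p₀ →
      Comb a b (Beaded.cup G ⟨μ₂, ls⟩) (Beaded.cup G ⟨μ₂, lt⟩) (Beaded.cup G ⟨μ₂, lr⟩) ∧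
      cupScalar S l ⟨μ₂, ls⟩ = cupScalar S l ⟨μ₂, lr⟩ ∧
      cupScalar S l ⟨μ₂, lt⟩ = cupScalar S l ⟨μ₂, lr⟩ := by
    rintro p h3 h4 p₀ rfl
    refine ⟨⟨rfl, rfl, p₀, ?_, ?_⟩, ?_⟩
    · intro q hq hq'
      have hq1 : (Sum.inr q : (Unit ⊕ Unit) ⊕ Q) ≠ .inr p₀ := fun h => hq (Sum.inr_injective h)
      simp only [Beaded.cup, Matching.cup, Matching.cupFun] at hq' ⊢
      have i0 := hi (.inr q)
      have i1 := hi (.inr p₀)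
      rcases e : μ₂.σ (.inr q) with (⟨⟨⟩⟩ | ⟨⟨⟩⟩) | q₁ <;> rw [e] at i0
      · have c1 := h3 (.inr q) hq1 (by intro h; rw [h, i1] at e; simp at e)
        have c2 := h3 (.inl (.inr ())) (by simp) (by
          intro h; rw [← h] at hq'; rw [i0] at hq'; simp at hq')
        simp [c1, c2]
      · have c1 := h3 (.inr q) hq1 (by intro h; rw [h, i1] at e; simp at e)
        have c2 := h3 (.inl (.inl ())) (by simp) (by
          intro h; rw [← h] at hq'; rw [i0] at hq'; simp at hq')
        simp [c1, c2]
      · have c1 := h3 (.inr q) hq1 (by intro h; rw [← h] at hq'; simp at hq')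
        simp [c1]
    · intro q hq
      have i1 := hi (.inr p₀)
      have c0 := h4 (.inr p₀) (.inl rfl)
      simp only [Beaded.cup, Matching.cup, Matching.cupFun] at hq ⊢
      rcases e : μ₂.σ (.inr p₀) with (⟨⟨⟩⟩ | ⟨⟨⟩⟩) | q₁ <;> rw [e] at i1 hq
      · have c1 := h3 (.inl (.inr ())) (by simp) (by rw [e]; simp)
        have c2 := h4 (.inl (.inl ())) (by rw [e]; simp)
        have ib := hi (.inl (.inr ()))
        have nb := hn (.inl (.inr ()))
        rcases hq with rfl | hq
        · simp [e, c0, c1, add_mul]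
        · rcases e2 : μ₂.σ (.inl (.inr ())) with (⟨⟨⟩⟩ | ⟨⟨⟩⟩) | q₂ <;> rw [e2] at ib nb hq
          · rw [i1] at ib; simp at ib
          · simp at nb
          · simp only at hq
            subst hq
            have c3 := h3 (.inr q) (by intro h; rw [h] at ib; rw [e] at ib; simp at ib)
              (by rw [e]; simp)
            simp [ib, c2, c3, mul_add]
      · have c1 := h3 (.inl (.inl ())) (by simp) (by rw [e]; simp)
        have c2 := h4 (.inl (.inr ())) (by rw [e]; simp)
        have ib := hi (.inl (.inl ()))
        have nb := hn (.inl (.inl ()))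
        rcases hq with rfl | hq
        · simp [e, c0, c1, add_mul]
        · rcases e2 : μ₂.σ (.inl (.inl ())) with (⟨⟨⟩⟩ | ⟨⟨⟩⟩) | q₂ <;> rw [e2] at ib nb hq
          · simp at nb
          · rw [i1] at ib; simp at ib
          · simp only at hq
            subst hq
            have c3 := h3 (.inr q) (by intro h; rw [h] at ib; rw [e] at ib; simp at ib)
              (by rw [e]; simp)
            simp [ib, c2, c3, mul_add]
      · simp only at hq
        have c1 := h4 (.inr q₁) (by rw [e]; simp)
        rcases hq with rfl | rfl
        · simp [e, c0]
        · simp [i1, c1]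
    · simp only [cupScalar]
      split_ifs with hl
      · have c := h3 (.inl (.inl ())) (by simp) (by
          intro h; rw [h, hi] at hl; simp at hl)
        simp [c]
      · simp
  rcases p with x | p₀
  · rcases e : μ₂.σ (.inl x) with y | p₀
    · left
      have hl : μ₂.σ (.inl (.inl ())) = .inl (.inr ()) ∧
          μ₂.σ (.inl (.inr ())) = .inl (.inl ()) := by
        have i := hi (.inl x)
        have n := hn (.inl x)
        rw [e] at i n
        rcases x with ⟨⟨⟩⟩ | ⟨⟨⟩⟩ <;> rcases y with ⟨⟨⟩⟩ | ⟨⟨⟩⟩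
        · exact absurd rfl n
        · exact ⟨e, i⟩
        · exact ⟨i, e⟩
        · exact absurd rfl n
      have hlab : ∀ q, ls (.inr q) = lr (.inr q) ∧ lt (.inr q) = lr (.inr q) := fun q =>
        h3 _ (by simp) (by rw [e]; simp)
      have ca : lr (.inl (.inl ())) = a • ls (.inl (.inl ())) + b • lt (.inl (.inl ())) := by
        refine h4 _ ?_
        rcases x with ⟨⟨⟩⟩ | ⟨⟨⟩⟩
        · exact .inl rfl
        · exact .inr hl.2.symm
      have hσ : ∀ q, ∃ q', μ₂.σ (.inr q) = .inr q' := by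
        intro q
        have i := hi (.inr q)
        rcases e2 : μ₂.σ (.inr q) with (⟨⟨⟩⟩ | ⟨⟨⟩⟩) | q' <;> rw [e2] at i
        · rw [hl.1] at i; cases i
        · rw [hl.2] at i; cases i
        · exact ⟨q', rfl⟩
      refine ⟨?_, ?_, ?_⟩
      · ext q
        · rfl
        · obtain ⟨q', hq'⟩ := hσ q
          simp [Beaded.cup, hq', hlab q]
      · ext q
        · rfl
        · obtain ⟨q', hq'⟩ := hσ q
          simp [Beaded.cup, hq', hlab q]
      · simp [cupScalar, hl.1, ca]
    · right
      refine key (μ₂.σ (.inl x)) ?_ ?_ p₀ e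
      · intro q h h'
        exact h3 q (by rwa [hi] at h') h
      · intro q h
        exact h4 q (by rw [hi] at h; exact h.symm)
  · exact .inr (key _ h3 h4 p₀ rfl)

end Beaded

section Skein
variable (k H : Type*) [Field k] [Ring H] [Algebra k H]

/-- Formal sums of flat diagrams with beads, multilinear in the beads. -/
abbrev Skein (P : Type) :=
  (Beaded H P →₀ k) ⧸ Submodule.span k {x : Beaded H P →₀ k |
    ∃ (a b : k) (s t r : Beaded H P), Beaded.Comb a b s t r ∧
      x = Finsupp.single r 1 - a • Finsupp.single s 1 - b • Finsupp.single t 1}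

end Skein

namespace Skein
variable {k H : Type*} [Field k] [Ring H] [Algebra k H] {P Q : Type}
  {V : Type*} [AddCommGroup V] [Module k V]

variable (k) in
/-- A single flat diagram with beads. -/
def of (s : Beaded H P) : Skein k H P := Submodule.Quotient.mk (Finsupp.single s 1)

theorem of_comb {a b : k} {s t r : Beaded H P} (h : Beaded.Comb a b s t r) :
    of k r = a • of k s + b • of k t := by
  have : (Submodule.Quotient.mk
      (Finsupp.single r 1 - a • Finsupp.single s 1 - b • Finsupp.single t 1) : Skein k H P) = 0 :=
    (Submodule.Quotient.mk_eq_zero _).2 (Submodule.subset_span ⟨a, b, s, t, r, h, rfl⟩)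
  rw [Submodule.Quotient.mk_sub, Submodule.Quotient.mk_sub, Submodule.Quotient.mk_smul,
    Submodule.Quotient.mk_smul, sub_sub, sub_eq_zero] at this
  exact this

/-- The linear map determined by its (multilinear) values on flat diagrams with beads. -/
def lift (φ : Beaded H P → V)
    (hφ : ∀ (a b : k) (s t r : Beaded H P), Beaded.Comb a b s t r → φ r = a • φ s + b • φ t) :
    Skein k H P →ₗ[k] V :=
  Submodule.liftQ _ (Finsupp.linearCombination k φ) (by
    rw [Submodule.span_le]
    rintro x ⟨a, b, s, t, r, h, rfl⟩
    simp [hφ a b s t r h])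

@[simp] theorem lift_of (φ : Beaded H P → V)
    (hφ : ∀ (a b : k) (s t r : Beaded H P), Beaded.Comb a b s t r → φ r = a • φ s + b • φ t)
    (s : Beaded H P) : lift φ hφ (of k s) = φ s := by
  simp [lift, of]

theorem hom_ext {f g : Skein k H P →ₗ[k] V} (h : ∀ s, f (of k s) = g (of k s)) : f = g := by
  apply Submodule.linearMap_qext
  ext s
  exact h s

/-- Transport along a bijection of the end points. -/
def relabel (e : P ≃ Q) : Skein k H P →ₗ[k] Skein k H Q :=
  lift (fun s => of k (s.relabel e)) fun _ _ _ _ _ h => of_comb (h.relabel e)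

/-- Put a bead below the end point `p`, linearly in the bead. -/
def bead (S : H ≃ₗ[k] H) (p : P) : H →ₗ[k] Module.End k (Skein k H P) where
  toFun h := lift (fun s => of k (s.bead S p h)) fun _ _ _ _ _ hc => of_comb (hc.bead S p h)
  map_add' h h' := hom_ext fun s => by
    have := of_comb (Beaded.comb_bead S p 1 1 h h' s)
    simpa using this
  map_smul' a h := hom_ext fun s => by
    have := of_comb (Beaded.comb_bead S p a 0 h 0 s)
    simpa using this

/-- A new maximum without bead. -/
def cap (Ginv : H) : Skein k H Q →ₗ[k] Skein k H ((Unit ⊕ Unit) ⊕ Q) :=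
  lift (fun s => of k (s.cap Ginv)) fun _ _ _ _ _ h => of_comb (h.cap Ginv)

/-- A minimum without bead; a component that becomes closed is evaluated by `l`. -/
def cup (S : H ≃ₗ[k] H) (l : H →ₗ[k] k) (G : H) :
    Skein k H ((Unit ⊕ Unit) ⊕ Q) →ₗ[k] Skein k H Q :=
  lift (fun s => s.cupScalar S l • of k (s.cup G)) fun a b s t r h => by
    rcases h.cup S l G with ⟨h1, h2, h3⟩ | ⟨h1, h2, h3⟩
    · simp only [h1, h2, h3, add_smul, mul_smul]
    · rw [of_comb h1, h2, h3, smul_add, smul_comm a, smul_comm b]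

end Skein

/-- For linear maps `f : M → End V` and `g : N → End V`, the linear map
`x ⊗ y ↦ f(x) ∘ g(y)`. -/
def tensorAct {k M N V : Type*} [Field k] [AddCommGroup M] [Module k M] [AddCommGroup N]
    [Module k N] [AddCommGroup V] [Module k V]
    (f : M →ₗ[k] Module.End k V) (g : N →ₗ[k] Module.End k V) : M ⊗[k] N →ₗ[k] Module.End k V :=
  TensorProduct.lift ((LinearMap.mul k (Module.End k V)).compl₁₂ f g)

/-! ### The evaluation -/

namespace NormalizedUnimodular
variable {k H : Type*} [Field k] [Ring H] [Algebra k H] (D : NormalizedUnimodular k H)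

/-- The beads on a bundle `A` of parallel strands given by the iterated coproduct, bracketed
as `A`, of an element of `H`. -/
def bundle {P : Type} : (A : Brac) → (Pts A → P) → H →ₗ[k] Module.End k (Skein k H P)
  | .unit, _ => D.counit.toLinearMap.smulRight 1
  | .pt, ι => Skein.bead D.S (ι ())
  | .tensor A B, ι =>
      tensorAct (bundle A fun p => ι (.inl p)) (bundle B fun p => ι (.inr p)) ∘ₗ
        D.comul.toLinearMap

/-- The beads on three neighbouring bundles `A`, `B`, `C` given by an element of `H ⊗ H ⊗ H`,
for instance `(Δ_A ⊗ Δ_B ⊗ Δ_C)(Φ)`. -/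
def bundle₃ (A B C : Brac) (Q : Type) :
    H ⊗[k] (H ⊗[k] H) →ₗ[k] Module.End k (Skein k H ((Pts A ⊕ (Pts B ⊕ Pts C)) ⊕ Q)) :=
  tensorAct (D.bundle A fun p => .inl (.inl p))
    (tensorAct (D.bundle B fun p => .inl (.inr (.inl p)))
      (D.bundle C fun p => .inl (.inr (.inr p))))

/-- The beads on two neighbouring strands given by an element of `H ⊗ H`. -/
def pair (Q : Type) : H ⊗[k] H →ₗ[k] Module.End k (Skein k H ((Unit ⊕ Unit) ⊕ Q)) :=
  tensorAct (Skein.bead D.S (.inl (.inl ()))) (Skein.bead D.S (.inl (.inr ())))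

/-- The evaluation of a bracketed tangle diagram, as an operator on flat diagrams with beads.
Its generators are replaced by flat diagrams with beads: a crossing `c` by a flat crossing
with the beads `R = s ⊗ t` above it, `c⁻¹` by a flat crossing with the beads `R⁻¹` below it, a
maximum by a maximum with bead `β` on the left leg, a minimum by a minimum with bead `α` on
the right leg, and a change of brackets by `Φ^{±1}`, with coproducts applied to its factors
according to the brackets. Beads are collected, and closed components are evaluated by `λ`.
The diagram is placed below a flat diagram with end points `Pts A` and others, `Q`. -/
def run : {A B : Brac} → Tangle A B → (Q : Type) →
    Skein k H (Pts A ⊕ Q) →ₗ[k] Skein k H (Pts B ⊕ Q)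
  | _, _, .id _, _ => LinearMap.id
  | _, _, .comp T U, Q => run U Q ∘ₗ run T Q
  | _, _, @Tangle.tensor A B A' B' T U, Q =>
      Skein.relabel (Equiv.sumAssoc (Pts B) (Pts B') Q).symm ∘ₗ
        Skein.relabel (exchange (Pts B') (Pts B) Q) ∘ₗ run U (Pts B ⊕ Q) ∘ₗ
        Skein.relabel (exchange (Pts B) (Pts A') Q) ∘ₗ run T (Pts A' ⊕ Q) ∘ₗ
        Skein.relabel (Equiv.sumAssoc (Pts A) (Pts A') Q)
  | _, _, .assoc A B C, Q =>
      D.bundle₃ A B C Q D.phi ∘ₗ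
        Skein.relabel (Equiv.sumCongr (Equiv.sumAssoc (Pts A) (Pts B) (Pts C)) (Equiv.refl Q))
  | _, _, .assocInv A B C, Q =>
      Skein.relabel
          (Equiv.sumCongr (Equiv.sumAssoc (Pts A) (Pts B) (Pts C)).symm (Equiv.refl Q)) ∘ₗ
        D.bundle₃ A B C Q D.phiInv
  | _, _, .lunit A, Q =>
      Skein.relabel (Equiv.sumCongr (Equiv.emptySum Empty (Pts A)) (Equiv.refl Q))
  | _, _, .lunitInv A, Q =>
      Skein.relabel (Equiv.sumCongr (Equiv.emptySum Empty (Pts A)).symm (Equiv.refl Q))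
  | _, _, .runit A, Q =>
      Skein.relabel (Equiv.sumCongr (Equiv.sumEmpty (Pts A) Empty) (Equiv.refl Q))
  | _, _, .runitInv A, Q =>
      Skein.relabel (Equiv.sumCongr (Equiv.sumEmpty (Pts A) Empty).symm (Equiv.refl Q))
  | _, _, .cap, Q =>
      Skein.bead D.S (.inl (.inl ())) D.β ∘ₗ Skein.cap D.Ginv ∘ₗ
        Skein.relabel (Equiv.emptySum Empty Q)
  | _, _, .cup, Q =>
      Skein.relabel (Equiv.emptySum Empty Q).symm ∘ₗ Skein.cup D.S D.coint D.G ∘ₗ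
        Skein.bead D.S (.inl (.inr ())) D.α
  | _, _, .cross true, Q => Skein.relabel (swapPts Q) ∘ₗ D.pair Q D.r
  | _, _, .cross false, Q => D.pair Q D.rInv ∘ₗ Skein.relabel (swapPts Q)

/-- `m` maxima joining the points of each pair `(j⁻, j⁺)`, with bead `x j` on the left leg. -/
def capsBeaded {m : ℕ} (x : Fin m → H) : Beaded H (Pts (bar m) ⊕ Empty) where
  toMatching := capsMatching m
  lab
    | .inl p => if (barIx m p).2 then D.Ginv * D.S (x (barIx m p).1) else x (barIx m p).1
    | .inr e => e.elim

theorem comb_capsBeaded {m : ℕ} (x : Fin m → H) (i : Fin m) (a b : k) (y z : H) :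
    Beaded.Comb a b (D.capsBeaded (Function.update x i y)) (D.capsBeaded (Function.update x i z))
      (D.capsBeaded (Function.update x i (a • y + b • z))) := by
  refine ⟨rfl, rfl, .inl (barPt m i false), ?_, ?_⟩
  · rintro (p | e) h h'
    · have hp : (barIx m p).1 ≠ i := by
        intro e
        have ep := barPt_barIx m p
        rw [e] at ep
        cases hb : (barIx m p).2 <;> rw [hb] at ep
        · exact h (by rw [ep])
        · exact h' (by simp [capsBeaded, capsMatching, barIx_barPt, ep])
      simp [capsBeaded, hp]
    · exact e.elim
  · intro q hq
    rcases hq with rfl | rfl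
    · simp [capsBeaded, barIx_barPt]
    · simp [capsBeaded, capsMatching, barIx_barPt, mul_add]

theorem comb_tprod {n : ℕ} {a b : k} {s t r : Beaded H (Pts (bar n) ⊕ Empty)}
    (h : Beaded.Comb a b s t r) (hr : r.toMatching = capsMatching n) :
    PiTensorProduct.tprod k (fun i => r.lab (.inl (barPt n i false))) =
      a • PiTensorProduct.tprod k (fun i => s.lab (.inl (barPt n i false))) +
        b • PiTensorProduct.tprod k (fun i => t.lab (.inl (barPt n i false))) := by
  obtain ⟨-, -, p, h3, h4⟩ := h
  rcases p with p | e
  · have hσ : r.σ (.inl p) = .inl (barPt n (barIx n p).1 (!(barIx n p).2)) := by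
      rw [hr]
      rfl
    have hp := barPt_barIx n p
    set i := (barIx n p).1
    set c := (barIx n p).2
    have hi : ∀ j, j ≠ i → s.lab (.inl (barPt n j false)) = r.lab (.inl (barPt n j false)) ∧
        t.lab (.inl (barPt n j false)) = r.lab (.inl (barPt n j false)) := by
      intro j hj
      refine h3 _ ?_ ?_
      · rw [← hp]
        intro e
        have := congrArg (barIx n) (Sum.inl_injective e)
        simp only [barIx_barPt, Prod.mk.injEq] at this
        exact hj this.1
      · rw [hσ]
        intro e
        have := congrArg (barIx n) (Sum.inl_injective e)
        simp only [barIx_barPt, Prod.mk.injEq] at this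
        exact hj this.1
    have hl := h4 (.inl (barPt n i false)) (by
      rw [hσ, ← hp]
      cases c
      · exact .inl rfl
      · exact .inr rfl)
    have e1 : (fun j => r.lab (.inl (barPt n j false))) =
        Function.update (fun j => r.lab (.inl (barPt n j false))) i
          (a • s.lab (.inl (barPt n i false)) + b • t.lab (.inl (barPt n i false))) := by
      rw [← hl, Function.update_eq_self]
    have e2 : (fun j => s.lab (.inl (barPt n j false))) =
        Function.update (fun j => r.lab (.inl (barPt n j false))) i
          (s.lab (.inl (barPt n i false))) := by
      ext j
      by_cases hj : j = i
      · subst hj; simp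
      · simp [hj, (hi j hj).1]
    have e3 : (fun j => t.lab (.inl (barPt n j false))) =
        Function.update (fun j => r.lab (.inl (barPt n j false))) i
          (t.lab (.inl (barPt n i false))) := by
      ext j
      by_cases hj : j = i
      · subst hj; simp
      · simp [hj, (hi j hj).2]
    rw [e1, e2, e3, MultilinearMap.map_update_add, MultilinearMap.map_update_smul,
      MultilinearMap.map_update_smul]
  · exact e.elim

/-- The input of the evaluation of an even tangle diagram: an element `x₁ ⊗ ... ⊗ xₘ` becomes
the flat diagram of `m` maxima with these beads on their left legs. -/
def input (m : ℕ) : (⨂[k] _ : Fin m, H) →ₗ[k] Skein k H (Pts (bar m) ⊕ Empty) :=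
  PiTensorProduct.lift
    { toFun := fun x => Skein.of k (D.capsBeaded x)
      map_update_add' := fun {inst} x i y z => by
        obtain rfl : inst = instDecidableEqFin m := Subsingleton.elim _ _
        have h := D.comb_capsBeaded x i 1 1 y z
        simpa using Skein.of_comb h
      map_update_smul' := fun {inst} x i c y => by
        obtain rfl : inst = instDecidableEqFin m := Subsingleton.elim _ _
        have h := D.comb_capsBeaded x i c 0 y 0
        simpa using Skein.of_comb h }

open Classical in
/-- The output of the evaluation of an even tangle diagram: the beads on the left legs of the
`n` maxima joining the points of each pair `(i⁻, i⁺)`. (Flat diagrams in which the points are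
joined otherwise, which do not occur for even tangle diagrams, are sent to `0`.) -/
def output (n : ℕ) : Skein k H (Pts (bar n) ⊕ Empty) →ₗ[k] ⨂[k] _ : Fin n, H :=
  Skein.lift
    (fun s => if s.toMatching = capsMatching n then
      PiTensorProduct.tprod k (fun i => s.lab (.inl (barPt n i false))) else 0)
    (by
      intro a b s t r h
      obtain ⟨h1, h2, -⟩ := id h
      rw [h1, h2]
      split_ifs with hr
      · exact comb_tprod h hr
      · simp)

/-- The linear map `Ξ(T) : H^{⊗m} → H^{⊗n}` of an even tangle diagram. -/
def Xi {m n : ℕ} (T : EvenTangle m n) : (⨂[k] _ : Fin m, H) →ₗ[k] ⨂[k] _ : Fin n, H :=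
  output n ∘ₗ D.run T.1 Empty ∘ₗ D.input m

end NormalizedUnimodular

end

end Hennings

set_option maxSynthPendingDepth 5
set_option linter.unusedSectionVars false
set_option linter.unusedSimpArgs false

/-! The core is algebraic. Once `Δ(v⁻¹) = (v⁻¹ ⊗ v⁻¹) M` is known, centrality of `v` turns `(v⁻¹ ⊗
1) q_L M p_L` into `(1 ⊗ v) q_L Δ(v⁻¹) p_L`. It then remains to show that the slice of `q_L Δ(h)
p_L` by `λ` is the scalar `λ(α h S⁻¹(β))` for central `h` (`slice_qL_comul_pL`). The other framing
is the same with `v` and `v⁻¹` exchanged.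

The formula for `Δ(v)`. The ribbon axiom gives `Δ(G)` for `G = u v⁻¹`, so what is needed is `f Δ(u)
R₂₁ R = (S ⊗ S)(f₂₁) (u ⊗ u)`. Both `f` and `u` are values at `W = X ⊗ Y β S(Z)` (from `Φ⁻¹`) of
maps that absorb coproducts on the left. Two general facts about such maps, `zigzag_slide` and
`zigzag_alpha`, yield `f Δ(S(h)) = (S ⊗ S)(Δᵒᵖ(h)) f`, `f Δ(α) = γ`, `u h = S²(h) u` and `S(t) α s =
S(α) u`. The identity for `Δ(u)` then follows from an isotopy of two nested minima below crossings
(`contract_braid`).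

The slice. The cointegral equation reads `(λ ⊗ id)(U Δ(h) V) = λ(h) 1`. Pentagon computations
express `q_L` through `U` (`qLU_phi`) and `p_L` through `V` (`pLV_phiInv`), with coassociators `Φ`
and `Φ⁻¹` around them. Inside `λ` the two meet as `Φ Φ⁻¹ = 1`, provided that `λ(S(h) z) = λ(z
S⁻¹(h))`. This trace property (`coint_S_mul`) comes from a two-sided integral `Λ` with `λ(Λ) = 1`:
beads pass between the two factors of `U Δ(Λ) V` on either side, and finite dimension makes slicing
injective.

Diagrams. Elements of `H` placed on bundles of strands act on the space of beaded flat diagrams by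
unital multiplicative maps with commuting images for disjoint bundles. All identities for `Φ` and
`R` are therefore stated for such "legs" in any algebra, and serve both for tensor powers of `H` and
for diagrams. Crossings of bundles are braidings of legs by the hexagons; a kink is the bead `G⁻¹ u
= v`, or `v⁻¹` for the opposite crossing; a full twist on `A` is `Δ_A(v^{±1})` by the formula for
`Δ(v^{±1})`. A circle around a bundle carries `Φ` at its maximum and `Φ⁻¹` at its minimum, which
become `p_L` and `q_L`, so that it evaluates to a slice of `q_L M^{±1} p_L`. Both sides of the move
thus give the same operator, and the evaluation is compositional, so the move may be applied
anywhere. -/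

namespace Hennings

noncomputable section

/-! ### Commuting legs

Elements of tensor powers of `H` are placed on commuting copies of `H` in an algebra `A`. -/

section Legs
variable {k : Type*} [Field k] {A : Type*} [Ring A] [Algebra k A]
  {M N M' N' : Type*} [AddCommMonoid M] [Module k M] [AddCommMonoid N] [Module k N]
  [AddCommMonoid M'] [Module k M'] [AddCommMonoid N'] [Module k N']
  {B B' : Type*} [Ring B] [Algebra k B] [Ring B'] [Algebra k B']

/-- `x ⊗ y ↦ f x * g y` -/
def two (f : M →ₗ[k] A) (g : N →ₗ[k] A) : M ⊗[k] N →ₗ[k] A :=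
  TensorProduct.lift ((LinearMap.mul k A).compl₁₂ f g)

@[simp] theorem two_tmul (f : M →ₗ[k] A) (g : N →ₗ[k] A) (x : M) (y : N) :
    two f g (x ⊗ₜ y) = f x * g y := by
  simp [two]

/-- `f` is unital and multiplicative. -/
class IsLeg [Mul M] [One M] (f : M →ₗ[k] A) : Prop where
  map_one' : f 1 = 1
  map_mul' : ∀ x y, f (x * y) = f x * f y

theorem leg_one [Mul M] [One M] (f : M →ₗ[k] A) [IsLeg f] : f 1 = 1 := IsLeg.map_one'

theorem leg_mul [Mul M] [One M] (f : M →ₗ[k] A) [IsLeg f] (x y : M) : f (x * y) = f x * f y :=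
  IsLeg.map_mul' x y

/-- The values of `f` commute with those of `g`. -/
class Commuting (f : M →ₗ[k] A) (g : N →ₗ[k] A) : Prop where
  comm' : ∀ x y, f x * g y = g y * f x

theorem leg_comm (f : M →ₗ[k] A) (g : N →ₗ[k] A) [Commuting f g] (x : M) (y : N) :
    f x * g y = g y * f x := Commuting.comm' x y

instance Commuting.symm (f : M →ₗ[k] A) (g : N →ₗ[k] A) [Commuting g f] : Commuting f g :=
  ⟨fun x y => (leg_comm g f y x).symm⟩

instance Commuting.two_left (f : M →ₗ[k] A) (g : N →ₗ[k] A) (h : M' →ₗ[k] A) [Commuting f h]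
    [Commuting g h] : Commuting (two f g) h :=
  ⟨fun x y => by
    induction x using TensorProduct.induction_on with
    | zero => simp
    | tmul a b => rw [two_tmul, mul_assoc, leg_comm g h, ← mul_assoc, leg_comm f h, mul_assoc]
    | add a b ha hb => rw [map_add, add_mul, ha, hb, mul_add]⟩

instance IsLeg.two (f : B →ₗ[k] A) (g : B' →ₗ[k] A) [IsLeg f] [IsLeg g] [Commuting f g] :
    IsLeg (two f g) where
  map_one' := by rw [Algebra.TensorProduct.one_def, two_tmul, leg_one, leg_one, one_mul]
  map_mul' x y := by
    induction x using TensorProduct.induction_on with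
    | zero => simp
    | add a b ha hb => rw [add_mul, map_add, map_add, ha, hb, add_mul]
    | tmul a b =>
      induction y using TensorProduct.induction_on with
      | zero => simp
      | add c d hc hd => rw [mul_add, map_add, map_add, hc, hd, mul_add]
      | tmul c d =>
        rw [Algebra.TensorProduct.tmul_mul_tmul, two_tmul, two_tmul, two_tmul, leg_mul, leg_mul,
          mul_assoc, mul_assoc, ← mul_assoc (f c), ← mul_assoc (g b), leg_comm f g c b]

theorem two_map (f : M →ₗ[k] A) (g : N →ₗ[k] A) (φ : M' →ₗ[k] M) (ψ : N' →ₗ[k] N)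
    (t : M' ⊗[k] N') : two f g (TensorProduct.map φ ψ t) = two (f ∘ₗ φ) (g ∘ₗ ψ) t := by
  induction t using TensorProduct.induction_on with
  | zero => simp
  | tmul a b => simp
  | add a b ha hb => rw [map_add, map_add, ha, hb, map_add]

theorem two_assoc (f : M →ₗ[k] A) (g : N →ₗ[k] A) (h : M' →ₗ[k] A) (t : (M ⊗[k] N) ⊗[k] M') :
    two f (two g h) (TensorProduct.assoc k M N M' t) = two (two f g) h t := by
  have : two f (two g h) ∘ₗ (TensorProduct.assoc k M N M').toLinearMap = two (two f g) h := by
    ext a b c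
    simp [mul_assoc]
  exact LinearMap.congr_fun this t

theorem two_comm (f : M →ₗ[k] A) (g : N →ₗ[k] A) [Commuting f g] (t : N ⊗[k] M) :
    two f g (TensorProduct.comm k N M t) = two g f t := by
  have : two f g ∘ₗ (TensorProduct.comm k N M).toLinearMap = two g f := by
    ext a b
    simpa using leg_comm f g b a
  exact LinearMap.congr_fun this t

/-- If `a` intertwines `F` and `G`, it does so next to a leg commuting with it. -/
theorem intertwine_left {a : A} {F G : M →ₗ[k] A} (w : N →ₗ[k] A)
    (h : ∀ x, a * F x = G x * a) (hw : ∀ y, a * w y = w y * a) (t : M ⊗[k] N) :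
    a * two F w t = two G w t * a := by
  induction t using TensorProduct.induction_on with
  | zero => simp
  | tmul x y => rw [two_tmul, two_tmul, ← mul_assoc, h, mul_assoc, hw, mul_assoc]
  | add x y hx hy => rw [map_add, map_add, mul_add, hx, hy, add_mul]

theorem intertwine_right {a : A} {F G : M →ₗ[k] A} (w : N →ₗ[k] A)
    (h : ∀ x, a * F x = G x * a) (hw : ∀ y, a * w y = w y * a) (t : N ⊗[k] M) :
    a * two w F t = two w G t * a := by
  induction t using TensorProduct.induction_on with
  | zero => simp
  | tmul x y => rw [two_tmul, two_tmul, ← mul_assoc, hw, mul_assoc, h, mul_assoc]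
  | add x y hx hy => rw [map_add, map_add, mul_add, hx, hy, add_mul]

/-! ### Functionals which do not distinguish legs -/

variable {V : Type*} [AddCommGroup V] [Module k V]

/-- `E (F y * T) = E (F' y * T)` -/
def EqL (E : A →ₗ[k] V) (F F' : M →ₗ[k] A) : Prop := ∀ y T, E (F y * T) = E (F' y * T)

/-- `E (T * F y) = E (T * F' y)` -/
def EqR (E : A →ₗ[k] V) (F F' : M →ₗ[k] A) : Prop := ∀ y T, E (T * F y) = E (T * F' y)

theorem EqL.left {E : A →ₗ[k] V} {F F' : M →ₗ[k] A} (h : EqL E F F') (g : N →ₗ[k] A) :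
    EqL E (two F g) (two F' g) := by
  intro t T
  induction t using TensorProduct.induction_on with
  | zero => simp
  | tmul x y => rw [two_tmul, two_tmul, mul_assoc, mul_assoc, h]
  | add x y hx hy => rw [map_add, map_add, add_mul, map_add, hx, hy, add_mul, map_add]

/-- `EqL` compares values standing leftmost in a product. A leg multiplied in front has to be
commuted past `F` and `F'`, unlike one multiplied behind. -/
theorem EqL.right {E : A →ₗ[k] V} {F F' : M →ₗ[k] A} (h : EqL E F F') (g : N →ₗ[k] A)
    [Commuting F g] [Commuting F' g] : EqL E (two g F) (two g F') := by
  intro t T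
  induction t using TensorProduct.induction_on with
  | zero => simp
  | tmul x y =>
    rw [two_tmul, two_tmul, ← leg_comm F g, ← leg_comm F' g, mul_assoc, mul_assoc, h]
  | add x y hx hy => rw [map_add, map_add, add_mul, map_add, hx, hy, add_mul, map_add]

theorem EqR.right {E : A →ₗ[k] V} {F F' : M →ₗ[k] A} (h : EqR E F F') (g : N →ₗ[k] A) :
    EqR E (two g F) (two g F') := by
  intro t T
  induction t using TensorProduct.induction_on with
  | zero => simp
  | tmul x y => rw [two_tmul, two_tmul, ← mul_assoc, ← mul_assoc, h]
  | add x y hx hy => rw [map_add, map_add, mul_add, map_add, hx, hy, mul_add, map_add]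

theorem EqR.left {E : A →ₗ[k] V} {F F' : M →ₗ[k] A} (h : EqR E F F') (g : N →ₗ[k] A)
    [Commuting F g] [Commuting F' g] : EqR E (two F g) (two F' g) := by
  intro t T
  induction t using TensorProduct.induction_on with
  | zero => simp
  | tmul x y =>
    rw [two_tmul, two_tmul, leg_comm F g, leg_comm F' g, ← mul_assoc, ← mul_assoc, h]
  | add x y hx hy => rw [map_add, map_add, mul_add, map_add, hx, hy, mul_add, map_add]

end Legs

/-! ### Quasi-bialgebras -/

namespace QuasiBialgebra
variable {k H : Type*} [Field k] [Ring H] [Algebra k H] (D : QuasiBialgebra k H)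
  {A : Type*} [Ring A] [Algebra k A]
  {N : Type*} [AddCommMonoid N] [Module k N]

/-- The leg `x ↦ f x' * g x''`. -/
def cop (f g : H →ₗ[k] A) : H →ₗ[k] A := two f g ∘ₗ D.comul.toLinearMap

variable (A) in
/-- The leg `x ↦ ε x`. -/
def eps : H →ₗ[k] A := Algebra.linearMap k A ∘ₗ D.counit.toLinearMap

theorem cop_apply (f g : H →ₗ[k] A) (x : H) : D.cop f g x = two f g (D.comul x) := rfl

theorem eps_apply (x : H) : D.eps A x = algebraMap k A (D.counit x) := rfl

instance (f g : H →ₗ[k] A) [IsLeg f] [IsLeg g] [Commuting f g] : IsLeg (D.cop f g) where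
  map_one' := by rw [cop_apply, map_one, leg_one]
  map_mul' x y := by rw [cop_apply, map_mul, leg_mul]; rfl

instance (f g : H →ₗ[k] A) (h : N →ₗ[k] A) [Commuting f h] [Commuting g h] :
    Commuting (D.cop f g) h :=
  ⟨fun x y => leg_comm (two f g) h (D.comul x) y⟩

instance : IsLeg (D.eps A) where
  map_one' := by rw [eps_apply, map_one, map_one]
  map_mul' x y := by rw [eps_apply, map_mul, map_mul]; rfl

instance (h : N →ₗ[k] A) : Commuting (D.eps A) h :=
  ⟨fun x y => Algebra.commutes (D.counit x) (h y)⟩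

/-- The coassociator on three legs. -/
def Ph (f g h : H →ₗ[k] A) : A := two f (two g h) (D.Phi : H ⊗[k] (H ⊗[k] H))

/-- The inverse coassociator on three legs. -/
def PhI (f g h : H →ₗ[k] A) : A :=
  two f (two g h) ((D.Phi⁻¹ : (H ⊗[k] (H ⊗[k] H))ˣ) : H ⊗[k] (H ⊗[k] H))

section
variable (f g h w : H →ₗ[k] A) [IsLeg f] [IsLeg g] [IsLeg h] [IsLeg w] [Commuting f g]
  [Commuting f h] [Commuting f w] [Commuting g h] [Commuting g w] [Commuting h w]

theorem Ph_mul_PhI : D.Ph f g h * D.PhI f g h = 1 := by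
  rw [Ph, PhI, ← leg_mul, Units.mul_inv, leg_one]

theorem PhI_mul_Ph : D.PhI f g h * D.Ph f g h = 1 := by
  rw [Ph, PhI, ← leg_mul, Units.inv_mul, leg_one]

theorem Ph_mul_PhI_assoc (a : A) : D.Ph f g h * (D.PhI f g h * a) = a := by
  rw [← mul_assoc, Ph_mul_PhI, one_mul]

theorem PhI_mul_Ph_assoc (a : A) : D.PhI f g h * (D.Ph f g h * a) = a := by
  rw [← mul_assoc, PhI_mul_Ph, one_mul]

theorem Ph_nat (x : H) :
    D.Ph f g h * D.cop (D.cop f g) h x = D.cop f (D.cop g h) x * D.Ph f g h := by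
  have e := congrArg (two f (two g h)) (D.quasi_coassoc x)
  rw [leg_mul, leg_mul] at e
  have e1 : two f (two g h) (Algebra.TensorProduct.map (AlgHom.id k H) D.comul (D.comul x)) =
      D.cop f (D.cop g h) x :=
    two_map f (two g h) (LinearMap.id : H →ₗ[k] H) D.comul.toLinearMap (D.comul x)
  have e2 : two f (two g h) (Algebra.TensorProduct.assoc k k k H H H
      (Algebra.TensorProduct.map D.comul (AlgHom.id k H) (D.comul x))) =
      D.cop (D.cop f g) h x :=
    (two_assoc f g h _).trans
      (two_map (two f g) h D.comul.toLinearMap (LinearMap.id : H →ₗ[k] H) (D.comul x))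
  rw [e1, e2] at e
  exact e.symm

theorem PhI_nat (x : H) :
    D.PhI f g h * D.cop f (D.cop g h) x = D.cop (D.cop f g) h x * D.PhI f g h := by
  have e := congrArg (fun y => D.PhI f g h * y * D.PhI f g h) (D.Ph_nat f g h x)
  simp only [mul_assoc, Ph_mul_PhI, mul_one] at e
  rw [PhI_mul_Ph_assoc] at e
  exact e.symm

theorem four_mul (s t : H ⊗[k] (H ⊗[k] (H ⊗[k] H))) : two f (two g (two h w)) (s * t) =
    two f (two g (two h w)) s * two f (two g (two h w)) t :=
  (IsLeg.two (B := H) (B' := H ⊗[k] (H ⊗[k] H)) f (two g (two h w))).map_mul' s t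

theorem four_comul_left (t : H ⊗[k] (H ⊗[k] H)) :
    two f (two g (two h w)) (Algebra.TensorProduct.assoc k k k H H (H ⊗[k] H)
        (Algebra.TensorProduct.map D.comul (AlgHom.id k (H ⊗[k] H)) t)) =
      two (D.cop f g) (two h w) t :=
  (two_assoc f g (two h w) _).trans
    (two_map (two f g) (two h w) D.comul.toLinearMap (LinearMap.id : H ⊗[k] H →ₗ[k] H ⊗[k] H) t)

theorem four_tmul_one (t : H ⊗[k] (H ⊗[k] H)) :
    two f (two g (two h w)) (Algebra.TensorProduct.map (AlgHom.id k H)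
        (Algebra.TensorProduct.assoc k k k H H H).toAlgHom
        (Algebra.TensorProduct.assoc k k k H (H ⊗[k] H) H (t ⊗ₜ[k] (1 : H)))) =
      two f (two g h) t := by
  refine (two_map f (two g (two h w)) (LinearMap.id : H →ₗ[k] H)
    (TensorProduct.assoc k H H H).toLinearMap _).trans ?_
  have : two g (two h w) ∘ₗ (TensorProduct.assoc k H H H).toLinearMap = two (two g h) w :=
    LinearMap.ext fun t => two_assoc g h w t
  rw [this]
  refine (two_assoc f (two g h) w (t ⊗ₜ[k] (1 : H))).trans ?_
  rw [two_tmul, leg_one, mul_one]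

/-- Stated for arbitrary commuting legs, the axiom applies to permuted tensor factors and to beads
on bundles alike. -/
theorem Ph_pentagon : D.Ph f g (D.cop h w) * D.Ph (D.cop f g) h w =
    D.Ph g h w * D.Ph f (D.cop g h) w * D.Ph f g h := by
  have e := congrArg (two f (two g (two h w))) D.pentagon
  rw [four_mul, four_mul, four_mul] at e
  set Φ : H ⊗[k] (H ⊗[k] H) := (D.Phi : H ⊗[k] (H ⊗[k] H)) with hΦ
  have e1 : two f (two g (two h w)) (Algebra.TensorProduct.map (AlgHom.id k H)
      (Algebra.TensorProduct.map (AlgHom.id k H) D.comul) Φ) = D.Ph f g (D.cop h w) := by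
    refine (two_map f (two g (two h w)) (LinearMap.id : H →ₗ[k] H)
      (TensorProduct.map (LinearMap.id : H →ₗ[k] H) D.comul.toLinearMap) Φ).trans ?_
    congr 2
    ext x y
    simp [cop_apply]
  have e3 : two f (two g (two h w)) ((1 : H) ⊗ₜ[k] Φ) = D.Ph g h w := by
    rw [two_tmul, leg_one, one_mul]; rfl
  have e4 : two f (two g (two h w)) (Algebra.TensorProduct.map (AlgHom.id k H)
        (((Algebra.TensorProduct.assoc k k k H H H).toAlgHom).comp
          (Algebra.TensorProduct.map D.comul (AlgHom.id k H))) Φ) = D.Ph f (D.cop g h) w := by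
    refine (two_map f (two g (two h w)) (LinearMap.id : H →ₗ[k] H)
      ((TensorProduct.assoc k H H H).toLinearMap ∘ₗ
        TensorProduct.map D.comul.toLinearMap (LinearMap.id : H →ₗ[k] H)) Φ).trans ?_
    congr 2
    ext x y
    exact two_assoc g h w (D.comul x ⊗ₜ[k] y)
  rw [e1, four_comul_left, e3, e4, four_tmul_one] at e
  exact e

theorem PhI_pentagon : D.PhI (D.cop f g) h w * D.PhI f g (D.cop h w) =
    D.PhI f g h * D.PhI f (D.cop g h) w * D.PhI g h w := by
  have h1 : D.Ph f g (D.cop h w) * D.Ph (D.cop f g) h w *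
      (D.PhI (D.cop f g) h w * D.PhI f g (D.cop h w)) = 1 := by
    rw [mul_assoc, Ph_mul_PhI_assoc, Ph_mul_PhI]
  have h2 : D.PhI f g h * D.PhI f (D.cop g h) w * D.PhI g h w *
      (D.Ph g h w * D.Ph f (D.cop g h) w * D.Ph f g h) = 1 := by
    simp only [mul_assoc]
    rw [PhI_mul_Ph_assoc, PhI_mul_Ph_assoc, PhI_mul_Ph]
  rw [← Ph_pentagon] at h2
  exact (left_inv_eq_right_inv h2 h1).symm
end

theorem cop_eps_left (f : H →ₗ[k] A) : D.cop (D.eps A) f = f := by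
  ext x
  conv_rhs => rw [← D.counit_left x]
  rw [cop_apply]
  induction D.comul x using TensorProduct.induction_on with
  | zero => simp
  | tmul a b => simp [eps_apply, ← Algebra.smul_def]
  | add a b ha hb => simp only [map_add, ha, hb]

theorem cop_eps_right (f : H →ₗ[k] A) : D.cop f (D.eps A) = f := by
  ext x
  conv_rhs => rw [← D.counit_right x]
  rw [cop_apply]
  induction D.comul x using TensorProduct.induction_on with
  | zero => simp
  | tmul a b => simp [eps_apply, ← Algebra.smul_def, ← Algebra.commutes]
  | add a b ha hb => simp only [map_add, ha, hb]

section
variable (f g : H →ₗ[k] A) [IsLeg f] [IsLeg g] [Commuting f g]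

theorem Ph_eps_mid : D.Ph f (D.eps A) g = 1 := by
  have e := congrArg (two f g) D.counit_Phi
  rw [leg_one] at e
  rw [← e]
  refine Eq.trans ?_ (two_map f g (LinearMap.id : H →ₗ[k] H)
    ((TensorProduct.lid k H).toLinearMap ∘ₗ
      TensorProduct.map D.counit.toLinearMap (LinearMap.id : H →ₗ[k] H)) D.Phi).symm
  rw [Ph]
  congr 2
  ext x y
  simp [eps_apply, ← Algebra.smul_def]

/-- Only the middle normalisation is an axiom. The pentagon with counits on its first two legs makes
`Φ` on `ε, f, g` idempotent, and an invertible idempotent is `1`. -/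
theorem Ph_eps_left : D.Ph (D.eps A) f g = 1 := by
  have e := D.Ph_pentagon (D.eps A) (D.eps A) f g
  rw [cop_eps_left, Ph_eps_mid, cop_eps_left, Ph_eps_mid, one_mul, mul_one] at e
  have := congrArg (fun y => D.PhI (D.eps A) f g * y) e
  simpa only [PhI_mul_Ph, PhI_mul_Ph_assoc, eq_comm] using this

theorem Ph_eps_right : D.Ph f g (D.eps A) = 1 := by
  have e := D.Ph_pentagon f g (D.eps A) (D.eps A)
  rw [cop_eps_left, Ph_eps_mid, cop_eps_right, Ph_eps_mid, one_mul, mul_one] at e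
  have := congrArg (fun y => D.PhI f g (D.eps A) * y) e
  simpa only [PhI_mul_Ph, PhI_mul_Ph_assoc, eq_comm] using this

theorem PhI_eps_mid : D.PhI f (D.eps A) g = 1 := by
  have := D.Ph_mul_PhI f (D.eps A) g
  rwa [Ph_eps_mid, one_mul] at this

theorem PhI_eps_left : D.PhI (D.eps A) f g = 1 := by
  have := D.Ph_mul_PhI (D.eps A) f g
  rwa [Ph_eps_left, one_mul] at this

theorem PhI_eps_right : D.PhI f g (D.eps A) = 1 := by
  have := D.Ph_mul_PhI f g (D.eps A)
  rwa [Ph_eps_right, one_mul] at this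
end

end QuasiBialgebra

/-! ### R-matrices -/

namespace QuasitriangularQuasiHopf
open QuasiBialgebra
variable {k H : Type*} [Field k] [Ring H] [Algebra k H] (D : QuasitriangularQuasiHopf k H)
  {A : Type*} [Ring A] [Algebra k A]

/-- The element giving the braiding (`true`) or its inverse (`false`). -/
def rs : Bool → H ⊗[k] H
  | true => D.r
  | false => QuasiHopf.flip D.rInv

/-- The braiding on two legs. -/
def Br (s : Bool) (f g : H →ₗ[k] A) : A := two f g (D.rs s)

section
variable (f g h : H →ₗ[k] A) [IsLeg f] [IsLeg g] [IsLeg h] [Commuting f g]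
  [Commuting f h] [Commuting g h]

theorem Br_false : D.Br false f g = two g f D.rInv :=
  two_comm f g D.rInv

/-- The negative braiding is built from `R₂₁⁻¹`, so that opposite signs are inverse to each other
once the legs are exchanged. -/
theorem Br_mul_Br : ∀ s, D.Br s f g * D.Br (!s) g f = 1
  | true => by
    rw [Bool.not_true, Br_false, Br, ← leg_mul, rs, r, rInv, Units.mul_inv, leg_one]
  | false => by
    rw [Bool.not_false, Br_false, Br, ← leg_mul, rs, r, rInv, Units.inv_mul, leg_one]

theorem Br_mul_Br_assoc (s : Bool) (a : A) : D.Br s f g * (D.Br (!s) g f * a) = a := by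
  rw [← mul_assoc, Br_mul_Br, one_mul]

theorem Br_nat (s : Bool) (x : H) : D.Br s f g * D.cop f g x = D.cop g f x * D.Br s f g := by
  have key : ∀ (f g : H →ₗ[k] A) [IsLeg f] [IsLeg g] [Commuting f g],
      D.Br true f g * D.cop f g x = D.cop g f x * D.Br true f g := by
    intro f g _ _ _
    have e := congrArg (two f g) (D.R_comul x)
    rw [leg_mul, leg_mul] at e
    have e1 : two f g (Algebra.TensorProduct.comm k H H (D.comul x)) = D.cop g f x :=
      two_comm f g (D.comul x)
    rw [e1] at e
    exact e.symm
  cases s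
  · have e := congrArg (fun y => D.Br false f g * y * D.Br false f g) (key g f)
    have e1 := D.Br_mul_Br f g false
    have e2 := D.Br_mul_Br g f true
    simp only [Bool.not_false, Bool.not_true] at e1 e2
    simp only [mul_assoc, e2, mul_one] at e
    rw [← mul_assoc, e1, one_mul] at e
    exact e.symm
  · exact key f g

theorem Br_hexagon_left_true : D.Br true (D.cop f g) h =
    D.Ph h f g * D.Br true f h * D.PhI f h g * D.Br true g h * D.Ph f g h := by
  have e := congrArg (two f (two g h)) D.hexagon_left
  rw [leg_mul, leg_mul, leg_mul, leg_mul] at e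
  have e0 : two f (two g h) (Algebra.TensorProduct.assoc k k k H H H
      (Algebra.TensorProduct.map D.comul (AlgHom.id k H) (D.R : H ⊗[k] H))) =
      D.Br true (D.cop f g) h :=
    (two_assoc f g h _).trans
      (two_map (two f g) h D.comul.toLinearMap (LinearMap.id : H →ₗ[k] H) D.R)
  have e1 : two f (two g h) (Algebra.TensorProduct.assoc k k k H H H
      (Algebra.TensorProduct.comm k H (H ⊗[k] H) (D.Phi : H ⊗[k] (H ⊗[k] H)))) = D.Ph h f g :=
    (two_assoc f g h _).trans (two_comm (two f g) h (D.Phi : H ⊗[k] (H ⊗[k] H)))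
  have e2 : two f (two g h) (Algebra.TensorProduct.map (AlgHom.id k H)
      (Algebra.TensorProduct.includeRight : H →ₐ[k] H ⊗[k] H) (D.R : H ⊗[k] H)) =
      D.Br true f h := by
    refine (two_map f (two g h) (LinearMap.id : H →ₗ[k] H)
      (Algebra.TensorProduct.includeRight : H →ₐ[k] H ⊗[k] H).toLinearMap D.R).trans ?_
    rw [Br]
    congr 2
    ext x
    simp [leg_one]
  have e3 : two f (two g h) (Algebra.TensorProduct.map (AlgHom.id k H)
      (Algebra.TensorProduct.comm k H H).toAlgHom
          ((D.Phi⁻¹ : (H ⊗[k] (H ⊗[k] H))ˣ) : H ⊗[k] (H ⊗[k] H))) = D.PhI f h g := by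
    refine (two_map f (two g h) (LinearMap.id : H →ₗ[k] H)
      (TensorProduct.comm k H H).toLinearMap _).trans ?_
    have : two g h ∘ₗ (TensorProduct.comm k H H).toLinearMap = two h g :=
      LinearMap.ext fun t => two_comm g h t
    rw [this]
    rfl
  have e4 : two f (two g h) ((1 : H) ⊗ₜ[k] (D.R : H ⊗[k] H)) = D.Br true g h := by
    rw [two_tmul, leg_one, one_mul]; rfl
  rw [e0, e1, e2, e3, e4] at e
  exact e

theorem Br_hexagon_right_true : D.Br true f (D.cop g h) =
    D.PhI g h f * D.Br true f h * D.Ph g f h * D.Br true f g * D.PhI f g h := by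
  have e := congrArg (two f (two g h)) D.hexagon_right
  rw [leg_mul, leg_mul, leg_mul, leg_mul] at e
  have e0 : two f (two g h) (Algebra.TensorProduct.map (AlgHom.id k H) D.comul
      (D.R : H ⊗[k] H)) = D.Br true f (D.cop g h) :=
    two_map f (two g h) (LinearMap.id : H →ₗ[k] H) D.comul.toLinearMap D.R
  have e1 : two f (two g h) (Algebra.TensorProduct.comm k (H ⊗[k] H) H
      ((Algebra.TensorProduct.assoc k k k H H H).symm
          ((D.Phi⁻¹ : (H ⊗[k] (H ⊗[k] H))ˣ) : H ⊗[k] (H ⊗[k] H)))) = D.PhI g h f := by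
    refine (two_comm f (two g h) _).trans ?_
    rw [← two_assoc g h f]
    exact congrArg (two g (two h f)) (LinearEquiv.apply_symm_apply
      (TensorProduct.assoc k H H H) ((D.Phi⁻¹ : (H ⊗[k] (H ⊗[k] H))ˣ) : H ⊗[k] (H ⊗[k] H)))
  have e2 : two f (two g h) (Algebra.TensorProduct.map (AlgHom.id k H)
      (Algebra.TensorProduct.includeRight : H →ₐ[k] H ⊗[k] H) (D.R : H ⊗[k] H)) =
      D.Br true f h := by
    refine (two_map f (two g h) (LinearMap.id : H →ₗ[k] H)
      (Algebra.TensorProduct.includeRight : H →ₐ[k] H ⊗[k] H).toLinearMap D.R).trans ?_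
    rw [Br]
    congr 2
    ext x
    simp [leg_one]
  have e3 : two f (two g h) (Algebra.TensorProduct.leftComm k H H H
      (D.Phi : H ⊗[k] (H ⊗[k] H))) = D.Ph g f h := by
    have : two f (two g h) ∘ₗ (TensorProduct.leftComm k H H H).toLinearMap =
        two g (two f h) := by
      ext x y z
      simp only [TensorProduct.AlgebraTensorModule.curry_apply, TensorProduct.curry_apply,
        LinearMap.coe_restrictScalars, LinearMap.comp_apply, LinearEquiv.coe_coe,
        TensorProduct.leftComm_tmul, two_tmul]
      rw [← mul_assoc, leg_comm f g, mul_assoc]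
    exact LinearMap.congr_fun this _
  have e4 : two f (two g h) (Algebra.TensorProduct.map (AlgHom.id k H)
      (Algebra.TensorProduct.includeLeft : H →ₐ[k] H ⊗[k] H) (D.R : H ⊗[k] H)) =
      D.Br true f g := by
    refine (two_map f (two g h) (LinearMap.id : H →ₗ[k] H)
      (Algebra.TensorProduct.includeLeft : H →ₐ[k] H ⊗[k] H).toLinearMap D.R).trans ?_
    rw [Br]
    congr 2
    ext x
    simp [leg_one]
  rw [e0, e1, e2, e3, e4] at e
  exact e

/-- Inverting the other hexagon for `R` gives this one for the negative braiding, so both signs obey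
the same formula. -/
theorem Br_hexagon_left (s : Bool) : D.Br s (D.cop f g) h =
    D.Ph h f g * D.Br s f h * D.PhI f h g * D.Br s g h * D.Ph f g h := by
  cases s
  · have e := D.Br_hexagon_right_true h f g
    have h1 := D.Br_mul_Br (D.cop f g) h false
    have h2 : D.Br true h (D.cop f g) *
        (D.Ph h f g * D.Br false f h * D.PhI f h g * D.Br false g h * D.Ph f g h) = 1 := by
      have a1 := D.Br_mul_Br_assoc h f true
      have a2 := D.Br_mul_Br_assoc h g true
      simp only [Bool.not_true] at a1 a2
      rw [e]
      simp only [mul_assoc, PhI_mul_Ph_assoc, Ph_mul_PhI_assoc, a1, a2, PhI_mul_Ph]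
    exact left_inv_eq_right_inv h1 h2
  · exact D.Br_hexagon_left_true f g h

theorem Br_hexagon_right (s : Bool) : D.Br s f (D.cop g h) =
    D.PhI g h f * D.Br s f h * D.Ph g f h * D.Br s f g * D.PhI f g h := by
  cases s
  · have e := D.Br_hexagon_left_true g h f
    have h1 := D.Br_mul_Br f (D.cop g h) false
    have h2 : D.Br true (D.cop g h) f *
        (D.PhI g h f * D.Br false f h * D.Ph g f h * D.Br false f g * D.PhI f g h) = 1 := by
      have a1 := D.Br_mul_Br_assoc g f true
      have a2 := D.Br_mul_Br_assoc h f true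
      simp only [Bool.not_true] at a1 a2
      rw [e]
      simp only [mul_assoc, PhI_mul_Ph_assoc, Ph_mul_PhI_assoc, a1, a2, Ph_mul_PhI]
    exact left_inv_eq_right_inv h1 h2
  · exact D.Br_hexagon_right_true f g h
end

/-- With counits on two legs all associators disappear and the hexagon reads `B = B * B` for an
invertible `B`. -/
theorem Br_eps_left (s : Bool) (f : H →ₗ[k] A) [IsLeg f] : D.Br s (D.eps A) f = 1 := by
  have e := D.Br_hexagon_left (D.eps A) (D.eps A) f s
  rw [cop_eps_left, Ph_eps_left, PhI_eps_left, Ph_eps_right, mul_one, mul_one, one_mul] at e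
  have h1 := D.Br_mul_Br f (D.eps A) (!s)
  rw [Bool.not_not] at h1
  have := congrArg (fun y => D.Br (!s) f (D.eps A) * y) e
  simp only [← mul_assoc, h1, one_mul] at this
  exact this.symm

theorem Br_eps_right (s : Bool) (f : H →ₗ[k] A) [IsLeg f] : D.Br s f (D.eps A) = 1 := by
  have h1 := D.Br_mul_Br f (D.eps A) s
  rwa [Br_eps_left, mul_one] at h1

end QuasitriangularQuasiHopf

end
end Hennings

namespace Hennings

noncomputable section

/-! ### Canonical legs and contractions -/

section Canonical
variable {k H : Type*} [Field k] [Ring H] [Algebra k H] {B : Type*} [Ring B] [Algebra k B]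
  {M : Type*} [AddCommMonoid M] [Module k M]

instance : IsLeg (LinearMap.id : H →ₗ[k] H) := ⟨rfl, fun _ _ => rfl⟩

variable (k H B) in
/-- `x ↦ x ⊗ 1` -/
def jl : H →ₗ[k] H ⊗[k] B :=
  (Algebra.TensorProduct.includeLeft : H →ₐ[k] H ⊗[k] B).toLinearMap

variable (H) in
/-- `x ↦ 1 ⊗ F x` -/
def jr (F : M →ₗ[k] B) : M →ₗ[k] H ⊗[k] B :=
  (Algebra.TensorProduct.includeRight : B →ₐ[k] H ⊗[k] B).toLinearMap ∘ₗ F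

@[simp] theorem jl_apply (x : H) : jl k H B x = x ⊗ₜ 1 := rfl

@[simp] theorem jr_apply (F : M →ₗ[k] B) (x : M) : jr H F x = 1 ⊗ₜ F x := rfl

instance : IsLeg (jl k H B) := ⟨rfl, fun x y => by simp⟩

instance [Mul M] [One M] (F : M →ₗ[k] B) [IsLeg F] : IsLeg (jr H F) :=
  ⟨by simp [leg_one, Algebra.TensorProduct.one_def], fun x y => by simp [leg_mul]⟩

instance (F : M →ₗ[k] B) : Commuting (jl k H B) (jr H F) := ⟨fun x y => by simp⟩

instance {N : Type*} [AddCommMonoid N] [Module k N] (F : M →ₗ[k] B) (G : N →ₗ[k] B)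
    [Commuting F G] : Commuting (jr H F) (jr H G) := ⟨fun x y => by simp [leg_comm F G]⟩

variable {V V' : Type*} [AddCommGroup V] [Module k V] [AddCommGroup V'] [Module k V']

/-- Contractions are built one tensor factor at a time: `L a` is what an extra leading factor `a`
does to the value of `E'`. The elements compared do not touch that factor. -/
theorem EqL.shift {E : H ⊗[k] B →ₗ[k] V} {E' : B →ₗ[k] V'} (L : H → V' →ₗ[k] V)
    (hE : ∀ a b, E (a ⊗ₜ b) = L a (E' b)) {F F' : M →ₗ[k] B} (h : EqL E' F F') :
    EqL E (jr H F) (jr H F') := by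
  intro y T
  induction T using TensorProduct.induction_on with
  | zero => simp
  | tmul a b =>
    simp only [jr_apply, Algebra.TensorProduct.tmul_mul_tmul, hE, h y b]
  | add a b ha hb => rw [mul_add, mul_add, map_add, map_add, ha, hb]

theorem EqR.shift {E : H ⊗[k] B →ₗ[k] V} {E' : B →ₗ[k] V'} (L : H → V' →ₗ[k] V)
    (hE : ∀ a b, E (a ⊗ₜ b) = L a (E' b)) {F F' : M →ₗ[k] B} (h : EqR E' F F') :
    EqR E (jr H F) (jr H F') := by
  intro y T
  induction T using TensorProduct.induction_on with
  | zero => simp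
  | tmul a b =>
    simp only [jr_apply, Algebra.TensorProduct.tmul_mul_tmul, hE, h y b]
  | add a b ha hb => rw [add_mul, add_mul, map_add, map_add, ha, hb]

variable {C : Type*} [Ring C] [Algebra k C]

theorem EqL.shift_two (f : H →ₗ[k] C) {E' : B →ₗ[k] C} {F F' : M →ₗ[k] B} (h : EqL E' F F') :
    EqL (two f E') (jr H F) (jr H F') :=
  h.shift (fun a => LinearMap.mulLeft k (f a)) fun a b => by simp

theorem EqR.shift_two (f : H →ₗ[k] C) {E' : B →ₗ[k] C} {F F' : M →ₗ[k] B} (h : EqR E' F F') :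
    EqR (two f E') (jr H F) (jr H F') :=
  h.shift (fun a => LinearMap.mulLeft k (f a)) fun a b => by simp

theorem jr_two (f g : H →ₗ[k] B) : two (jr H f) (jr H g) = jr H (two f g) := by
  ext x y
  simp

variable (D : QuasiBialgebra k H)

theorem jr_cop (f g : H →ₗ[k] B) : D.cop (jr H f) (jr H g) = jr H (D.cop f g) := by
  ext x
  rw [QuasiBialgebra.cop_apply, jr_two]
  rfl

theorem jr_eps : jr H (D.eps B) = D.eps (H ⊗[k] B) := by
  ext x
  simp [QuasiBialgebra.eps_apply, Algebra.algebraMap_eq_smul_one, Algebra.TensorProduct.one_def]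

theorem EqL.shift_cop {f : H →ₗ[k] C} {E' : B →ₗ[k] C} {g h : H →ₗ[k] B}
    (e : EqL E' (D.cop g h) (D.eps B)) :
    EqL (two f E') (D.cop (jr H g) (jr H h)) (D.eps (H ⊗[k] B)) := by
  have := e.shift_two f
  rwa [jr_eps, ← jr_cop] at this

theorem EqR.shift_cop {f : H →ₗ[k] C} {E' : B →ₗ[k] C} {g h : H →ₗ[k] B}
    (e : EqR E' (D.cop g h) (D.eps B)) :
    EqR (two f E') (D.cop (jr H g) (jr H h)) (D.eps (H ⊗[k] B)) := by
  have := e.shift_two f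
  rwa [jr_eps, ← jr_cop] at this

/-- `f ⊗ g` contracts a coproduct multiplied from the left. -/
def InvL (f g : H →ₗ[k] C) : Prop :=
  ∀ h t, two f g (D.comul h * t) = D.counit h • two f g t

/-- `f ⊗ g` contracts a coproduct multiplied from the right. -/
def InvR (f g : H →ₗ[k] C) : Prop :=
  ∀ h t, two f g (t * D.comul h) = D.counit h • two f g t

variable {D}

/-- `head` serves when further factors follow the contracted pair, `tail` when the pair comes last;
factors in front are handled by the `shift` lemmas. -/
theorem InvL.head {f g : H →ₗ[k] C} (i : InvL D f g) (E' : B →ₗ[k] C) :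
    EqL (two f (two g E')) (D.cop (jl k H (H ⊗[k] B)) (jr H (jl k H B))) (D.eps _) := by
  intro h T
  have key : ∀ p a b c, two f (two g E') (two (jl k H (H ⊗[k] B)) (jr H (jl k H B)) p *
      (a ⊗ₜ (b ⊗ₜ c))) = two f g (p * a ⊗ₜ b) * E' c := by
    intro p a b c
    induction p using TensorProduct.induction_on with
    | zero => simp
    | tmul x y => simp [mul_assoc]
    | add x y hx hy => rw [map_add, add_mul, map_add, hx, hy, add_mul, map_add, add_mul]
  have : two f (two g E') ∘ₗ LinearMap.mulLeft k (D.cop (jl k H (H ⊗[k] B)) (jr H (jl k H B)) h) =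
      two f (two g E') ∘ₗ LinearMap.mulLeft k (D.eps _ h) := by
    ext a b c
    simp [QuasiBialgebra.cop_apply, key, i h, QuasiBialgebra.eps_apply, mul_assoc,
      ← Algebra.smul_def]
  exact LinearMap.congr_fun this T

theorem InvR.head {f g : H →ₗ[k] C} (i : InvR D f g) (E' : B →ₗ[k] C) :
    EqR (two f (two g E')) (D.cop (jl k H (H ⊗[k] B)) (jr H (jl k H B))) (D.eps _) := by
  intro h T
  have key : ∀ p a b c, two f (two g E') ((a ⊗ₜ (b ⊗ₜ c)) *
      two (jl k H (H ⊗[k] B)) (jr H (jl k H B)) p) = two f g (a ⊗ₜ b * p) * E' c := by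
    intro p a b c
    induction p using TensorProduct.induction_on with
    | zero => simp
    | tmul x y => simp [mul_assoc]
    | add x y hx hy => rw [map_add, mul_add, map_add, hx, hy, mul_add, map_add, add_mul]
  have : two f (two g E') ∘ₗ
      LinearMap.mulRight k (D.cop (jl k H (H ⊗[k] B)) (jr H (jl k H B)) h) =
      two f (two g E') ∘ₗ LinearMap.mulRight k (D.eps _ h) := by
    ext a b c
    simp [QuasiBialgebra.cop_apply, key, i h, QuasiBialgebra.eps_apply, mul_assoc,
      ← Algebra.smul_def, ← Algebra.commutes]
  exact LinearMap.congr_fun this T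

theorem two_jl_jr_id (p : H ⊗[k] H) : two (jl k H H) (jr H LinearMap.id) p = p := by
  induction p using TensorProduct.induction_on with
  | zero => simp
  | tmul x y => simp
  | add x y hx hy => rw [map_add, hx, hy]

theorem InvL.tail {f g : H →ₗ[k] C} (i : InvL D f g) :
    EqL (two f g) (D.cop (jl k H H) (jr H LinearMap.id)) (D.eps _) := by
  intro h T
  rw [QuasiBialgebra.cop_apply, two_jl_jr_id, i, QuasiBialgebra.eps_apply, ← Algebra.smul_def,
    map_smul]

theorem InvR.tail {f g : H →ₗ[k] C} (i : InvR D f g) :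
    EqR (two f g) (D.cop (jl k H H) (jr H LinearMap.id)) (D.eps _) := by
  intro h T
  rw [QuasiBialgebra.cop_apply, two_jl_jr_id, i, QuasiBialgebra.eps_apply, ← Algebra.commutes,
    ← Algebra.smul_def, map_smul]

end Canonical

namespace QuasiBialgebra
variable {k H : Type*} [Field k] [Ring H] [Algebra k H] {D : QuasiBialgebra k H}
  {A : Type*} [Ring A] [Algebra k A] {V : Type*} [AddCommGroup V] [Module k V]
  {E : A →ₗ[k] V} {F : H →ₗ[k] A}

section
variable (g h : H →ₗ[k] A) [IsLeg g] [IsLeg h] [Commuting g h]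

/-- A leg which `E` cannot tell from the counit may be replaced by it, and then `Φ⁻¹` becomes `1`.
This and its variants make associators with a joined pair on one leg vanish. -/
theorem _root_.Hennings.EqL.PhI_left (e : EqL E F (D.eps A)) (T : A) :
    E (D.PhI F g h * T) = E T := by
  have := e.left (two g h) (D.Phi⁻¹ : (H ⊗[k] (H ⊗[k] H))ˣ).1 T
  rwa [← PhI, ← PhI, PhI_eps_left, one_mul] at this

theorem _root_.Hennings.EqR.Ph_left [Commuting F g] [Commuting F h] (e : EqR E F (D.eps A))
    (T : A) : E (T * D.Ph F g h) = E T := by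
  have := e.left (two g h) D.Phi T
  rwa [← Ph, ← Ph, Ph_eps_left, mul_one] at this

theorem _root_.Hennings.EqL.PhI_mid [Commuting F g] (e : EqL E F (D.eps A)) (T : A) :
    E (D.PhI g F h * T) = E T := by
  have := (e.left h).right g (D.Phi⁻¹ : (H ⊗[k] (H ⊗[k] H))ˣ).1 T
  rwa [← PhI, ← PhI, PhI_eps_mid, one_mul] at this

theorem _root_.Hennings.EqR.Ph_mid [Commuting F h] (e : EqR E F (D.eps A)) (T : A) :
    E (T * D.Ph g F h) = E T := by
  have := (e.left h).right g D.Phi T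
  rwa [← Ph, ← Ph, Ph_eps_mid, mul_one] at this

theorem _root_.Hennings.EqL.PhI_right [Commuting F g] [Commuting F h] (e : EqL E F (D.eps A))
    (T : A) : E (D.PhI g h F * T) = E T := by
  have := (e.right h).right g (D.Phi⁻¹ : (H ⊗[k] (H ⊗[k] H))ˣ).1 T
  rwa [← PhI, ← PhI, PhI_eps_right, one_mul] at this

theorem _root_.Hennings.EqR.Ph_right (e : EqR E F (D.eps A)) (T : A) :
    E (T * D.Ph g h F) = E T := by
  have := (e.right h).right g D.Phi T
  rwa [← Ph, ← Ph, Ph_eps_right, mul_one] at this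
end

theorem _root_.Hennings.EqL.cop_left {f : H →ₗ[k] A} (e : EqL E F (D.eps A)) :
    EqL E (D.cop F f) f := by
  have := e.left f
  intro y T
  have := this (D.comul y) T
  rwa [← cop_apply, ← cop_apply, cop_eps_left] at this

theorem _root_.Hennings.EqL.cop_right {f : H →ₗ[k] A} [Commuting F f] (e : EqL E F (D.eps A)) :
    EqL E (D.cop f F) f := by
  have := e.right f
  intro y T
  have := this (D.comul y) T
  rwa [← cop_apply, ← cop_apply, cop_eps_right] at this

theorem _root_.Hennings.EqR.cop_right {f : H →ₗ[k] A} (e : EqR E F (D.eps A)) :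
    EqR E (D.cop f F) f := by
  have := e.right f
  intro y T
  have := this (D.comul y) T
  rwa [← cop_apply, ← cop_apply, cop_eps_right] at this

theorem _root_.Hennings.EqL.apply_eps (e : EqL E F (D.eps A)) (x : H) (T : A) :
    E (F x * T) = D.counit x • E T := by
  rw [e x T, eps_apply, ← Algebra.smul_def, map_smul]

end QuasiBialgebra

/-! ### Quasi-Hopf algebras -/

namespace QuasiHopf
open QuasiBialgebra
variable {k H : Type*} [Field k] [Ring H] [Algebra k H] (D : QuasiHopf k H)
  {C : Type*} [Ring C] [Algebra k C]

@[simp] theorem evalAlpha_tmul (x y : H) : evalAlpha D.S D.α (x ⊗ₜ y) = D.S x * D.α * y := rfl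

@[simp] theorem evalBeta_tmul (x y : H) : evalBeta D.S D.β (x ⊗ₜ y) = x * D.β * D.S y := rfl

theorem evalAlpha_comul_mul (h : H) (t : H ⊗[k] H) :
    evalAlpha D.S D.α (D.comul h * t) = D.counit h • evalAlpha D.S D.α t := by
  induction t using TensorProduct.induction_on with
  | zero => simp
  | add x y hx hy => rw [mul_add, map_add, map_add, hx, hy, smul_add]
  | tmul x y =>
    have : ∀ p : H ⊗[k] H, evalAlpha D.S D.α (p * x ⊗ₜ y) = D.S x * evalAlpha D.S D.α p * y := by
      intro p
      induction p using TensorProduct.induction_on with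
      | zero => simp
      | add a b ha hb => rw [add_mul, map_add, map_add, ha, hb, mul_add, add_mul]
      | tmul a b => simp [D.S_mul, mul_assoc]
    rw [this, D.antipode_left]
    simp

theorem evalBeta_mul_comul (h : H) (t : H ⊗[k] H) :
    evalBeta D.S D.β (t * D.comul h) = D.counit h • evalBeta D.S D.β t := by
  induction t using TensorProduct.induction_on with
  | zero => simp
  | add x y hx hy => rw [add_mul, map_add, map_add, hx, hy, smul_add]
  | tmul x y =>
    have : ∀ p : H ⊗[k] H, evalBeta D.S D.β (x ⊗ₜ y * p) = x * evalBeta D.S D.β p * D.S y := by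
      intro p
      induction p using TensorProduct.induction_on with
      | zero => simp
      | add a b ha hb => rw [mul_add, map_add, map_add, ha, hb, mul_add, add_mul]
      | tmul a b => simp [D.S_mul, mul_assoc]
    rw [this, D.antipode_right]
    simp

theorem invL_of {f g : H →ₗ[k] C} (G : H →ₗ[k] C)
    (h : ∀ x y, f x * g y = G (D.S x * D.α * y)) : InvL D.toQuasiBialgebra f g := by
  have e : two f g = G ∘ₗ evalAlpha D.S D.α := by
    ext x y
    simpa using h x y
  intro y t
  rw [e, LinearMap.comp_apply, LinearMap.comp_apply, evalAlpha_comul_mul, map_smul]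

theorem invR_of {f g : H →ₗ[k] C} (G : H →ₗ[k] C)
    (h : ∀ x y, f x * g y = G (x * D.β * D.S y)) : InvR D.toQuasiBialgebra f g := by
  have e : two f g = G ∘ₗ evalBeta D.S D.β := by
    ext x y
    simpa using h x y
  intro y t
  rw [e, LinearMap.comp_apply, LinearMap.comp_apply, evalBeta_mul_comul, map_smul]

/-- `x ↦ φ (S x * α)` -/
def alphaLeg (φ : H →ₗ[k] C) : H →ₗ[k] C := φ ∘ₗ LinearMap.mulRight k D.α ∘ₗ D.S.toLinearMap

/-- `x ↦ φ (x * β)` -/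
def betaLeg (φ : H →ₗ[k] C) : H →ₗ[k] C := φ ∘ₗ LinearMap.mulRight k D.β

/-- `x ↦ φ (S x)` -/
def antiLeg (φ : H →ₗ[k] C) : H →ₗ[k] C := φ ∘ₗ D.S.toLinearMap

@[simp] theorem alphaLeg_apply (φ : H →ₗ[k] C) (x : H) : D.alphaLeg φ x = φ (D.S x * D.α) := rfl

@[simp] theorem betaLeg_apply (φ : H →ₗ[k] C) (x : H) : D.betaLeg φ x = φ (x * D.β) := rfl

@[simp] theorem antiLeg_apply (φ : H →ₗ[k] C) (x : H) : D.antiLeg φ x = φ (D.S x) := rfl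

theorem invL_alpha (φ : H →ₗ[k] C) [IsLeg φ] : InvL D.toQuasiBialgebra (D.alphaLeg φ) φ :=
  D.invL_of φ fun x y => by rw [alphaLeg_apply, ← leg_mul]

theorem invR_beta (φ : H →ₗ[k] C) [IsLeg φ] :
    InvR D.toQuasiBialgebra (D.betaLeg φ) (D.antiLeg φ) :=
  D.invR_of φ fun x y => by rw [betaLeg_apply, antiLeg_apply, ← leg_mul]

theorem invR_beta_alpha (φ : H →ₗ[k] C) [IsLeg φ] :
    InvR D.toQuasiBialgebra (D.betaLeg φ) (D.alphaLeg φ) :=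
  D.invR_of (φ ∘ₗ LinearMap.mulRight k D.α) fun x y => by
    rw [betaLeg_apply, alphaLeg_apply, ← leg_mul]; simp [mul_assoc]

/-- `X ⊗ Y β S(Z)`, where `Φ⁻¹ = X ⊗ Y ⊗ Z`. -/
def W : H ⊗[k] H := TensorProduct.map LinearMap.id (evalBeta D.S D.β) D.phiInv

/-! ### Invariant maps evaluated at `W` -/

section Zigzag
variable {V : Type*} [AddCommGroup V] [Module k V] {K : H ⊗[k] H →ₗ[k] V}

/-- `W` is `Φ⁻¹` with its last two strands closed by a maximum, and `K` acts as a minimum on the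
first two. In the naturality of `Φ⁻¹` the maximum absorbs one side and `K` the other, leaving `h` on
the first strand, respectively on the third, where it appears as `S h`. -/
theorem zigzag_slide (hK : ∀ h t, K (D.comul h * t) = D.counit h • K t) (h : H) :
    K (D.W * h ⊗ₜ 1) = K (D.W * 1 ⊗ₜ D.S h) := by
  set Q : H ⊗[k] H →ₗ[k] H := two (D.betaLeg LinearMap.id) (D.antiLeg LinearMap.id) with hQ
  set Ψ : H ⊗[k] (H ⊗[k] H) →ₗ[k] V := K ∘ₗ TensorProduct.map LinearMap.id Q with hΨ
  set f := jl k H (H ⊗[k] H)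
  set g := jr H (jl k H H)
  set w : H →ₗ[k] H ⊗[k] (H ⊗[k] H) := jr H (jr H LinearMap.id)
  have hR : EqR Ψ (D.cop g w) (D.eps _) := by
    have := (D.invR_beta (LinearMap.id : H →ₗ[k] H)).tail.shift (E := Ψ)
      (fun a => K ∘ₗ TensorProduct.mk k H H a) (fun a b => rfl)
    rwa [jr_eps, ← jr_cop] at this
  have hL : EqL Ψ (D.cop f g) (D.eps _) := by
    intro x T
    rw [eps_apply, ← Algebra.smul_def, map_smul, cop_apply]
    have key : ∀ p, TensorProduct.map LinearMap.id Q (two f g p * T) =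
        p * TensorProduct.map LinearMap.id Q T := by
      intro p
      have : TensorProduct.map LinearMap.id Q ∘ₗ LinearMap.mulLeft k (two f g p) =
          LinearMap.mulLeft k p ∘ₗ TensorProduct.map LinearMap.id Q := by
        ext a b c
        induction p using TensorProduct.induction_on with
        | zero => simp
        | tmul x y => simp [f, g, Q, mul_assoc]
        | add x y hx hy =>
          simp only [TensorProduct.AlgebraTensorModule.curry_apply, TensorProduct.curry_apply,
            LinearMap.coe_restrictScalars, LinearMap.comp_apply, LinearMap.mulLeft_apply] at hx hy ⊢
          rw [map_add, add_mul, map_add, hx, hy, add_mul]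
      exact LinearMap.congr_fun this T
    rw [hΨ, LinearMap.comp_apply, LinearMap.comp_apply, key, hK]
  have e := congrArg Ψ (D.PhI_nat f g w h)
  have a1 : Ψ (D.PhI f g w * D.cop f (D.cop g w) h) = Ψ (D.PhI f g w * f h) :=
    hR.cop_right h _
  have a2 : Ψ (D.cop (D.cop f g) w h * D.PhI f g w) = Ψ (w h * D.PhI f g w) :=
    hL.cop_left h _
  rw [a1, a2] at e
  have b1 : Ψ ∘ₗ LinearMap.mulRight k (f h) ∘ₗ two f (two g w) =
      K ∘ₗ LinearMap.mulRight k (h ⊗ₜ 1) ∘ₗ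
        TensorProduct.map LinearMap.id (evalBeta D.S D.β) := by
    ext a b c
    simp [f, g, w, Ψ, Q]
  have b2 : Ψ ∘ₗ LinearMap.mulLeft k (w h) ∘ₗ two f (two g w) =
      K ∘ₗ LinearMap.mulRight k (1 ⊗ₜ D.S h) ∘ₗ
        TensorProduct.map LinearMap.id (evalBeta D.S D.β) := by
    ext a b c
    simp [f, g, w, Ψ, Q, D.S_mul, mul_assoc]
  have c1 := LinearMap.congr_fun b1 D.phiInv
  have c2 := LinearMap.congr_fun b2 D.phiInv
  exact c1.symm.trans (e.trans c2)

/-- The pentagon writes `Φ⁻¹` on strands 1 to 3 as a product of four associators on four strands.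
Three have a contracted pair on one leg and vanish; the fourth is the zigzag `X β S(Y) α Z = 1`. -/
theorem zigzag_alpha (hK : ∀ h t, K (D.comul h * t) = D.counit h • K t) :
    K (D.W * 1 ⊗ₜ D.α) = K 1 := by
  set Q : H ⊗[k] (H ⊗[k] H) →ₗ[k] H :=
    two (D.betaLeg LinearMap.id) (two (D.alphaLeg LinearMap.id) LinearMap.id) with hQ
  set Ψ : H ⊗[k] (H ⊗[k] (H ⊗[k] H)) →ₗ[k] V := K ∘ₗ TensorProduct.map LinearMap.id Q with hΨ
  set f := jl k H (H ⊗[k] (H ⊗[k] H))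
  set g := jr H (jl k H (H ⊗[k] H))
  set w := jr H (jr H (jl k H H))
  set z : H →ₗ[k] H ⊗[k] (H ⊗[k] (H ⊗[k] H)) := jr H (jr H (jr H LinearMap.id))
  have hR : EqR Ψ (D.cop g w) (D.eps _) := by
    have := ((D.invR_beta_alpha (LinearMap.id : H →ₗ[k] H)).head LinearMap.id).shift (E := Ψ)
      (fun a => K ∘ₗ TensorProduct.mk k H H a) (fun a b => rfl)
    rwa [jr_eps, ← jr_cop] at this
  have hL' : EqL Ψ (D.cop w z) (D.eps _) := by
    have := ((D.invL_alpha (LinearMap.id : H →ₗ[k] H)).tail.shift_cop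
      (f := D.betaLeg LinearMap.id)).shift (E := Ψ)
      (fun a => K ∘ₗ TensorProduct.mk k H H a) (fun a b => rfl)
    rwa [jr_eps, ← jr_cop] at this
  have hL : EqL Ψ (D.cop f g) (D.eps _) := by
    intro x T
    rw [eps_apply, ← Algebra.smul_def, map_smul, cop_apply]
    have key : ∀ p, TensorProduct.map LinearMap.id Q (two f g p * T) =
        p * TensorProduct.map LinearMap.id Q T := by
      intro p
      have : TensorProduct.map LinearMap.id Q ∘ₗ LinearMap.mulLeft k (two f g p) =
          LinearMap.mulLeft k p ∘ₗ TensorProduct.map LinearMap.id Q := by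
        ext a b c d
        induction p using TensorProduct.induction_on with
        | zero => simp
        | tmul x y => simp [f, g, Q, mul_assoc]
        | add x y hx hy =>
          simp only [TensorProduct.AlgebraTensorModule.curry_apply, TensorProduct.curry_apply,
            LinearMap.coe_restrictScalars, LinearMap.comp_apply, LinearMap.mulLeft_apply] at hx hy ⊢
          rw [map_add, add_mul, map_add, hx, hy, add_mul]
      exact LinearMap.congr_fun this T
    rw [hΨ, LinearMap.comp_apply, LinearMap.comp_apply, key, hK]
  have e : D.PhI f g w = D.PhI (D.cop f g) w z * (D.PhI f g (D.cop w z) *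
      (D.Ph g w z * D.Ph f (D.cop g w) z)) := by
    rw [← mul_assoc, D.PhI_pentagon f g w z]
    simp only [mul_assoc, PhI_mul_Ph_assoc, PhI_mul_Ph, mul_one]
  have e1 : Ψ (D.PhI f g w) = Ψ (D.Ph g w z) := by
    rw [e, hL.PhI_left w z, hL'.PhI_right f g, hR.Ph_mid f z]
  have b1 : Ψ ∘ₗ two f (two g w) =
      K ∘ₗ LinearMap.mulRight k (1 ⊗ₜ D.α) ∘ₗ
        TensorProduct.map LinearMap.id (evalBeta D.S D.β) := by
    ext a b c
    simp [f, g, w, Ψ, Q, mul_assoc]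
  have b2 : Ψ ∘ₗ two g (two w z) = K ∘ₗ TensorProduct.mk k H H 1 ∘ₗ
      LinearMap.mul' k H ∘ₗ TensorProduct.map (LinearMap.mulRight k D.β) (evalAlpha D.S D.α) := by
    ext a b c
    simp [g, w, z, Ψ, Q]
  have c1 := LinearMap.congr_fun b1 D.phiInv
  have c2 := LinearMap.congr_fun b2 D.phi
  have c3 : LinearMap.mul' k H (TensorProduct.map (LinearMap.mulRight k D.β)
    (evalAlpha D.S D.α) D.phi) = 1 := D.zigzag_Phi
  simp only [LinearMap.comp_apply, c3] at c2
  exact c1.symm.trans (e1.trans c2)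
end Zigzag

end QuasiHopf

end
end Hennings

/-! ### The Drinfeld twist `f` and the element `u` -/

namespace Hennings

noncomputable section

section Flip
variable {k H : Type*} [Field k] [Ring H] [Algebra k H] {C : Type*} [Ring C] [Algebra k C]

@[simp] theorem flip_tmul (x y : H) : QuasiHopf.flip (k := k) (x ⊗ₜ[k] y) = y ⊗ₜ x := rfl

theorem flip_flip (t : H ⊗[k] H) : QuasiHopf.flip (QuasiHopf.flip t) = t :=
  LinearEquiv.apply_symm_apply (TensorProduct.comm k H H) t

theorem flip_mul (s t : H ⊗[k] H) :
    QuasiHopf.flip (s * t) = QuasiHopf.flip s * QuasiHopf.flip t :=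
  map_mul (Algebra.TensorProduct.comm k H H) s t

theorem flip_one : QuasiHopf.flip (1 : H ⊗[k] H) = 1 :=
  map_one (Algebra.TensorProduct.comm k H H)

theorem two_flip (f g : H →ₗ[k] C) [Commuting f g] (t : H ⊗[k] H) :
    two f g (QuasiHopf.flip t) = two g f t := two_comm f g t

theorem two_jr_id_jl (p : H ⊗[k] H) :
    two (jr H LinearMap.id) (jl k H H) p = QuasiHopf.flip p := by
  induction p using TensorProduct.induction_on with
  | zero => simp
  | tmul x y => simp
  | add x y hx hy => rw [map_add, hx, hy, map_add]

end Flip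

namespace QuasiHopf
open QuasiBialgebra
variable {k H : Type*} [Field k] [Ring H] [Algebra k H] (D : QuasiHopf k H)
  {A : Type*} [Ring A] [Algebra k A]

@[simp] theorem SS_tmul (x y : H) : D.SS (x ⊗ₜ[k] y) = D.S x ⊗ₜ D.S y := rfl

@[simp] theorem SSinv_tmul (x y : H) : D.SSinv (x ⊗ₜ[k] y) = D.S.symm x ⊗ₜ D.S.symm y := rfl

theorem SS_mul (s t : H ⊗[k] H) : D.SS (s * t) = D.SS t * D.SS s := by
  induction s using TensorProduct.induction_on with
  | zero => simp
  | add x y hx hy => rw [add_mul, map_add, map_add, hx, hy, mul_add]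
  | tmul x y =>
    induction t using TensorProduct.induction_on with
    | zero => simp
    | add x y hx hy => rw [mul_add, map_add, map_add, hx, hy, add_mul]
    | tmul z w => simp [D.S_mul]

theorem SS_one : D.SS 1 = 1 := by
  rw [Algebra.TensorProduct.one_def, SS_tmul, D.S_one]

theorem evalAlpha_mul_tmul (t : H ⊗[k] H) (x y : H) :
    evalAlpha D.S D.α (t * x ⊗ₜ y) = D.S x * evalAlpha D.S D.α t * y := by
  induction t using TensorProduct.induction_on with
  | zero => simp
  | add a b ha hb => rw [add_mul, map_add, map_add, ha, hb, mul_add, add_mul]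
  | tmul a b => simp [D.S_mul, mul_assoc]

section
variable (a b c d : H →ₗ[k] A) [IsLeg a] [IsLeg b] [IsLeg c] [IsLeg d] [Commuting a b]
  [Commuting a c] [Commuting a d] [Commuting b c] [Commuting b d] [Commuting c d]

/-- `(Φ ⊗ 1) (Δ ⊗ id ⊗ id)(Φ⁻¹)` on four legs. -/
def theta : A := D.Ph a b c * D.PhI (D.cop a b) c d

theorem theta_nat (x : H) : D.theta a b c d * D.cop (D.cop a b) (D.cop c d) x =
    D.cop (D.cop a (D.cop b c)) d x * D.theta a b c d := by
  rw [theta, mul_assoc, PhI_nat, ← mul_assoc, ← mul_assoc]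
  congr 1
  exact intertwine_left d (D.Ph_nat a b c) (leg_comm (two a (two b c)) d _) (D.comul x)

/-- The pentagon rearranged so that `b, c` occupy a single leg of the first factor; joining them
removes it. -/
theorem theta_eq : D.theta a b c d =
    D.PhI a (D.cop b c) d * (D.PhI b c d * D.Ph a b (D.cop c d)) := by
  have e : D.Ph a (D.cop b c) d * D.theta a b c d = D.PhI b c d * D.Ph a b (D.cop c d) := by
    have := congrArg (fun y => D.PhI b c d * y * D.PhI (D.cop a b) c d) (D.Ph_pentagon a b c d)
    simp only [mul_assoc, PhI_mul_Ph_assoc, Ph_mul_PhI, mul_one] at this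
    exact this.symm
  rw [← e, PhI_mul_Ph_assoc]
end

variable (k H) in
/-- The canonical leg `a` of `gammaE`. -/
abbrev legA : H →ₗ[k] H ⊗[k] (H ⊗[k] (H ⊗[k] H)) := jr H (jr H (jl k H H))

variable (k H) in
/-- The canonical leg `b` of `gammaE`. -/
abbrev legB : H →ₗ[k] H ⊗[k] (H ⊗[k] (H ⊗[k] H)) := jl k H (H ⊗[k] (H ⊗[k] H))

variable (k H) in
/-- The canonical leg `c` of `gammaE`. -/
abbrev legC : H →ₗ[k] H ⊗[k] (H ⊗[k] (H ⊗[k] H)) := jr H (jl k H (H ⊗[k] H))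

variable (k H) in
/-- The canonical leg `d` of `gammaE`. -/
abbrev legD : H →ₗ[k] H ⊗[k] (H ⊗[k] (H ⊗[k] H)) := jr H (jr H (jr H LinearMap.id))

/-- The contraction `b ⊗ c ⊗ a ⊗ d ↦ S(b) α c ⊗ S(a) α d`. -/
def gammaE : H ⊗[k] (H ⊗[k] (H ⊗[k] H)) →ₗ[k] H ⊗[k] H :=
  two (D.alphaLeg (jl k H H)) (two (jl k H H)
    (two (D.alphaLeg (jr H LinearMap.id)) (jr H LinearMap.id)))

@[simp] theorem gammaE_tmul (a b c d : H) : D.gammaE (b ⊗ₜ (c ⊗ₜ (a ⊗ₜ d))) =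
    (D.S b * D.α * c) ⊗ₜ (D.S a * D.α * d) := by
  simp [gammaE]

/-- Of the two nested minima, `b, c` is the inner and `a, d` the outer one. The factors are ordered
`b, c, a, d` to make both pairs adjacent. -/
theorem gammaE_bc : EqL D.gammaE (D.cop (legB k H) (legC k H)) (D.eps _) :=
  (D.invL_alpha (jl k H H)).head _

theorem gammaE_ad : EqL D.gammaE (D.cop (legA k H) (legD k H)) (D.eps _) :=
  ((D.invL_alpha (jr H LinearMap.id)).tail.shift_cop).shift_cop

theorem gammaE_mul_ab (T : H ⊗[k] (H ⊗[k] (H ⊗[k] H))) (p : H ⊗[k] H) :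
    D.gammaE (T * two (legA k H) (legB k H) p) = D.SS (flip p) * D.gammaE T := by
  induction p using TensorProduct.induction_on with
  | zero => simp
  | add x y hx hy => rw [map_add, mul_add, map_add, hx, hy, map_add, map_add, add_mul]
  | tmul x y =>
    have : D.gammaE ∘ₗ LinearMap.mulRight k (two (legA k H) (legB k H) (x ⊗ₜ y)) =
        LinearMap.mulLeft k (D.SS (flip (x ⊗ₜ y))) ∘ₗ D.gammaE := by
      ext b c a d
      simp [D.S_mul, mul_assoc]
    exact LinearMap.congr_fun this T

theorem gammaE_mul_cd (T : H ⊗[k] (H ⊗[k] (H ⊗[k] H))) (p : H ⊗[k] H) :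
    D.gammaE (T * two (legC k H) (legD k H) p) = D.gammaE T * p := by
  induction p using TensorProduct.induction_on with
  | zero => simp
  | add x y hx hy => rw [map_add, mul_add, map_add, hx, hy, mul_add]
  | tmul x y =>
    have : D.gammaE ∘ₗ LinearMap.mulRight k (two (legC k H) (legD k H) (x ⊗ₜ y)) =
        LinearMap.mulRight k (x ⊗ₜ y) ∘ₗ D.gammaE := by
      ext b c a d
      simp [mul_assoc]
    exact LinearMap.congr_fun this T

/-- `(Φ ⊗ 1) (Δ ⊗ id ⊗ id)(Φ⁻¹)` -/
def theta₀ : H ⊗[k] (H ⊗[k] (H ⊗[k] H)) :=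
  Algebra.TensorProduct.map (AlgHom.id k H) (Algebra.TensorProduct.assoc k k k H H H).toAlgHom
      (Algebra.TensorProduct.assoc k k k H (H ⊗[k] H) H (D.phi ⊗ₜ[k] (1 : H))) *
    Algebra.TensorProduct.assoc k k k H H (H ⊗[k] H)
      (Algebra.TensorProduct.map D.comul (AlgHom.id k (H ⊗[k] H)) D.phiInv)

theorem four_theta₀ (a b c d : H →ₗ[k] A) [IsLeg a] [IsLeg b] [IsLeg c] [IsLeg d]
    [Commuting a b] [Commuting a c] [Commuting a d] [Commuting b c] [Commuting b d]
    [Commuting c d] : two a (two b (two c d)) D.theta₀ = D.theta a b c d := by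
  rw [theta₀, four_mul, four_tmul_one, four_comul_left]
  rfl

theorem gamma_eq : D.gamma = D.gammaE (D.theta (legA k H) (legB k H) (legC k H) (legD k H)) := by
  rw [← four_theta₀]
  have : TensorProduct.map LinearMap.id (evalAlpha D.S D.α) ∘ₗ
      (TensorProduct.leftComm k H H H).toLinearMap ∘ₗ
        TensorProduct.map LinearMap.id
        (TensorProduct.map (evalAlpha D.S D.α) LinearMap.id ∘ₗ
          (TensorProduct.assoc k H H H).symm.toLinearMap) =
      D.gammaE ∘ₗ two (legA k H) (two (legB k H) (two (legC k H) (legD k H))) := by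
    ext a b c d
    simp
  exact LinearMap.congr_fun this D.theta₀

/-- `x ⊗ y ↦ (S ⊗ S)(Δᵒᵖ(x)) γ Δ(y)` -/
def gammaK : H ⊗[k] H →ₗ[k] H ⊗[k] H :=
  LinearMap.mul' k (H ⊗[k] H) ∘ₗ
    TensorProduct.map
      (LinearMap.mulRight k D.gamma ∘ₗ D.SS ∘ₗ flip ∘ₗ D.comul.toLinearMap) D.comul.toLinearMap

@[simp] theorem gammaK_tmul (x y : H) :
    D.gammaK (x ⊗ₜ y) = D.SS (flip (D.comul x)) * D.gamma * D.comul y := rfl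

theorem gammaK_eq (t : H ⊗[k] H) : D.gammaK t =
    D.gammaE (D.theta (legA k H) (legB k H) (legC k H) (legD k H) *
      two (D.cop (legA k H) (legB k H)) (D.cop (legC k H) (legD k H)) t) := by
  induction t using TensorProduct.induction_on with
  | zero => simp
  | add x y hx hy => rw [map_add, map_add, mul_add, map_add, hx, hy]
  | tmul x y =>
    rw [two_tmul, ← mul_assoc, cop_apply _ (legC k H), gammaE_mul_cd, cop_apply, gammaE_mul_ab,
      ← gamma_eq, gammaK_tmul]

/-- Past `theta` the coproduct of `h` is bracketed `(a(bc))d`: the inner minimum absorbs `b, c`, and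
then the outer one absorbs `a, d`. -/
theorem gammaK_comul_mul (h : H) (t : H ⊗[k] H) :
    D.gammaK (D.comul h * t) = D.counit h • D.gammaK t := by
  have h1 : EqL D.gammaE (D.cop (D.cop (legA k H) (D.cop (legB k H) (legC k H))) (legD k H))
      (D.cop (legA k H) (legD k H)) := fun x T =>
    (D.gammaE_bc.cop_right (f := legA k H)).left (legD k H) (D.comul x) T
  rw [gammaK_eq, leg_mul (two _ _), ← mul_assoc, ← cop_apply, theta_nat, mul_assoc, h1,
    D.gammaE_ad.apply_eps, ← gammaK_eq]

/-- This makes the basic identities of the twist instances of `zigzag_slide` and `zigzag_alpha`. -/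
theorem f_eq : D.f = D.gammaK D.W := by
  have : LinearMap.mul' k (H ⊗[k] H) ∘ₗ TensorProduct.map
      (LinearMap.mulRight k D.gamma ∘ₗ D.SS ∘ₗ flip ∘ₗ D.comul.toLinearMap)
      (D.comul.toLinearMap ∘ₗ evalBeta D.S D.β) =
      D.gammaK ∘ₗ TensorProduct.map LinearMap.id (evalBeta D.S D.β) := by
    ext a b c
    simp
  exact LinearMap.congr_fun this D.phiInv

/-- `(S ⊗ S)(Δᵒᵖ(h)) f = f Δ(S(h))` -/
theorem f_comul_S (h : H) : D.SS (flip (D.comul h)) * D.f = D.f * D.comul (D.S h) := by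
  have e := zigzag_slide D D.gammaK_comul_mul h
  have e1 : D.gammaK ∘ₗ LinearMap.mulRight k (h ⊗ₜ[k] (1 : H)) =
      LinearMap.mulLeft k (D.SS (flip (D.comul h))) ∘ₗ D.gammaK := by
    ext x y
    simp [flip_mul, SS_mul, mul_assoc]
  have e2 : D.gammaK ∘ₗ LinearMap.mulRight k ((1 : H) ⊗ₜ[k] D.S h) =
      LinearMap.mulRight k (D.comul (D.S h)) ∘ₗ D.gammaK := by
    ext x y
    simp [mul_assoc]
  have c1 := LinearMap.congr_fun e1 D.W
  have c2 := LinearMap.congr_fun e2 D.W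
  simp only [LinearMap.comp_apply, LinearMap.mulRight_apply, LinearMap.mulLeft_apply] at c1 c2
  rw [f_eq, ← c1, ← c2, e]

/-- `f Δ(α) = γ` -/
theorem f_comul_alpha : D.f * D.comul D.α = D.gamma := by
  have e := zigzag_alpha D D.gammaK_comul_mul
  have e2 : D.gammaK ∘ₗ LinearMap.mulRight k ((1 : H) ⊗ₜ[k] D.α) =
      LinearMap.mulRight k (D.comul D.α) ∘ₗ D.gammaK := by
    ext x y
    simp [mul_assoc]
  have c2 := LinearMap.congr_fun e2 D.W
  simp only [LinearMap.comp_apply, LinearMap.mulRight_apply] at c2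
  rw [f_eq, ← c2, e, Algebra.TensorProduct.one_def, gammaK_tmul, map_one, flip_one, SS_one,
    one_mul, mul_one]

end QuasiHopf

namespace QuasitriangularQuasiHopf
open QuasiBialgebra QuasiHopf
variable {k H : Type*} [Field k] [Ring H] [Algebra k H] (D : QuasitriangularQuasiHopf k H)
  {A : Type*} [Ring A] [Algebra k A]

/-- `S(t) α s`, where `R^{±1} = s ⊗ t`. -/
def kap (s : Bool) : H := evalAlpha D.S D.α (QuasiHopf.flip (D.rs s))

/-- `a ⊗ b ↦ S(b) κ a` -/
def kapK (s : Bool) : H ⊗[k] H →ₗ[k] H :=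
  evalAlpha D.S D.α ∘ₗ LinearMap.mulLeft k (QuasiHopf.flip (D.rs s)) ∘ₗ QuasiHopf.flip

@[simp] theorem kapK_tmul (s : Bool) (a b : H) :
    D.kapK s (a ⊗ₜ b) = D.S b * D.kap s * a :=
  D.evalAlpha_mul_tmul _ b a

theorem rs_mul (s : Bool) : D.rs s * QuasiHopf.flip (D.rs (!s)) = 1 := by
  have := D.Br_mul_Br (jl k H H) (jr H LinearMap.id) s
  rwa [Br, Br, two_jl_jr_id, two_jr_id_jl] at this

theorem rs_comul (s : Bool) (h : H) :
    D.rs s * D.comul h = QuasiHopf.flip (D.comul h) * D.rs s := by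
  have := D.Br_nat (jl k H H) (jr H LinearMap.id) s h
  rwa [Br, cop_apply, cop_apply, two_jl_jr_id, two_jr_id_jl, two_jl_jr_id] at this

/-- `Δᵒᵖ R = R Δ` carries the coproduct across the crossing to the minimum, which absorbs it. Hence
the zigzag lemmas apply to `us` as they do to `f`. -/
theorem kapK_comul_mul (s : Bool) (h : H) (t : H ⊗[k] H) :
    D.kapK s (D.comul h * t) = D.counit h • D.kapK s t := by
  rw [kapK, LinearMap.comp_apply, LinearMap.comp_apply, LinearMap.mulLeft_apply, flip_mul,
    ← mul_assoc, ← flip_mul, rs_comul, flip_mul, flip_flip, mul_assoc, evalAlpha_comul_mul]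
  rfl

/-- The element `u` for the braiding or its inverse. -/
def us (s : Bool) : H := D.kapK s D.W

theorem u_eq : D.u = D.us true := by
  have : LinearMap.mul' k H ∘ₗ TensorProduct.map
      (LinearMap.mulRight k (evalAlpha D.S D.α (QuasiHopf.flip D.r)) ∘ₗ D.S.toLinearMap ∘ₗ
        evalBeta D.S D.β) LinearMap.id ∘ₗ (TensorProduct.comm k H (H ⊗[k] H)).toLinearMap =
      D.kapK true ∘ₗ TensorProduct.map LinearMap.id (evalBeta D.S D.β) := by
    ext a b c
    simp [kap, rs]
  exact LinearMap.congr_fun this D.phiInv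

theorem us_mul (s : Bool) (h : H) : D.us s * h = D.S (D.S h) * D.us s := by
  have e := D.zigzag_slide (D.kapK_comul_mul s) h
  have e1 : D.kapK s ∘ₗ LinearMap.mulRight k (h ⊗ₜ[k] (1 : H)) =
      LinearMap.mulRight k h ∘ₗ D.kapK s := by
    ext x y
    simp [mul_assoc]
  have e2 : D.kapK s ∘ₗ LinearMap.mulRight k ((1 : H) ⊗ₜ[k] D.S h) =
      LinearMap.mulLeft k (D.S (D.S h)) ∘ₗ D.kapK s := by
    ext x y
    simp [mul_assoc, D.S_mul]
  have c1 := LinearMap.congr_fun e1 D.W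
  have c2 := LinearMap.congr_fun e2 D.W
  simp only [LinearMap.comp_apply, LinearMap.mulRight_apply, LinearMap.mulLeft_apply] at c1 c2
  rw [us, ← c1, ← c2, e]

theorem kap_eq (s : Bool) : D.kap s = D.S D.α * D.us s := by
  have e := D.zigzag_alpha (D.kapK_comul_mul s)
  have e2 : D.kapK s ∘ₗ LinearMap.mulRight k ((1 : H) ⊗ₜ[k] D.α) =
      LinearMap.mulLeft k (D.S D.α) ∘ₗ D.kapK s := by
    ext x y
    simp [mul_assoc, D.S_mul]
  have c2 := LinearMap.congr_fun e2 D.W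
  simp only [LinearMap.comp_apply, LinearMap.mulRight_apply, LinearMap.mulLeft_apply] at c2
  rw [us, ← c2, e, Algebra.TensorProduct.one_def, kapK_tmul, D.S_one, one_mul, mul_one]

/-- Since `S(t) α s = S(α) u` and `u y = S²(y) u`, a crossing at a minimum can be traded for a
factor `u`. -/
theorem evalAlpha_flip_rs_mul (s : Bool) (t : H ⊗[k] H) :
    evalAlpha D.S D.α (QuasiHopf.flip (D.rs s) * t) =
      D.S (evalAlpha D.S D.α (QuasiHopf.flip t)) * D.us s := by
  induction t using TensorProduct.induction_on with
  | zero => simp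
  | add x y hx hy => rw [mul_add, map_add, hx, hy, map_add, map_add, map_add, add_mul]
  | tmul x y =>
    rw [evalAlpha_mul_tmul]
    change D.S x * D.kap s * y = _
    rw [kap_eq, flip_tmul, evalAlpha_tmul, mul_assoc, mul_assoc, us_mul]
    simp only [D.S_mul, mul_assoc]

/-- Two opposite crossings at a minimum cancel, but each may also be traded for its `us`. This gives
`α = S(us (!s)) us s α`, where `α` can be cancelled. -/
theorem S_us_mul_us (hα : IsUnit D.α) (s : Bool) : D.S (D.us (!s)) * D.us s = 1 := by
  have e := D.evalAlpha_flip_rs_mul s (D.rs (!s))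
  have e1 := congrArg QuasiHopf.flip (D.rs_mul s)
  rw [flip_mul, flip_flip, flip_one] at e1
  rw [e1, Algebra.TensorProduct.one_def, evalAlpha_tmul, D.S_one, one_mul, mul_one] at e
  change D.α = D.S (D.kap (!s)) * D.us s at e
  rw [kap_eq, D.S_mul, mul_assoc, ← us_mul, ← mul_assoc] at e
  exact hα.mul_right_cancel (by rw [one_mul, ← e])

end QuasitriangularQuasiHopf
end
end Hennings

/-! ### The coproducts of `u` and of the ribbon element -/

namespace Hennings

noncomputable section

namespace QuasitriangularQuasiHopf
open QuasiBialgebra QuasiHopf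
variable {k H : Type*} [Field k] [Ring H] [Algebra k H] (D : QuasitriangularQuasiHopf k H)
  {A : Type*} [Ring A] [Algebra k A]

section
variable {N : Type*} [AddCommMonoid N] [Module k N] (f g h : H →ₗ[k] A) (w : N →ₗ[k] A)
  [Commuting f w] [Commuting g w] [Commuting h w]

theorem Br_comm (s : Bool) (y : N) : D.Br s f g * w y = w y * D.Br s f g :=
  leg_comm (two f g) w _ y

theorem _root_.Hennings.QuasiBialgebra.Ph_comm (D : QuasiBialgebra k H) (y : N) :
    D.Ph f g h * w y = w y * D.Ph f g h :=
  leg_comm (two f (two g h)) w _ y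
end

section
variable {V : Type*} [AddCommGroup V] [Module k V] (E : A →ₗ[k] V)
  (a b x y : H →ₗ[k] A) [IsLeg a] [IsLeg b] [IsLeg x] [IsLeg y] [Commuting a b]
  [Commuting a x] [Commuting a y] [Commuting b x] [Commuting b y] [Commuting x y]

/-- Two strands `x`, `y` which twist fully around each other, cross the strands `a`, `b` and are
then joined to these: the strands can be joined one after the other. -/
theorem contract_braid (s : Bool) (hb : EqL E (D.cop b x) (D.eps A))
    (ha : EqL E (D.cop a y) (D.eps A)) :
    E (D.theta a b x y * D.Br s (D.cop x y) (D.cop a b) * (D.Br s y x * D.Br s x y)) =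
      E (D.Br s y a * D.Br s x b * D.theta x y a b) := by
  set z := D.cop a b with hz
  -- The hexagons gather the crossings of `y` with `z` and with `x` into a single crossing with `cop
  -- x z`.
  have l1 : D.theta a b x y * D.Br s (D.cop x y) z * (D.Br s y x * D.Br s x y) =
      D.Ph a b x * D.Br s x z * D.Br s y (D.cop x z) * (D.Ph y x z * D.Br s x y) := by
    rw [D.Br_hexagon_left x y z s, D.Br_hexagon_right y x z s, theta, ← hz]
    simp only [mul_assoc, PhI_mul_Ph_assoc]
  -- By naturality `y` passes the crossing of `x` with `z` and the associator. It then crosses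
  -- `a(bx)`, where the joined pair `b, x` is invisible to `E`.
  have l2 : D.Ph a b x * D.Br s x z * D.Br s y (D.cop x z) =
      D.Br s y (D.cop a (D.cop b x)) * (D.Ph a b x * D.Br s x z) := by
    refine intertwine_right y (fun h => ?_) (fun h => ?_) (D.rs s)
    · rw [mul_assoc, Br_nat, ← mul_assoc, Ph_nat, mul_assoc]
    · rw [mul_assoc, Br_comm, ← mul_assoc, Ph_comm, mul_assoc]
  have l3 : ∀ T, E (D.Br s y (D.cop a (D.cop b x)) * T) = E (D.Br s y a * T) :=
    (hb.cop_right (f := a)).right y (D.rs s)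
  have l4 : D.Ph a b x * D.Br s x z =
      D.Br s x b * (D.Ph a x b * D.Br s x a * D.PhI x a b) := by
    rw [hz, D.Br_hexagon_right x a b s]
    simp only [mul_assoc, Ph_mul_PhI_assoc]
  rw [l1, l2, mul_assoc, l3, l4]
  -- Naturality of the two remaining braidings exchanges their legs: once these are absorbed into
  -- `E'`, it is `y, a` and `x, b` that are joined in this order.
  set E' : A →ₗ[k] V := E ∘ₗ LinearMap.mulLeft k (D.Br s y a * D.Br s x b) with hE'
  have e' : ∀ T, E (D.Br s y a * D.Br s x b * T) = E' T := fun T => rfl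
  have ha' : EqL E' (D.cop y a) (D.eps A) := by
    intro h T
    rw [eps_apply, ← Algebra.smul_def, map_smul, ← e', ← e', mul_assoc, mul_assoc,
      ← mul_assoc (D.Br s x b), Br_comm, mul_assoc, ← mul_assoc (D.Br s y a), D.Br_nat y a s h,
      mul_assoc, ha.apply_eps]
  have hb' : EqL E' (D.cop x b) (D.eps A) := by
    intro h T
    rw [eps_apply, ← Algebra.smul_def, map_smul, ← e', ← e', mul_assoc, mul_assoc,
      ← mul_assoc (D.Br s x b), D.Br_nat x b s h, mul_assoc, ← mul_assoc (D.Br s y a), Br_comm,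
      mul_assoc, hb.apply_eps]
  have e0 : E (D.Br s y a * (D.Br s x b * (D.Ph a x b * D.Br s x a * D.PhI x a b) *
      (D.Ph y x z * D.Br s x y))) =
      E' (D.Ph a x b * (D.Br s x a * (D.PhI x a b * (D.Ph y x z * D.Br s x y)))) := by
    rw [← e']
    simp only [mul_assoc]
  rw [e0, e']
  -- Crossing `x` with the joined pair `y, a` has no effect, so such a braiding may be inserted;
  -- opened by the hexagon it supplies the crossings of `x` with `y` and with `a` that are still to
  -- be matched.
  have r1 : ∀ T, E' (D.Br s x (D.cop y a) * T) = E' T := by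
    intro T
    have := ha'.right x (D.rs s) T
    rw [← Br, ← Br, Br_eps_right, one_mul] at this
    exact this
  have r2 : D.Br s x y * D.PhI (D.cop x y) a b = D.PhI (D.cop y x) a b * D.Br s x y :=
    intertwine_left (two a b) (D.Br_nat x y s) (leg_comm (two x y) (two a b) _) _
  have r3 : D.Ph y x a * D.PhI (D.cop y x) a b =
      D.PhI y (D.cop x a) b * (D.PhI x a b * D.Ph y x z) := D.theta_eq y x a b
  have r4 : D.Br s x a * D.PhI y (D.cop x a) b = D.PhI y (D.cop a x) b * D.Br s x a :=
    intertwine_right y (intertwine_left b (D.Br_nat x a s) (leg_comm (two x a) b _))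
      (leg_comm (two x a) y _) _
  have r5 : D.PhI y a x * D.PhI y (D.cop a x) b =
      D.PhI (D.cop y a) x b * (D.PhI y a (D.cop x b) * D.Ph a x b) := by
    rw [← mul_assoc, D.PhI_pentagon y a x b, mul_assoc, PhI_mul_Ph, mul_one]
  -- The first two associators on the right each have a joined pair on one leg and vanish under
  -- `E'`.
  have r6 : D.PhI y a x * D.Br s x a * D.Ph y x a * D.Br s x y * D.PhI x y a *
      (D.Ph x y a * D.PhI (D.cop x y) a b) =
      D.PhI (D.cop y a) x b * (D.PhI y a (D.cop x b) * (D.Ph a x b *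
        (D.Br s x a * (D.PhI x a b * (D.Ph y x z * D.Br s x y))))) := by
    simp only [mul_assoc, PhI_mul_Ph_assoc]
    rw [r2, ← mul_assoc (D.Ph y x a), r3]
    simp only [mul_assoc]
    rw [← mul_assoc (D.Br s x a), r4]
    simp only [mul_assoc]
    rw [← mul_assoc (D.PhI y a x), r5]
    simp only [mul_assoc]
  rw [← r1 (D.theta x y a b), D.Br_hexagon_right x y a s, theta, r6, ha'.PhI_left x b,
    hb'.PhI_right y a]

end

/-- With `κ = S(t) α s` one has `S(x) κ y = S(S(y) α x) u`: a crossing above a minimum exchanges its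
legs at the price of `S` and `u`. Here this happens at both nested minima at once. -/
theorem gammaE_kap (t : H ⊗[k] (H ⊗[k] (H ⊗[k] H))) (s : Bool) :
    D.gammaE (D.Br s (legD k H) (legA k H) * D.Br s (legC k H) (legB k H) *
      two (legC k H) (two (legD k H) (two (legA k H) (legB k H))) t) =
    D.SS (QuasiHopf.flip
      (D.gammaE (two (legA k H) (two (legB k H) (two (legC k H) (legD k H))) t))) *
        (D.us s ⊗ₜ D.us s) := by
  have key : ∀ p q b c a d, D.gammaE (two (legD k H) (legA k H) p * two (legC k H) (legB k H) q *
      (b ⊗ₜ (c ⊗ₜ (a ⊗ₜ d)))) =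
      (D.S b * evalAlpha D.S D.α (QuasiHopf.flip q) * c) ⊗ₜ
        (D.S a * evalAlpha D.S D.α (QuasiHopf.flip p) * d) := by
    intro p q b c a d
    induction p using TensorProduct.induction_on with
    | zero => simp
    | add x y hx hy =>
      simp only [map_add, add_mul, mul_add, hx, hy, TensorProduct.tmul_add]
    | tmul x y =>
      induction q using TensorProduct.induction_on with
      | zero => simp
      | add x y hx hy =>
        simp only [map_add, add_mul, mul_add, hx, hy, TensorProduct.add_tmul]
      | tmul z w => simp [D.S_mul, mul_assoc]
  have hk : ∀ x y, D.S x * D.kap s * y = D.S (D.S y * D.α * x) * D.us s := by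
    intro x y
    rw [kap_eq]
    simp only [D.S_mul, mul_assoc, us_mul]
  have : D.gammaE ∘ₗ LinearMap.mulLeft k (D.Br s (legD k H) (legA k H) *
      D.Br s (legC k H) (legB k H)) ∘ₗ
      two (legC k H) (two (legD k H) (two (legA k H) (legB k H))) =
      LinearMap.mulRight k (D.us s ⊗ₜ D.us s) ∘ₗ D.SS ∘ₗ QuasiHopf.flip ∘ₗ D.gammaE ∘ₗ
        two (legA k H) (two (legB k H) (two (legC k H) (legD k H))) := by
    ext a b c d
    simp only [TensorProduct.AlgebraTensorModule.curry_apply, TensorProduct.curry_apply,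
      LinearMap.coe_restrictScalars, LinearMap.comp_apply, LinearMap.mulLeft_apply,
      LinearMap.mulRight_apply]
    have e1 : two (legC k H) (two (legD k H) (two (legA k H) (legB k H)))
        (a ⊗ₜ (b ⊗ₜ (c ⊗ₜ d))) = (d ⊗ₜ (a ⊗ₜ (c ⊗ₜ b)) : H ⊗[k] (H ⊗[k] (H ⊗[k] H))) := by
      simp
    have e2 : two (legA k H) (two (legB k H) (two (legC k H) (legD k H)))
        (a ⊗ₜ (b ⊗ₜ (c ⊗ₜ d))) = (b ⊗ₜ (c ⊗ₜ (a ⊗ₜ d)) : H ⊗[k] (H ⊗[k] (H ⊗[k] H))) := by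
      simp
    rw [e1, e2, Br, Br, key]
    change (D.S d * D.kap s * a) ⊗ₜ (D.S c * D.kap s * b) = _
    rw [hk, hk, gammaE_tmul, flip_tmul, SS_tmul, Algebra.TensorProduct.tmul_mul_tmul]
  exact LinearMap.congr_fun this t

/-- `f Δ(u) R₂₁ R = (S ⊗ S)(f₂₁) (u ⊗ u)` -/
theorem f_comul_us (hα : IsUnit D.α) (s : Bool) :
    D.f * D.comul (D.us s) * (QuasiHopf.flip (D.rs s) * D.rs s) =
      D.SS (QuasiHopf.flip D.f) * (D.us s ⊗ₜ D.us s) := by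
  -- For these legs the left side will be read as `f Δ(S(t) α s) R₂₁ R` and the right side as `(S ⊗
  -- S)(γ₂₁) (u ⊗ u)`, for the chosen sign of the braiding.
  have e := D.contract_braid D.gammaE (legA k H) (legB k H) (legC k H) (legD k H) s
    D.gammaE_bc D.gammaE_ad
  have h1 : ∀ q p, D.gammaE (D.theta (legA k H) (legB k H) (legC k H) (legD k H) *
      two (D.cop (legC k H) (legD k H)) (D.cop (legA k H) (legB k H)) q *
        two (legC k H) (legD k H) p) =
      D.f * D.comul (evalAlpha D.S D.α (QuasiHopf.flip q)) * p := by
    intro q p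
    rw [gammaE_mul_cd]
    congr 1
    induction q using TensorProduct.induction_on with
    | zero => simp
    | add x y hx hy => simp only [map_add, mul_add, hx, hy]
    | tmul x y =>
      have c := leg_comm (D.cop (legC k H) (legD k H)) (D.cop (legA k H) (legB k H)) x y
      rw [two_tmul, c, ← mul_assoc, cop_apply _ (legC k H), gammaE_mul_cd, cop_apply,
        gammaE_mul_ab, ← gamma_eq, ← f_comul_alpha, flip_tmul, evalAlpha_tmul, ← mul_assoc,
        f_comul_S, map_mul, map_mul]
      simp only [mul_assoc]
  have h2 : D.Br s (legD k H) (legC k H) * D.Br s (legC k H) (legD k H) =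
      two (legC k H) (legD k H) (QuasiHopf.flip (D.rs s) * D.rs s) := by
    rw [leg_mul (two _ _), two_flip]
    rfl
  have h3 := D.gammaE_kap D.theta₀ s
  rw [four_theta₀, four_theta₀, ← e, h2] at h3
  have h4 := (h1 (D.rs s) (QuasiHopf.flip (D.rs s) * D.rs s)).symm.trans h3
  change D.f * D.comul (D.kap s) * _ = _ at h4
  have h5 : D.SS (QuasiHopf.flip D.gamma) =
      D.SS (QuasiHopf.flip (D.comul D.α)) * D.SS (QuasiHopf.flip D.f) := by
    rw [← f_comul_alpha, flip_mul, SS_mul]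
  rw [← gamma_eq, h5, kap_eq, map_mul, ← mul_assoc D.f, ← f_comul_S] at h4
  -- This `β` is a right inverse of `α`, not the antipode element. It serves to cancel the common
  -- factor `(S ⊗ S)(Δᵒᵖ(α))`.
  obtain ⟨β, hβ⟩ := hα.exists_right_inv
  have h6 : D.SS (QuasiHopf.flip (D.comul β)) * D.SS (QuasiHopf.flip (D.comul D.α)) = 1 := by
    rw [← SS_mul, ← flip_mul, ← map_mul, hβ, map_one, flip_one, SS_one]
  have h7 := congrArg (fun z => D.SS (QuasiHopf.flip (D.comul β)) * z) h4
  simp only [← mul_assoc, h6, one_mul] at h7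
  rw [← mul_assoc, h7]

end QuasitriangularQuasiHopf

namespace RibbonQuasiHopf
open QuasiBialgebra QuasiHopf QuasitriangularQuasiHopf
variable {k H : Type*} [Field k] [Ring H] [Algebra k H] (D : RibbonQuasiHopf k H)

theorem v_mul_vInv : (D.v : H) * D.vInv = 1 := D.v.mul_inv

theorem vInv_mul_v : D.vInv * (D.v : H) = 1 := D.v.inv_mul

theorem vInv_central (h : H) : D.vInv * h = h * D.vInv := by
  have := congrArg (fun x => D.vInv * x * D.vInv) (D.v_central h)
  simp only [← mul_assoc, vInv_mul_v, one_mul] at this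
  rw [mul_assoc, v_mul_vInv, mul_one] at this
  exact this.symm

theorem S_vInv : D.S D.vInv = D.vInv := by
  have := congrArg D.S D.v_mul_vInv
  rw [D.S_mul, D.S_v, D.S_one] at this
  have h := congrArg (fun x => x * D.vInv) this
  simpa only [mul_assoc, v_mul_vInv, mul_one, one_mul] using h

theorem counit_vInv : D.counit D.vInv = 1 := by
  have := congrArg D.counit D.v_mul_vInv
  rwa [map_mul, D.counit_v, one_mul, map_one] at this

theorem us_true_mul_S : D.us true * D.S (D.us true) = D.v * D.v := by
  rw [← u_eq, D.v_sq]

/-- `u S(u) = v²` makes `u` right invertible, so `u u = S²(u) u` gives `S²(u) = u`. Then `u S(u) =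
S³(u) u = S(u) u`. -/
theorem S_mul_us_true : D.S (D.us true) * D.us true = D.v * D.v := by
  have h1 := D.us_mul true (D.us true)
  have h2 := D.us_mul true (D.S (D.us true))
  have hr : D.us true * (D.S (D.us true) * (D.vInv * D.vInv)) = 1 := by
    rw [← mul_assoc, us_true_mul_S, mul_assoc, ← mul_assoc (D.v : H) D.vInv, v_mul_vInv, one_mul,
      v_mul_vInv]
  have e1 : D.S (D.S (D.us true)) = D.us true := by
    have := congrArg (· * (D.S (D.us true) * (D.vInv * D.vInv))) h1
    simpa only [mul_assoc, hr, mul_one] using this.symm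
  rw [e1, us_true_mul_S] at h2
  exact h2.symm

theorem isUnit_us : IsUnit (D.us true) := by
  have h : (D.v : H) * D.v * (D.vInv * D.vInv) = 1 := by
    rw [mul_assoc, ← mul_assoc (D.v : H) D.vInv, v_mul_vInv, one_mul, v_mul_vInv]
  refine isUnit_iff_exists.2 ⟨D.S (D.us true) * (D.vInv * D.vInv), ?_, ?_⟩
  · rw [← mul_assoc, us_true_mul_S, h]
  · rw [mul_assoc, mul_assoc, D.vInv_central, D.vInv_central, ← mul_assoc, ← mul_assoc,
      S_mul_us_true, mul_assoc, h]

/-- The element `u` for the inverse braiding is `u v⁻²`. -/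
theorem us_false (hα : IsUnit D.α) : D.us false = D.us true * (D.vInv * D.vInv) := by
  have h : (D.v : H) * D.v * (D.vInv * D.vInv) = 1 := by
    rw [mul_assoc, ← mul_assoc (D.v : H) D.vInv, v_mul_vInv, one_mul, v_mul_vInv]
  have h1 := D.S_us_mul_us hα false
  have h2 : D.S (D.us true) * (D.us true * (D.vInv * D.vInv)) = 1 := by
    rw [← mul_assoc, S_mul_us_true, h]
  have hu : IsUnit (D.S (D.us true)) := by
    refine isUnit_iff_exists.2 ⟨D.us true * (D.vInv * D.vInv), h2, ?_⟩
    rw [mul_assoc, mul_assoc, D.vInv_central, D.vInv_central, ← mul_assoc, ← mul_assoc,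
      us_true_mul_S, mul_assoc, h]
  exact hu.mul_left_cancel (h1.trans h2.symm)

theorem G_eq : D.G = D.us true * D.vInv := by rw [G, u_eq]

theorem isUnit_G : IsUnit D.G := by
  rw [G_eq]
  exact D.isUnit_us.mul ⟨D.v⁻¹, rfl⟩

theorem G_mul_Ginv : D.G * D.Ginv = 1 := Ring.mul_inverse_cancel _ D.isUnit_G

theorem Ginv_mul_G : D.Ginv * D.G = 1 := Ring.inverse_mul_cancel _ D.isUnit_G

theorem G_mul (h : H) : D.G * h = D.S (D.S h) * D.G := by
  rw [G_eq, mul_assoc, D.vInv_central, ← mul_assoc, us_mul, mul_assoc]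

theorem mul_Ginv (h : H) : h * D.Ginv = D.Ginv * D.S (D.S h) := by
  have e := congrArg (fun x => D.Ginv * x * D.Ginv) (D.G_mul h)
  simp only [← mul_assoc, Ginv_mul_G, one_mul] at e
  rw [e, mul_assoc, mul_assoc, G_mul_Ginv, mul_one]

theorem Ginv_mul_us_true : D.Ginv * D.us true = D.v := by
  have : D.us true = D.G * D.v := by rw [G_eq, mul_assoc, vInv_mul_v, mul_one]
  rw [this, ← mul_assoc, Ginv_mul_G, one_mul]

theorem Ginv_mul_us_false (hα : IsUnit D.α) : D.Ginv * D.us false = D.vInv := by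
  rw [D.us_false hα, ← mul_assoc, Ginv_mul_us_true, ← mul_assoc, v_mul_vInv, one_mul]

/-- `S(G) G = 1`, because `S(u) u = v²` and `G = u v⁻¹` with `v` central and fixed by `S`. -/
theorem S_Ginv : D.S D.Ginv = D.G := by
  have h1 : D.S D.G * D.G = 1 := by
    rw [G_eq, D.S_mul, S_vInv, D.vInv_central, mul_assoc, D.vInv_central, mul_assoc,
      ← mul_assoc (D.S _), S_mul_us_true, mul_assoc, ← mul_assoc (D.v : H) D.vInv,
      v_mul_vInv, one_mul, v_mul_vInv]
  have h2 : D.S D.Ginv * D.S D.G = 1 := by rw [← D.S_mul, G_mul_Ginv, D.S_one]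
  exact left_inv_eq_right_inv h2 h1

/-- `Δ(v) R₂₁ R = v ⊗ v` -/
theorem comul_v_mul_M (hα : IsUnit D.α) (hf : IsUnit D.f) :
    D.comul D.v * D.M = (D.v : H) ⊗ₜ (D.v : H) := by
  -- With `u = G v`, the ribbon axiom turns `(S ⊗ S)(f₂₁)(G ⊗ G)` into `f Δ(G)`, a unit common to
  -- both sides.
  have e := D.f_comul_us hα true
  have h1 : D.us true = D.G * D.v := by rw [G_eq, mul_assoc, vInv_mul_v, mul_one]
  have h2 : D.f * D.comul D.G = D.SS (QuasiHopf.flip D.f) * (D.G ⊗ₜ D.G) := D.comul_G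
  have h3 : (D.us true) ⊗ₜ[k] (D.us true) = (D.G ⊗ₜ D.G) * ((D.v : H) ⊗ₜ (D.v : H)) := by
    rw [Algebra.TensorProduct.tmul_mul_tmul, ← h1]
  rw [h3, ← mul_assoc (D.SS _), ← h2, h1, map_mul, ← mul_assoc D.f, mul_assoc (D.f * _)] at e
  exact (hf.mul (D.isUnit_G.map D.comul)).mul_left_cancel e

theorem M_mul_Minv : D.M * D.Minv = 1 := by
  have h : QuasiHopf.flip D.r * QuasiHopf.flip D.rInv = 1 := by
    rw [← flip_mul, rInv, r, Units.mul_inv, flip_one]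
  have h' : D.r * D.rInv = 1 := by rw [rInv, r, Units.mul_inv]
  rw [Minv, M, mul_assoc, ← mul_assoc D.r, h', one_mul, h]

theorem comul_v (hα : IsUnit D.α) (hf : IsUnit D.f) :
    D.comul D.v = ((D.v : H) ⊗ₜ (D.v : H)) * D.Minv := by
  rw [← D.comul_v_mul_M hα hf, mul_assoc, M_mul_Minv, mul_one]

theorem tmul_v_central (t : H ⊗[k] H) :
    ((D.v : H) ⊗ₜ[k] (D.v : H)) * t = t * ((D.v : H) ⊗ₜ[k] (D.v : H)) := by
  induction t using TensorProduct.induction_on with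
  | zero => simp
  | add x y hx hy => rw [mul_add, add_mul, hx, hy]
  | tmul x y =>
    rw [Algebra.TensorProduct.tmul_mul_tmul, Algebra.TensorProduct.tmul_mul_tmul, D.v_central,
      D.v_central]

theorem tmul_vInv_central (t : H ⊗[k] H) :
    (D.vInv ⊗ₜ[k] D.vInv) * t = t * (D.vInv ⊗ₜ[k] D.vInv) := by
  induction t using TensorProduct.induction_on with
  | zero => simp
  | add x y hx hy => rw [mul_add, add_mul, hx, hy]
  | tmul x y =>
    rw [Algebra.TensorProduct.tmul_mul_tmul, Algebra.TensorProduct.tmul_mul_tmul, D.vInv_central,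
      D.vInv_central]

theorem comul_vInv (hα : IsUnit D.α) (hf : IsUnit D.f) :
    D.comul D.vInv = (D.vInv ⊗ₜ D.vInv) * D.M := by
  have h1 : (D.vInv ⊗ₜ[k] D.vInv) * D.M * D.comul D.v = 1 := by
    rw [D.comul_v hα hf, tmul_v_central, mul_assoc, ← mul_assoc D.M, M_mul_Minv, one_mul,
      Algebra.TensorProduct.tmul_mul_tmul, vInv_mul_v, Algebra.TensorProduct.one_def]
  have h2 : D.comul D.v * D.comul D.vInv = 1 := by rw [← map_mul, v_mul_vInv, map_one]
  exact (left_inv_eq_right_inv h1 h2).symm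

end RibbonQuasiHopf
end
end Hennings

/-! ### Slices by a functional; intertwining properties of `p_L`, `q_L` and `U` -/

namespace Hennings

noncomputable section

theorem EqR.cop_left {k H : Type*} [Field k] [Ring H] [Algebra k H] {D : QuasiBialgebra k H}
    {A : Type*} [Ring A] [Algebra k A] {V : Type*} [AddCommGroup V] [Module k V]
    {E : A →ₗ[k] V} {F f : H →ₗ[k] A} [Commuting F f] (e : EqR E F (D.eps A)) :
    EqR E (D.cop F f) f := by
  intro y T
  have := e.left f (D.comul y) T
  rwa [← QuasiBialgebra.cop_apply, ← QuasiBialgebra.cop_apply, QuasiBialgebra.cop_eps_left] at this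

section Slice
variable {k H : Type*} [Field k] [Ring H] [Algebra k H] (l : H →ₗ[k] k)

@[simp] theorem slice_tmul (x y : H) : slice l (x ⊗ₜ y) = l x • y := by
  simp [slice]

theorem slice_one_tmul_mul (a : H) (T : H ⊗[k] H) : slice l (1 ⊗ₜ a * T) = a * slice l T := by
  induction T using TensorProduct.induction_on with
  | zero => simp
  | add x y hx hy => rw [mul_add, map_add, map_add, hx, hy, mul_add]
  | tmul x y => simp

theorem slice_mul_one_tmul (a : H) (T : H ⊗[k] H) : slice l (T * 1 ⊗ₜ a) = slice l T * a := by
  induction T using TensorProduct.induction_on with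
  | zero => simp
  | add x y hx hy => rw [add_mul, map_add, map_add, hx, hy, add_mul]
  | tmul x y => simp

theorem slice_mulLeft (a : H) (T : H ⊗[k] H) :
    slice l (a ⊗ₜ 1 * T) = slice (l ∘ₗ LinearMap.mulLeft k a) T := by
  induction T using TensorProduct.induction_on with
  | zero => simp
  | add x y hx hy => rw [mul_add, map_add, map_add, hx, hy]
  | tmul x y => simp

theorem slice_mulRight (a : H) (T : H ⊗[k] H) :
    slice l (T * a ⊗ₜ 1) = slice (l ∘ₗ LinearMap.mulRight k a) T := by
  induction T using TensorProduct.induction_on with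
  | zero => simp
  | add x y hx hy => rw [add_mul, map_add, map_add, hx, hy]
  | tmul x y => simp

/-- If slices of `T` fill the algebra, a functional is determined by its slice of `T`. -/
theorem slice_injective [Module.Finite k H] (T : H ⊗[k] H)
    (hT : ∀ h, ∃ l : H →ₗ[k] k, slice l T = h) {l l' : H →ₗ[k] k} (h : slice l T = slice l' T) :
    l = l' := by
  let φ : Module.Dual k H →ₗ[k] H :=
    { toFun := fun l => slice l T
      map_add' := fun l l' => by simp [slice, TensorProduct.map_add_left]
      map_smul' := fun c l => by simp [slice, TensorProduct.map_smul_left] }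
  have hs : Function.Surjective φ := hT
  -- The dual has the same dimension as `H`, so surjectivity gives injectivity.
  exact ((LinearMap.injective_iff_surjective_of_finrank_eq_finrank
    (Subspace.dual_finrank_eq)).2 hs) h

end Slice

namespace QuasiHopf
open QuasiBialgebra
variable {k H : Type*} [Field k] [Ring H] [Algebra k H] (D : QuasiHopf k H)

@[simp] theorem S_symm_S (x : H) : D.S.symm (D.S x) = x := D.S.symm_apply_apply x

@[simp] theorem S_S_symm (x : H) : D.S (D.S.symm x) = x := D.S.apply_symm_apply x

theorem S_symm_mul (x y : H) : D.S.symm (x * y) = D.S.symm y * D.S.symm x := by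
  rw [LinearEquiv.symm_apply_eq, D.S_mul, S_S_symm, S_S_symm]

theorem S_symm_one : D.S.symm 1 = 1 := by
  rw [LinearEquiv.symm_apply_eq, D.S_one]

theorem SSinv_mul (s t : H ⊗[k] H) : D.SSinv (s * t) = D.SSinv t * D.SSinv s := by
  induction s using TensorProduct.induction_on with
  | zero => simp
  | add x y hx hy => rw [add_mul, map_add, map_add, hx, hy, mul_add]
  | tmul x y =>
    induction t using TensorProduct.induction_on with
    | zero => simp
    | add x y hx hy => rw [mul_add, map_add, map_add, hx, hy, add_mul]
    | tmul z w => simp [S_symm_mul]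

theorem SSinv_flip_SS_flip (t : H ⊗[k] H) : D.SSinv (flip (D.SS (flip t))) = t := by
  induction t using TensorProduct.induction_on with
  | zero => simp
  | add x y hx hy => simp only [map_add, hx, hy]
  | tmul x y => simp

/-- The element `(S ⊗ S)((p_L)₂₁) f`. -/
def U : H ⊗[k] H := D.SS (flip D.pL) * D.f

/-- `a ⊗ b ⊗ c ↦ S(c) ⊗ a β S(b)` -/
def pLE : H ⊗[k] (H ⊗[k] H) →ₗ[k] H ⊗[k] H :=
  two (D.betaLeg (jr H LinearMap.id)) (two (D.antiLeg (jr H LinearMap.id))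
    (D.antiLeg (jl k H H)))

theorem SS_flip_pL : D.SS (flip D.pL) = D.pLE D.phi := by
  have : D.SS ∘ₗ flip ∘ₗ TensorProduct.map
      (LinearMap.mul' k H ∘ₗ flip ∘ₗ
      TensorProduct.map (D.S.symm.toLinearMap ∘ₗ LinearMap.mulRight k D.β) LinearMap.id)
      LinearMap.id ∘ₗ (TensorProduct.assoc k H H H).symm.toLinearMap = D.pLE := by
    ext a b c
    simp [pLE, D.S_mul, mul_assoc]
  exact LinearMap.congr_fun this D.phi

/-- `x ⊗ y ↦ (1 ⊗ x) (S ⊗ S)((p_L)₂₁) (S ⊗ S)(Δᵒᵖ(y))` -/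
def pLJ : H ⊗[k] H →ₗ[k] H ⊗[k] H :=
  two (LinearMap.mulRight k (D.SS (flip D.pL)) ∘ₗ jr H LinearMap.id)
    (D.SS ∘ₗ flip ∘ₗ D.comul.toLinearMap)

@[simp] theorem pLJ_tmul (x y : H) :
    D.pLJ (x ⊗ₜ y) = 1 ⊗ₜ x * D.SS (flip D.pL) * D.SS (flip (D.comul y)) := by
  simp [pLJ]

/-- `p_L` is `Φ` with its first two strands closed by a maximum. In the naturality of `Φ` the
maximum absorbs their coproduct on one side, leaving `h` on the third strand alone. -/
theorem pLJ_comul (h : H) : D.pLJ (D.comul h) = D.S h ⊗ₜ 1 * D.SS (flip D.pL) := by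
  set f := jl k H (H ⊗[k] H)
  set g := jr H (jl k H H)
  set w : H →ₗ[k] H ⊗[k] (H ⊗[k] H) := jr H (jr H LinearMap.id)
  have hR : EqR D.pLE (D.cop f g) (D.eps _) := (D.invR_beta (jr H LinearMap.id)).head _
  have e := congrArg D.pLE (D.Ph_nat f g w h)
  rw [hR.cop_left (f := w) h] at e
  have c : ∀ t, two f (two g w) t = t := by
    intro t
    have : two f (two g w) = LinearMap.id := by
      ext a b c
      simp [f, g, w]
    rw [this]; rfl
  have b1 : D.pLE ∘ₗ LinearMap.mulRight k (w h) =
      LinearMap.mulLeft k (D.S h ⊗ₜ 1) ∘ₗ D.pLE := by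
    ext a b c
    simp [w, pLE, D.S_mul, mul_assoc]
  have b2 : ∀ t, D.pLE (two f (D.cop g w) t * D.phi) = D.pLJ t := by
    intro t
    induction t using TensorProduct.induction_on with
    | zero => simp
    | add x y hx hy => rw [map_add, map_add, add_mul, map_add, hx, hy]
    | tmul x y =>
      rw [pLJ_tmul, SS_flip_pL, two_tmul, cop_apply]
      have : ∀ p, D.pLE ∘ₗ LinearMap.mulLeft k (f x * two g w p) =
          LinearMap.mulRight k (D.SS (flip p)) ∘ₗ LinearMap.mulLeft k (1 ⊗ₜ x) ∘ₗ D.pLE := by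
        intro p
        ext a b c
        induction p using TensorProduct.induction_on with
        | zero => simp
        | tmul y z => simp [f, g, w, pLE, D.S_mul, mul_assoc]
        | add y z hy hz =>
          simp only [TensorProduct.AlgebraTensorModule.curry_apply, TensorProduct.curry_apply,
            LinearMap.coe_restrictScalars, LinearMap.comp_apply, LinearMap.mulLeft_apply,
            LinearMap.mulRight_apply] at hy hz ⊢
          simp only [map_add, mul_add, add_mul, hy, hz]
      exact LinearMap.congr_fun (this (D.comul y)) D.phi
  have c1 := LinearMap.congr_fun b1 D.phi
  have c2 := b2 (D.comul h)
  rw [SS_flip_pL, ← c2]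
  refine Eq.trans ?_ c1
  refine Eq.trans ?_ (e.symm.trans ?_)
  · rw [Ph, c]; rfl
  · rw [Ph, c]; rfl

/-- `x ⊗ y ↦ (1 ⊗ x) U Δ(S(y))` -/
def UJ : H ⊗[k] H →ₗ[k] H ⊗[k] H :=
  two (LinearMap.mulRight k D.U ∘ₗ jr H LinearMap.id) (D.comul.toLinearMap ∘ₗ D.S.toLinearMap)

@[simp] theorem UJ_tmul (x y : H) :
    D.UJ (x ⊗ₜ y) = 1 ⊗ₜ x * D.U * D.comul (D.S y) := by
  simp [UJ]

/-- `f` turns `(S ⊗ S)(Δᵒᵖ(y))` into `Δ(S(y))`. Next to `Δ(Λ)` for a left integral `Λ`, the identity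
lets a bead pass from one tensor factor to the other. -/
theorem UJ_comul (h : H) : D.UJ (D.comul h) = D.S h ⊗ₜ 1 * D.U := by
  have : D.UJ = LinearMap.mulRight k D.f ∘ₗ D.pLJ := by
    ext x y
    simp only [TensorProduct.AlgebraTensorModule.curry_apply, TensorProduct.curry_apply,
      LinearMap.coe_restrictScalars, LinearMap.comp_apply, LinearMap.mulRight_apply, UJ_tmul,
      pLJ_tmul, U]
    simp only [mul_assoc, f_comul_S]
  rw [this, LinearMap.comp_apply, pLJ_comul, U, LinearMap.mulRight_apply, mul_assoc]

/-- `a ⊗ b ⊗ c ↦ S(a) α b ⊗ c` -/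
def qLE : H ⊗[k] (H ⊗[k] H) →ₗ[k] H ⊗[k] H :=
  two (D.alphaLeg (jl k H H)) (two (jl k H H) (jr H LinearMap.id))

theorem qL_eq : D.qL = D.qLE D.phiInv := by
  have : TensorProduct.map (evalAlpha D.S D.α) LinearMap.id ∘ₗ
      (TensorProduct.assoc k H H H).symm.toLinearMap = D.qLE := by
    ext a b c
    simp [qLE]
  exact LinearMap.congr_fun this D.phiInv

/-- `x ⊗ y ↦ (S(x) ⊗ 1) q_L Δ(y)` -/
def qLJ : H ⊗[k] H →ₗ[k] H ⊗[k] H :=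
  two (LinearMap.mulRight k D.qL ∘ₗ D.antiLeg (jl k H H)) D.comul.toLinearMap

@[simp] theorem qLJ_tmul (x y : H) :
    D.qLJ (x ⊗ₜ y) = D.S x ⊗ₜ 1 * D.qL * D.comul y := by
  simp [qLJ]

/-- The counterpart of `pLJ_comul`: in the naturality of `Φ⁻¹` the minimum in `q_L` absorbs the
coproduct of the first two strands. -/
theorem qLJ_comul (h : H) : D.qLJ (D.comul h) = 1 ⊗ₜ h * D.qL := by
  set f := jl k H (H ⊗[k] H)
  set g := jr H (jl k H H)
  set w : H →ₗ[k] H ⊗[k] (H ⊗[k] H) := jr H (jr H LinearMap.id)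
  have hL : EqL D.qLE (D.cop f g) (D.eps _) := (D.invL_alpha (jl k H H)).head _
  have e := congrArg D.qLE (D.PhI_nat f g w h)
  rw [hL.cop_left (f := w) h] at e
  have c : ∀ t, two f (two g w) t = t := by
    intro t
    have : two f (two g w) = LinearMap.id := by
      ext a b c
      simp [f, g, w]
    rw [this]; rfl
  have b1 : D.qLE ∘ₗ LinearMap.mulLeft k (w h) =
      LinearMap.mulLeft k (1 ⊗ₜ h) ∘ₗ D.qLE := by
    ext a b c
    simp [w, qLE, mul_assoc]
  have b2 : ∀ t, D.qLE (D.phiInv * two f (D.cop g w) t) = D.qLJ t := by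
    intro t
    induction t using TensorProduct.induction_on with
    | zero => simp
    | add x y hx hy => rw [map_add, map_add, mul_add, map_add, hx, hy]
    | tmul x y =>
      rw [qLJ_tmul, qL_eq, two_tmul, cop_apply]
      have : ∀ p, D.qLE ∘ₗ LinearMap.mulRight k (f x * two g w p) =
          LinearMap.mulRight k p ∘ₗ LinearMap.mulLeft k (D.S x ⊗ₜ 1) ∘ₗ D.qLE := by
        intro p
        ext a b c
        induction p using TensorProduct.induction_on with
        | zero => simp
        | tmul y z => simp [f, g, w, qLE, D.S_mul, mul_assoc]
        | add y z hy hz =>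
          simp only [TensorProduct.AlgebraTensorModule.curry_apply, TensorProduct.curry_apply,
            LinearMap.coe_restrictScalars, LinearMap.comp_apply, LinearMap.mulLeft_apply,
            LinearMap.mulRight_apply] at hy hz ⊢
          simp only [map_add, mul_add, hy, hz]
      exact LinearMap.congr_fun (this (D.comul y)) D.phiInv
  have c1 := LinearMap.congr_fun b1 D.phiInv
  have c2 := b2 (D.comul h)
  rw [qL_eq, ← c2]
  refine Eq.trans ?_ c1
  refine Eq.trans ?_ (e.trans ?_)
  · rw [PhI, c]; rfl
  · rw [PhI, c]; rfl

end QuasiHopf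
end
end Hennings

/-! ### The element `q_L` expressed through `U` -/

namespace Hennings

noncomputable section

namespace QuasiHopf
open QuasiBialgebra
variable {k H : Type*} [Field k] [Ring H] [Algebra k H] (D : QuasiHopf k H)

theorem SS_comul_mul_gamma (h : H) : D.SS (flip (D.comul h)) * D.gamma =
    D.f * D.comul (D.S h * D.α) := by
  rw [← f_comul_alpha, ← mul_assoc, f_comul_S, mul_assoc, ← map_mul]

/-- `X ⊗ Y ⊗ Z ↦ (1 ⊗ X) U Δ(S(Y) α Z)` -/
def qLU : H ⊗[k] (H ⊗[k] H) →ₗ[k] H ⊗[k] H :=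
  two (LinearMap.mulRight k D.U ∘ₗ jr H LinearMap.id) (D.comul.toLinearMap ∘ₗ evalAlpha D.S D.α)

@[simp] theorem qLU_tmul (x y z : H) : D.qLU (x ⊗ₜ (y ⊗ₜ z)) =
    1 ⊗ₜ x * D.U * D.comul (D.S y * D.α * z) := by
  simp [qLU]

/-- `q_L = (1 ⊗ X) U Δ(S(Y) α Z)` for `Φ = X ⊗ Y ⊗ Z` -/
theorem qLU_phi : D.qLU D.phi = D.qL := by
  -- Five strands: `l2, l3` are joined in the first output, and `l0, l1, l4` form a zigzag in the
  -- second. One product of associators is evaluated under `F` in two ways.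
  set F : H ⊗[k] (H ⊗[k] (H ⊗[k] (H ⊗[k] H))) →ₗ[k] H ⊗[k] H :=
    two (D.alphaLeg (jl k H H)) (two (jl k H H) (two (D.betaLeg (jr H LinearMap.id))
      (two (D.alphaLeg (jr H LinearMap.id)) (jr H LinearMap.id)))) with hF
  set l2 := jl k H (H ⊗[k] (H ⊗[k] (H ⊗[k] H)))
  set l3 := jr H (jl k H (H ⊗[k] (H ⊗[k] H)))
  set l0 := jr H (jr H (jl k H (H ⊗[k] H)))
  set l1 := jr H (jr H (jr H (jl k H H)))
  set l4 : H →ₗ[k] H ⊗[k] (H ⊗[k] (H ⊗[k] (H ⊗[k] H))) :=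
    jr H (jr H (jr H (jr H LinearMap.id)))
  have hL : EqL F (D.cop l2 l3) (D.eps _) := (D.invL_alpha (jl k H H)).head _
  have hR : EqR F (D.cop l0 l1) (D.eps _) :=
    (((D.invR_beta_alpha (jr H LinearMap.id)).head _).shift_cop).shift_cop
  have hX : F (D.theta l1 l2 l3 l4 * D.Ph l0 (D.cop l1 l2) (D.cop l3 l4) * D.Ph l0 l1 l2) =
      D.qL := by
    have e : D.theta l1 l2 l3 l4 * D.Ph l0 (D.cop l1 l2) (D.cop l3 l4) * D.Ph l0 l1 l2 =
        D.PhI l1 (D.cop l2 l3) l4 * (D.Ph l0 l1 (D.cop (D.cop l2 l3) l4) *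
          (D.PhI l2 l3 l4 * D.Ph (D.cop l0 l1) l2 (D.cop l3 l4))) := by
      have p := D.Ph_pentagon l0 l1 l2 (D.cop l3 l4)
      have n : D.PhI l2 l3 l4 * D.Ph l0 l1 (D.cop l2 (D.cop l3 l4)) =
          D.Ph l0 l1 (D.cop (D.cop l2 l3) l4) * D.PhI l2 l3 l4 := by
        refine intertwine_right l0 (intertwine_right l1 (D.PhI_nat l2 l3 l4) ?_) ?_ _
        · exact leg_comm (two l2 (two l3 l4)) l1 _
        · exact leg_comm (two l2 (two l3 l4)) l0 _
      rw [theta_eq]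
      rw [← mul_assoc (D.Ph l0 l1 _), ← n]
      simp only [mul_assoc] at p ⊢
      rw [p]
    have h5 : EqL F (D.cop (D.cop l2 l3) l4) l4 := hL.cop_left
    have z : D.Ph l0 l1 (D.cop (D.cop l2 l3) l4) = two l0 (two l1 (D.cop (D.cop l2 l3) l4))
      D.phi := rfl
    -- What survives the contractions is `Φ` on `l0, l1, l4`, a zigzag of value `1`, and `Φ⁻¹` on
    -- `l2, l3, l4`, which is `q_L`.
    rw [e, hL.PhI_mid l1 l4, z, (h5.right l1).right l0]
    rw [← mul_assoc, hR.Ph_left l2 (D.cop l3 l4), qL_eq]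
    have key : ∀ t : H ⊗[k] (H ⊗[k] H),
        F ∘ₗ LinearMap.mulLeft k (two l0 (two l1 l4) t) ∘ₗ two l2 (two l3 l4) =
        LinearMap.mulLeft k (1 ⊗ₜ (LinearMap.mul' k H (TensorProduct.map (LinearMap.mulRight k D.β)
          (evalAlpha D.S D.α) t))) ∘ₗ D.qLE := by
      intro t
      ext p q r
      induction t using TensorProduct.induction_on with
      | zero => simp
      | add x y hx hy =>
        simp only [TensorProduct.AlgebraTensorModule.curry_apply, TensorProduct.curry_apply,
          LinearMap.coe_restrictScalars, LinearMap.comp_apply, LinearMap.mulLeft_apply] at hx hy ⊢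
        simp only [map_add, add_mul, hx, hy, TensorProduct.tmul_add]
      | tmul x t =>
        induction t using TensorProduct.induction_on with
        | zero => simp
        | add x y hx hy =>
          simp only [TensorProduct.AlgebraTensorModule.curry_apply, TensorProduct.curry_apply,
            LinearMap.coe_restrictScalars, LinearMap.comp_apply, LinearMap.mulLeft_apply] at hx hy ⊢
          simp only [map_add, add_mul, hx, hy, TensorProduct.tmul_add]
        | tmul y z => simp [F, l0, l1, l2, l3, l4, qLE, mul_assoc]
    have := LinearMap.congr_fun (key D.phi) D.phiInv
    have c3 : LinearMap.mul' k H (TensorProduct.map (LinearMap.mulRight k D.β)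
      (evalAlpha D.S D.α) D.phi) = 1 := D.zigzag_Phi
    rw [LinearMap.comp_apply, LinearMap.comp_apply, LinearMap.comp_apply, c3] at this
    simp only [LinearMap.mulLeft_apply, ← Algebra.TensorProduct.one_def, one_mul] at this
    exact this
  rw [← hX]
  have hF4 : ∀ T q, F (T * two l3 l4 q) = F T * q := by
    intro T q
    induction q using TensorProduct.induction_on with
    | zero => simp
    | add x y hx hy => rw [map_add, mul_add, map_add, hx, hy, mul_add]
    | tmul x y =>
      have : F ∘ₗ LinearMap.mulRight k (two l3 l4 (x ⊗ₜ y)) =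
          LinearMap.mulRight k (x ⊗ₜ y) ∘ₗ F := by
        ext a b c d e
        simp [F, l3, l4, mul_assoc]
      exact LinearMap.congr_fun this T
  have hF0 : ∀ x T, F (l0 x * T) = 1 ⊗ₜ x * F T := by
    intro x T
    have : F ∘ₗ LinearMap.mulLeft k (l0 x) = LinearMap.mulLeft k (1 ⊗ₜ x) ∘ₗ F := by
      ext a b c d e
      simp [F, l0, mul_assoc]
    exact LinearMap.congr_fun this T
  have hFg : ∀ (t : H ⊗[k] (H ⊗[k] (H ⊗[k] H))) (p : H ⊗[k] H) (φ : H ⊗[k] (H ⊗[k] H)),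
      F (two l1 (two l2 (two l3 l4)) t * two l1 l2 p * two l0 (two l1 l2) φ) =
        D.pLE φ * D.SS (flip p) * D.gammaE (two (legA k H) (two (legB k H)
          (two (legC k H) (legD k H))) t) := by
    intro t p φ
    induction p using TensorProduct.induction_on with
    | zero => simp
    | add x y hx hy => simp only [map_add, mul_add, add_mul, hx, hy]
    | tmul x y =>
      have h2 : ∀ φ, F ∘ₗ LinearMap.mulRight k (two l1 l2 (x ⊗ₜ y) * two l0 (two l1 l2) φ) ∘ₗ
          two l1 (two l2 (two l3 l4)) =
          LinearMap.mulLeft k (D.pLE φ * D.SS (flip (x ⊗ₜ y))) ∘ₗ D.gammaE ∘ₗ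
            two (legA k H) (two (legB k H) (two (legC k H) (legD k H))) := by
        intro φ
        ext a b c d
        induction φ using TensorProduct.induction_on with
        | zero => simp
        | add x y hx hy =>
          simp only [TensorProduct.AlgebraTensorModule.curry_apply, TensorProduct.curry_apply,
            LinearMap.coe_restrictScalars, LinearMap.comp_apply, LinearMap.mulRight_apply,
            LinearMap.mulLeft_apply] at hx hy ⊢
          simp only [map_add, add_mul, mul_add, hx, hy]
        | tmul u φ =>
          induction φ using TensorProduct.induction_on with
          | zero => simp
          | add x y hx hy =>
            simp only [TensorProduct.AlgebraTensorModule.curry_apply, TensorProduct.curry_apply,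
              LinearMap.coe_restrictScalars, LinearMap.comp_apply, LinearMap.mulRight_apply,
              LinearMap.mulLeft_apply] at hx hy ⊢
            simp only [map_add, add_mul, mul_add, hx, hy, TensorProduct.tmul_add]
          | tmul v w => simp [F, l0, l1, l2, l3, l4, pLE, D.S_mul, mul_assoc]
      have := LinearMap.congr_fun (h2 φ) t
      rw [mul_assoc]
      exact this
  -- The second evaluation: `theta` gives `γ`, the last `Φ` gives `p_L`, and the middle one,
  -- generalised to `s`, supplies `X`, `Y`, `Z`. The element `U` appears because `(S ⊗ S)(Δᵒᵖ(Y)) γ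
  -- = f Δ(S(Y) α)`.
  have hA : ∀ s : H ⊗[k] (H ⊗[k] H), F (D.theta l1 l2 l3 l4 *
      two l0 (two (D.cop l1 l2) (D.cop l3 l4)) s * D.Ph l0 l1 l2) = D.qLU s := by
    intro s
    induction s using TensorProduct.induction_on with
    | zero => simp
    | add x y hx hy => simp only [map_add, mul_add, add_mul, hx, hy]
    | tmul x s =>
      induction s using TensorProduct.induction_on with
      | zero => simp
      | add x y hx hy => simp only [map_add, mul_add, add_mul, hx, hy, TensorProduct.tmul_add]
      | tmul y z =>
        have c1 : D.theta l1 l2 l3 l4 * l0 x = l0 x * D.theta l1 l2 l3 l4 := by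
          rw [← four_theta₀]
          exact leg_comm (two l1 (two l2 (two l3 l4))) l0 _ _
        have c2 : D.cop l3 l4 z * D.Ph l0 l1 l2 = D.Ph l0 l1 l2 * D.cop l3 l4 z :=
          (leg_comm (two l0 (two l1 l2)) (D.cop l3 l4) _ _).symm
        rw [two_tmul, two_tmul]
        have : D.theta l1 l2 l3 l4 * (l0 x * (D.cop l1 l2 y * D.cop l3 l4 z)) * D.Ph l0 l1 l2 =
            l0 x * (D.theta l1 l2 l3 l4 * D.cop l1 l2 y * D.Ph l0 l1 l2 * D.cop l3 l4 z) := by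
          simp only [mul_assoc]
          rw [c2, ← mul_assoc, c1]
          simp only [mul_assoc]
        rw [this, hF0, cop_apply _ l3 l4, hF4, cop_apply]
        have h3 := hFg D.theta₀ (D.comul y) D.phi
        rw [four_theta₀, four_theta₀, ← gamma_eq] at h3
        have h4 := h3.trans (mul_assoc _ _ _)
        rw [SS_comul_mul_gamma, ← SS_flip_pL, ← mul_assoc (D.SS _)] at h4
        refine (congrArg (fun w => 1 ⊗ₜ x * (w * D.comul z)) h4).trans ?_
        rw [qLU_tmul, U, map_mul _ _ z]
        simp only [mul_assoc]
  exact (hA D.phi).symm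

end QuasiHopf
end
end Hennings

/-! ### The element `U` expressed through `q_L` -/

namespace Hennings

noncomputable section

namespace QuasiHopf
open QuasiBialgebra
variable {k H : Type*} [Field k] [Ring H] [Algebra k H] (D : QuasiHopf k H)

/-- `X ⊗ Y ⊗ Z ↦ (S(X) ⊗ 1) q_L Δ(Y β S(Z))` -/
def UqL : H ⊗[k] (H ⊗[k] H) →ₗ[k] H ⊗[k] H :=
  two (LinearMap.mulRight k D.qL ∘ₗ D.antiLeg (jl k H H))
    (D.comul.toLinearMap ∘ₗ evalBeta D.S D.β)

@[simp] theorem UqL_tmul (x y z : H) : D.UqL (x ⊗ₜ (y ⊗ₜ z)) =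
    D.S x ⊗ₜ 1 * D.qL * D.comul (y * D.β * D.S z) := by
  simp [UqL]

/-- `U = (S(X) ⊗ 1) q_L Δ(Y β S(Z))` for `Φ⁻¹ = X ⊗ Y ⊗ Z` -/
theorem UqL_phiInv : D.UqL D.phiInv = D.U := by
  -- Four strands: `O` places the zigzag `zz` of the last three behind `U`. Here it is `theta` that
  -- is evaluated in two ways.
  set zz : H ⊗[k] (H ⊗[k] H) →ₗ[k] H :=
    two (D.alphaLeg LinearMap.id) (two (D.betaLeg LinearMap.id) (D.antiLeg LinearMap.id)) with hzz
  set O : H ⊗[k] (H ⊗[k] (H ⊗[k] H)) →ₗ[k] H ⊗[k] H :=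
    two (LinearMap.mulRight k D.U ∘ₗ jr H LinearMap.id) (D.comul.toLinearMap ∘ₗ zz) with hO
  set m1 := jl k H (H ⊗[k] (H ⊗[k] H))
  set m2 := jr H (jl k H (H ⊗[k] H))
  set m3 := jr H (jr H (jl k H H))
  set m4 : H →ₗ[k] H ⊗[k] (H ⊗[k] (H ⊗[k] H)) := jr H (jr H (jr H LinearMap.id))
  have hsh : ∀ a b, O (a ⊗ₜ b) = (LinearMap.mulLeft k (1 ⊗ₜ a * D.U) ∘ₗ D.comul.toLinearMap)
    (zz b) := fun a b => by simp [O, mul_assoc]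
  have hL : EqL O (D.cop m2 m3) (D.eps _) := by
    have := ((D.invL_of (f := D.alphaLeg LinearMap.id) (g := D.betaLeg LinearMap.id)
      (LinearMap.mulRight k D.β) (fun x y => by simp [mul_assoc])).head
        (D.antiLeg LinearMap.id)).shift (E := O) _ hsh
    rwa [jr_eps, ← jr_cop] at this
  have hR : EqR O (D.cop m3 m4) (D.eps _) := by
    have := ((D.invR_beta (LinearMap.id : H →ₗ[k] H)).tail.shift_cop
      (f := D.alphaLeg LinearMap.id)).shift (E := O) _ hsh
    rwa [jr_eps, ← jr_cop] at this
  have hB : O (D.theta m1 m2 m3 m4) = D.U := by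
    -- The outer two associators meet a joined pair and vanish; the zigzag of `Φ⁻¹` is `1`.
    rw [theta_eq, hL.PhI_mid m1 m4, hR.Ph_right m1 m2]
    have : O ∘ₗ two m2 (two m3 m4) = LinearMap.mulLeft k D.U ∘ₗ D.comul.toLinearMap ∘ₗ
        LinearMap.mul' k H ∘ₗ
          TensorProduct.map (LinearMap.mulRight k D.α ∘ₗ D.S.toLinearMap) (evalBeta D.S D.β) := by
      ext a b c
      simp [m2, m3, m4, O, zz, ← Algebra.TensorProduct.one_def]
    have e := LinearMap.congr_fun this D.phiInv
    have c3 : LinearMap.mul' k H (TensorProduct.map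
      (LinearMap.mulRight k D.α ∘ₗ D.S.toLinearMap) (evalBeta D.S D.β) D.phiInv) = 1 :=
      D.zigzag_Phi_inv
    simp only [LinearMap.comp_apply, c3] at e
    refine Eq.trans e ?_
    simp
  rw [← hB, theta]
  -- In the unrearranged form of `theta`, the first factor of `Φ⁻¹` (generalised to `s`) passes `U`
  -- by `UJ_comul`, and `Φ` assembles to `q_L` by `qLU_phi`.
  have key : ∀ s : H ⊗[k] (H ⊗[k] H), D.UqL s = O (D.Ph m1 m2 m3 * two (D.cop m1 m2) (two m3 m4) s) := by
    intro s
    induction s using TensorProduct.induction_on with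
    | zero => simp
    | add x y hx hy => simp only [map_add, mul_add, hx, hy]
    | tmul x s =>
      induction s using TensorProduct.induction_on with
      | zero => simp
      | add x y hx hy => simp only [map_add, mul_add, hx, hy, TensorProduct.tmul_add]
      | tmul y z =>
        have h1 : ∀ a b c p, O (two m1 (two m2 m3) (a ⊗ₜ (b ⊗ₜ c)) *
            (two m1 m2 p * (m3 y * m4 z))) =
            1 ⊗ₜ a * D.UJ p * D.comul (D.S b * D.α * c * (y * D.β * D.S z)) := by
          intro a b c p
          induction p using TensorProduct.induction_on with
          | zero => simp
          | add u v hu hv => simp only [map_add, add_mul, mul_add, hu, hv]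
          | tmul u v =>
            simp only [UJ_tmul, two_tmul, m1, m2, m3, m4, O, zz, jl_apply, jr_apply,
              Algebra.TensorProduct.tmul_mul_tmul, mul_one, one_mul, LinearMap.id_apply,
              LinearMap.comp_apply, LinearMap.mulRight_apply, AlgHom.toLinearMap_apply,
              alphaLeg_apply, betaLeg_apply, antiLeg_apply, D.S_mul]
            rw [← mul_assoc (1 ⊗ₜ a), ← mul_assoc (1 ⊗ₜ a), Algebra.TensorProduct.tmul_mul_tmul,
              one_mul, mul_assoc (_ * D.U) (D.comul (D.S v)), ← map_mul D.comul]
            simp only [mul_assoc]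
        have h2 : ∀ t, D.S x ⊗ₜ 1 * D.qLU t * D.comul (y * D.β * D.S z) =
            O (two m1 (two m2 m3) t * (two m1 m2 (D.comul x) * (m3 y * m4 z))) := by
          intro t
          induction t using TensorProduct.induction_on with
          | zero => simp
          | add u v hu hv => simp only [map_add, add_mul, mul_add, hu, hv]
          | tmul a t =>
            induction t using TensorProduct.induction_on with
            | zero => simp
            | add u v hu hv =>
              simp only [map_add, add_mul, mul_add, hu, hv, TensorProduct.tmul_add]
            | tmul b c =>
              rw [h1, UJ_comul, qLU_tmul, map_mul D.comul (_ * c)]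
              have : D.S x ⊗ₜ[k] (1 : H) * (1 : H) ⊗ₜ[k] a = 1 ⊗ₜ a * D.S x ⊗ₜ 1 := by simp
              simp only [← mul_assoc, this]
        rw [UqL_tmul, ← qLU_phi, h2, two_tmul, two_tmul, Ph, cop_apply]
        rfl
  exact key D.phiInv

end QuasiHopf
end
end Hennings

/-! ### The cointegral as a twisted trace, and its slices -/

namespace Hennings

noncomputable section

namespace QuasiHopf
open QuasiBialgebra
variable {k H : Type*} [Field k] [Ring H] [Algebra k H] (D : QuasiHopf k H)

/-- Apply `ε` to `S(h') α h'' = ε(h) α` and use `ε(α) = 1`. -/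
theorem counit_S (hα : D.counit D.α = 1) (h : H) : D.counit (D.S h) = D.counit h := by
  have e := congrArg D.counit (D.antipode_left h)
  have : D.counit.toLinearMap ∘ₗ evalAlpha D.S D.α =
      D.counit.toLinearMap ∘ₗ D.S.toLinearMap ∘ₗ (TensorProduct.rid k H).toLinearMap ∘ₗ
        TensorProduct.map LinearMap.id D.counit.toLinearMap := by
    ext x y
    simp [hα, mul_comm]
  have e2 := LinearMap.congr_fun this (D.comul h)
  have e3 := D.counit_right h
  have e4 : (TensorProduct.rid k H) (TensorProduct.map LinearMap.id D.counit.toLinearMap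
    (D.comul h)) = h := e3
  simp only [LinearMap.comp_apply, LinearEquiv.coe_coe, AlgHom.toLinearMap_apply, e4] at e2
  rw [← e2, e, map_smul, hα, smul_eq_mul, mul_one]

theorem counit_S_symm (hα : D.counit D.α = 1) (h : H) :
    D.counit (D.S.symm h) = D.counit h := by
  rw [← D.counit_S hα, S_S_symm]

/-- The element `(S⁻¹ ⊗ S⁻¹)((q_L f⁻¹)₂₁)`. -/
def V : H ⊗[k] H := D.SSinv (flip (D.qL * Ring.inverse D.f))

theorem V_eq : D.V = D.SSinv (flip (Ring.inverse D.f)) * D.SSinv (flip D.qL) := by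
  rw [V, flip_mul, SSinv_mul]

theorem comul_mul_inverse_f (hf : IsUnit D.f) (h : H) : D.comul h * Ring.inverse D.f =
    Ring.inverse D.f * D.SS (flip (D.comul (D.S.symm h))) := by
  have e := D.f_comul_S (D.S.symm h)
  rw [S_S_symm] at e
  have := congrArg (fun x => Ring.inverse D.f * x * Ring.inverse D.f) e
  simp only [mul_assoc, Ring.mul_inverse_cancel _ hf, mul_one] at this
  rw [this, ← mul_assoc, Ring.inverse_mul_cancel _ hf, one_mul]

theorem SSinv_flip_qLJ (hf : IsUnit D.f) (x y : H) :
    D.SSinv (flip (D.S x ⊗ₜ 1 * D.qL * D.comul y * Ring.inverse D.f)) =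
      D.comul (D.S.symm y) * D.V * 1 ⊗ₜ x := by
  rw [mul_assoc _ (D.comul y), comul_mul_inverse_f D hf, ← mul_assoc, mul_assoc (_ ⊗ₜ _),
    flip_mul, flip_mul, SSinv_mul, SSinv_mul, SSinv_flip_SS_flip, V]
  simp [S_symm_one, mul_assoc]

/-- `x ⊗ y ↦ Δ(S⁻¹(y)) V (1 ⊗ x)` -/
def VJ : H ⊗[k] H →ₗ[k] H ⊗[k] H :=
  D.SSinv ∘ₗ flip ∘ₗ LinearMap.mulRight k (Ring.inverse D.f) ∘ₗ D.qLJ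

theorem VJ_tmul (hf : IsUnit D.f) (x y : H) : D.VJ (x ⊗ₜ y) =
    D.comul (D.S.symm y) * D.V * 1 ⊗ₜ x := by
  simp only [VJ, LinearMap.comp_apply, qLJ_tmul, LinearMap.mulRight_apply]
  exact D.SSinv_flip_qLJ hf x y

/-- This is `qLJ_comul`, multiplied by `f⁻¹` and transported by the flip and `S⁻¹ ⊗ S⁻¹`. On the
right of a coproduct `V` has the role that `U` has on the left. -/
theorem VJ_comul (h : H) : D.VJ (D.comul h) = D.V * D.S.symm h ⊗ₜ 1 := by
  simp only [VJ, LinearMap.comp_apply, qLJ_comul, LinearMap.mulRight_apply]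
  rw [mul_assoc, flip_mul, SSinv_mul, V]
  simp [S_symm_one]

/-- `X ⊗ Y ⊗ Z ↦ Δ(S⁻¹(Y β S(Z))) V (1 ⊗ X)` -/
def pLV : H ⊗[k] (H ⊗[k] H) →ₗ[k] H ⊗[k] H :=
  D.SSinv ∘ₗ flip ∘ₗ LinearMap.mulRight k (Ring.inverse D.f) ∘ₗ D.UqL

theorem pLV_tmul (hf : IsUnit D.f) (x y z : H) : D.pLV (x ⊗ₜ (y ⊗ₜ z)) =
    D.comul (z * D.S.symm (y * D.β)) * D.V * 1 ⊗ₜ x := by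
  simp only [pLV, LinearMap.comp_apply, UqL_tmul, LinearMap.mulRight_apply]
  rw [D.SSinv_flip_qLJ hf, S_symm_mul, S_symm_S]

/-- `p_L = Δ(S⁻¹(Y β S(Z))) V (1 ⊗ X)` for `Φ⁻¹ = X ⊗ Y ⊗ Z` -/
theorem pLV_phiInv (hf : IsUnit D.f) : D.pLV D.phiInv = D.pL := by
  simp only [pLV, LinearMap.comp_apply, UqL_phiInv, LinearMap.mulRight_apply]
  rw [U, mul_assoc, Ring.mul_inverse_cancel _ hf, mul_one, SSinv_flip_SS_flip]

end QuasiHopf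

namespace NormalizedUnimodular
open QuasiBialgebra QuasiHopf
variable {k H : Type*} [Field k] [Ring H] [Algebra k H] (D : NormalizedUnimodular k H)

/-- `Ring.inverse` of a non-unit is `0`. The cointegral equation would then give `λ(Λ) 1 = 0`,
against `λ(Λ) = 1`. -/
theorem isUnit_f : IsUnit D.f := by
  by_contra hf
  obtain ⟨Λ, -, hΛ⟩ := D.coint_integral
  have e := D.coint_isRightCointegral Λ
  rw [Ring.inverse_non_unit _ hf, map_zero, map_zero, mul_zero, zero_mul, map_zero, hΛ,
    one_smul] at e
  have h0 : Λ = 0 := by rw [← one_mul Λ, ← e, zero_mul]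
  rw [h0, map_zero] at hΛ
  exact zero_ne_one hΛ

theorem slice_coint (h : H) : slice D.coint (D.U * D.comul h * D.V) = D.coint h • (1 : H) := by
  have := D.coint_isRightCointegral h
  rwa [mul_assoc (_ * D.comul h), ← V_eq] at this

/-- The right cointegral is a twisted trace. -/
theorem coint_S_mul [Module.Finite k H] (h z : H) :
    D.coint (D.S h * z) = D.coint (z * D.S.symm h) := by
  obtain ⟨Λ, hl, hΛ⟩ := D.coint_integral
  have hr := D.unimodular Λ hl
  -- `T` is a copairing for `λ`: beads pass between its factors on the left because `Λ` is a left
  -- integral, and on the right because it is also a right integral.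
  set T := D.U * D.comul Λ * D.V with hT
  have hT1 : slice D.coint T = 1 := by rw [hT, slice_coint, hΛ, one_smul]
  have hleft : ∀ h, D.S h ⊗ₜ 1 * T = 1 ⊗ₜ h * T := by
    intro h
    have e : ∀ t, D.UJ t * D.comul Λ * D.V =
        1 ⊗ₜ (TensorProduct.rid k H (TensorProduct.map LinearMap.id D.counit.toLinearMap t)) *
          T := by
      intro t
      induction t using TensorProduct.induction_on with
      | zero => simp
      | add x y hx hy => simp only [map_add, add_mul, TensorProduct.tmul_add, hx, hy]
      | tmul x y =>
        rw [UJ_tmul, mul_assoc _ (D.comul (D.S y)), ← map_mul, hl, D.counit_S D.counit_α, hT]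
        simp [mul_assoc, TensorProduct.tmul_smul]
    have e1 := e (D.comul h)
    rw [UJ_comul] at e1
    have e2 : (TensorProduct.rid k H) (TensorProduct.map LinearMap.id D.counit.toLinearMap
      (D.comul h)) = h := D.counit_right h
    rw [e2] at e1
    rw [← e1, hT]
    simp only [mul_assoc]
  have hright : T * D.S.symm h ⊗ₜ 1 = T * 1 ⊗ₜ h := by
    have e : ∀ t, D.U * D.comul Λ * D.VJ t =
        T * 1 ⊗ₜ (TensorProduct.rid k H (TensorProduct.map LinearMap.id D.counit.toLinearMap t)) := by
      intro t
      induction t using TensorProduct.induction_on with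
      | zero => simp
      | add x y hx hy => simp only [map_add, mul_add, TensorProduct.tmul_add, hx, hy]
      | tmul x y =>
        rw [D.VJ_tmul D.isUnit_f, ← mul_assoc, ← mul_assoc, mul_assoc D.U, ← map_mul, hr,
          D.counit_S_symm D.counit_α, hT]
        simp [TensorProduct.tmul_smul]
    have e1 := e (D.comul h)
    rw [VJ_comul] at e1
    have e2 : (TensorProduct.rid k H) (TensorProduct.map LinearMap.id D.counit.toLinearMap
      (D.comul h)) = h := D.counit_right h
    rw [e2] at e1
    rw [← e1, hT]
    simp only [mul_assoc]
  have hs : ∀ h, slice (D.coint ∘ₗ LinearMap.mulLeft k (D.S h)) T = h := by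
    intro h
    rw [← slice_mulLeft, hleft, slice_one_tmul_mul, hT1, mul_one]
  have hs' : slice (D.coint ∘ₗ LinearMap.mulRight k (D.S.symm h)) T = h := by
    rw [← slice_mulRight, hright, slice_mul_one_tmul, hT1, one_mul]
  -- The functionals `λ(S(h) ·)` already realise every element of `H` as a slice of `T`, so slicing
  -- `T` is injective.
  have := slice_injective T (fun h => ⟨_, hs h⟩) ((hs h).trans hs'.symm)
  exact LinearMap.congr_fun this z

theorem coint_S_S [Module.Finite k H] (z : H) : D.coint (D.S (D.S z)) = D.coint z := by
  have := D.coint_S_mul (D.S z) 1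
  rwa [mul_one, one_mul, S_symm_S] at this

/-- `λ(q_L¹ h' p_L¹) q_L² h'' p_L² = λ(α h S⁻¹(β)) 1` for central `h` -/
theorem slice_qL_comul_pL [Module.Finite k H] (h : H) (hh : ∀ x, h * x = x * h) :
    slice D.coint (D.qL * D.comul h * D.pL) = D.coint (D.α * h * D.S.symm D.β) • (1 : H) := by
  -- `Z` records that the slice depends only on the product of the two coassociators standing around
  -- `U` and `V`, and this product is `Φ Φ⁻¹ = 1`.
  let Z : H ⊗[k] (H ⊗[k] H) →ₗ[k] H :=
    (TensorProduct.rid k H).toLinearMap ∘ₗ TensorProduct.map LinearMap.id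
      (D.coint ∘ₗ LinearMap.mulLeft k (D.α * h) ∘ₗ LinearMap.mul' k H ∘ₗ
        QuasiHopf.flip ∘ₗ TensorProduct.map (D.S.symm.toLinearMap ∘ₗ LinearMap.mulRight k D.β)
          LinearMap.id)
  have hZ : ∀ x y z, Z (x ⊗ₜ (y ⊗ₜ z)) =
      D.coint (D.α * h * (z * D.S.symm (y * D.β))) • x := by
    intro x y z
    simp [Z, mul_assoc]
  have key : ∀ s t, slice D.coint (D.qLU s * D.comul h * D.pLV t) = Z (s * t) := by
    intro s t
    induction s using TensorProduct.induction_on with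
    | zero => simp
    | add u v hu hv => simp only [map_add, add_mul, hu, hv]
    | tmul x s =>
    induction s using TensorProduct.induction_on with
    | zero => simp
    | add u v hu hv => simp only [map_add, add_mul, hu, hv, TensorProduct.tmul_add]
    | tmul y z =>
    induction t using TensorProduct.induction_on with
    | zero => simp
    | add u v hu hv => simp only [map_add, mul_add, hu, hv]
    | tmul p t =>
    induction t using TensorProduct.induction_on with
    | zero => simp
    | add u v hu hv => simp only [map_add, mul_add, hu, hv, TensorProduct.tmul_add]
    | tmul q r =>
      rw [qLU_tmul, D.pLV_tmul D.isUnit_f]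
      have : ∀ a b c, (1 : H) ⊗ₜ[k] x * D.U * D.comul a * D.comul b *
          (D.comul c * D.V * 1 ⊗ₜ p) =
          1 ⊗ₜ x * (D.U * D.comul (a * b * c) * D.V * 1 ⊗ₜ p) := by
        intro a b c
        simp only [map_mul, mul_assoc]
      rw [this, slice_one_tmul_mul, slice_mul_one_tmul, slice_coint,
        Algebra.TensorProduct.tmul_mul_tmul, Algebra.TensorProduct.tmul_mul_tmul, hZ]
      -- The twisted trace carries `S(y)` to the far right as `S⁻¹(y)`, next to `S⁻¹(q β)`;
      -- centrality of `h` brings `z` next to `r`.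
      have : D.coint (D.S y * D.α * z * h * (r * D.S.symm (q * D.β))) =
          D.coint (D.α * h * (z * r * D.S.symm (y * q * D.β))) := by
        rw [mul_assoc (D.S y), mul_assoc (D.S y), mul_assoc (D.S y), D.coint_S_mul]
        congr 1
        simp only [S_symm_mul, mul_assoc]
        rw [← mul_assoc z h, ← hh z]
        simp only [mul_assoc]
      rw [this]
      simp
  have := key D.phi D.phiInv
  rw [qLU_phi, D.pLV_phiInv D.isUnit_f] at this
  have h1 : D.phi * D.phiInv = 1 := D.Phi.mul_inv
  rw [this, h1, Algebra.TensorProduct.one_def, Algebra.TensorProduct.one_def, hZ, one_mul, one_mul]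

/-- `M` is `Δ(v⁻¹)` up to the central factor `v ⊗ v`. One `v` cancels `v⁻¹ ⊗ 1`, the other leaves
the slice as a factor. -/
theorem slice_vInv_mul_M [Module.Finite k H] :
    slice D.coint ((D.vInv ⊗ₜ[k] (1 : H)) * (D.qL * D.M * D.pL)) =
      D.coint (D.α * D.vInv * D.S.symm D.β) • (D.v : H) := by
  have e : (D.vInv ⊗ₜ[k] (1 : H)) * (D.qL * D.M * D.pL) =
      1 ⊗ₜ (D.v : H) * (D.qL * D.comul D.vInv * D.pL) := by
    have h1 : (1 : H) ⊗ₜ[k] (D.v : H) = D.vInv ⊗ₜ 1 * (D.v : H) ⊗ₜ (D.v : H) := by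
      rw [Algebra.TensorProduct.tmul_mul_tmul, one_mul, D.vInv_mul_v]
    rw [D.comul_vInv D.isUnit_α D.isUnit_f, h1, mul_assoc (D.vInv ⊗ₜ 1)]
    congr 1
    rw [← mul_assoc D.qL, ← D.tmul_vInv_central, mul_assoc (_ ⊗ₜ _), mul_assoc (_ ⊗ₜ _),
      ← mul_assoc (_ ⊗ₜ _) (_ ⊗ₜ _), Algebra.TensorProduct.tmul_mul_tmul, D.v_mul_vInv,
      ← Algebra.TensorProduct.one_def, one_mul]
  rw [e, slice_one_tmul_mul, D.slice_qL_comul_pL _ D.vInv_central, mul_smul_comm, mul_one]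

theorem slice_v_mul_Minv [Module.Finite k H] :
    slice D.coint (((D.v : H) ⊗ₜ[k] (1 : H)) * (D.qL * D.Minv * D.pL)) =
      D.coint (D.α * (D.v : H) * D.S.symm D.β) • D.vInv := by
  have e : ((D.v : H) ⊗ₜ[k] (1 : H)) * (D.qL * D.Minv * D.pL) =
      1 ⊗ₜ D.vInv * (D.qL * D.comul D.v * D.pL) := by
    have h1 : (1 : H) ⊗ₜ[k] D.vInv = (D.v : H) ⊗ₜ 1 * D.vInv ⊗ₜ D.vInv := by
      rw [Algebra.TensorProduct.tmul_mul_tmul, one_mul, D.v_mul_vInv]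
    rw [D.comul_v D.isUnit_α D.isUnit_f, h1, mul_assoc ((D.v : H) ⊗ₜ 1)]
    congr 1
    rw [← mul_assoc D.qL, ← D.tmul_v_central, mul_assoc (_ ⊗ₜ _), mul_assoc (_ ⊗ₜ _),
      ← mul_assoc (_ ⊗ₜ _) (_ ⊗ₜ _), Algebra.TensorProduct.tmul_mul_tmul, D.vInv_mul_v,
      ← Algebra.TensorProduct.one_def, one_mul]
  rw [e, slice_one_tmul_mul, D.slice_qL_comul_pL _ D.v_central, mul_smul_comm, mul_one]

end NormalizedUnimodular
end
end Hennings

namespace Hennings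

noncomputable section

/-! ### Flat diagrams with beads -/

namespace Beaded
variable {k H : Type*} [Field k] [Ring H] [Algebra k H] {P Q R : Type}

@[simp] theorem bead_σ (S : H ≃ₗ[k] H) (p : P) (x : H) (s : Beaded H P) :
    (s.bead S p x).σ = s.σ := rfl

@[simp] theorem bead_lab_self (S : H ≃ₗ[k] H) (p : P) (x : H) (s : Beaded H P) :
    (s.bead S p x).lab p = x * s.lab p := if_pos rfl

@[simp] theorem bead_lab_partner (S : H ≃ₗ[k] H) (p : P) (x : H) (s : Beaded H P) :
    (s.bead S p x).lab (s.σ p) = s.lab (s.σ p) * S x :=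
  (if_neg (s.ne p)).trans (if_pos rfl)

theorem bead_lab_of_ne (S : H ≃ₗ[k] H) {p q : P} (x : H) (s : Beaded H P) (h : q ≠ p)
    (h' : q ≠ s.σ p) : (s.bead S p x).lab q = s.lab q :=
  (if_neg h).trans (if_neg h')

/-- Placing a bead changes the labels at the two ends of one arc only, so an equality with a beaded
diagram reduces to these cases. -/
theorem bead_ext (S : H ≃ₗ[k] H) (p : P) (x : H) (s t : Beaded H P) (hσ : t.σ = s.σ)
    (h0 : t.lab p = x * s.lab p) (h1 : t.lab (s.σ p) = s.lab (s.σ p) * S x)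
    (h2 : ∀ q, q ≠ p → q ≠ s.σ p → t.lab q = s.lab q) : t = s.bead S p x := by
  ext q
  · rw [hσ]; rfl
  · by_cases a : q = p
    · subst a; rw [h0, bead_lab_self]
    · by_cases b : q = s.σ p
      · subst b; rw [h1, bead_lab_partner]
      · rw [h2 q a b, bead_lab_of_ne S x s a b]

theorem bead_one (D : QuasiHopf k H) (p : P) (s : Beaded H P) : s.bead D.S p 1 = s := by
  refine (bead_ext D.S p 1 s s rfl ?_ ?_ fun _ _ _ => rfl).symm
  · rw [one_mul]
  · rw [D.S_one, mul_one]

theorem bead_mul (D : QuasiHopf k H) (p : P) (x y : H) (s : Beaded H P) :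
    s.bead D.S p (x * y) = (s.bead D.S p y).bead D.S p x := by
  refine (bead_ext D.S p (x * y) s ((s.bead D.S p y).bead D.S p x) rfl ?_ ?_ ?_).symm
  · simp [mul_assoc]
  · have := bead_lab_partner D.S p x (s.bead D.S p y)
    rw [bead_σ] at this
    rw [this, bead_lab_partner, D.S_mul, mul_assoc]
  · intro q h h'
    rw [bead_lab_of_ne D.S x (s.bead D.S p y) h h', bead_lab_of_ne D.S y s h h']

/-- This includes the two ends of one arc: at each end one bead multiplies from the left, and the
other, arriving over the maximum, from the right. -/
theorem bead_comm (S : H ≃ₗ[k] H) {p q : P} (hpq : p ≠ q) (x y : H) (s : Beaded H P) :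
    (s.bead S p x).bead S q y = (s.bead S q y).bead S p x := by
  by_cases h : q = s.σ p
  · subst h
    have hi := s.invol p
    refine bead_ext S p x (s.bead S (s.σ p) y) _ rfl ?_ ?_ ?_
    · have h1 := bead_lab_partner S (s.σ p) y (s.bead S p x)
      have h2 := bead_lab_partner S (s.σ p) y s
      rw [bead_σ, hi] at h1
      rw [hi] at h2
      rw [h1, h2, bead_lab_self, mul_assoc]
    · rw [bead_σ, bead_lab_self, bead_lab_partner, bead_lab_self, mul_assoc]
    · intro q h h'
      rw [bead_σ] at h'
      have h3 : q ≠ s.σ (s.σ p) := by rwa [hi]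
      rw [bead_lab_of_ne S y (s.bead S p x) h' h3, bead_lab_of_ne S x s h h',
        bead_lab_of_ne S y s h' h3]
  · have h4 : p ≠ s.σ q := fun e => h (by rw [e, s.invol])
    have h5 : s.σ p ≠ s.σ q := fun e => hpq (by rw [← s.invol p, e, s.invol])
    refine bead_ext S p x (s.bead S q y) _ rfl ?_ ?_ ?_
    · rw [bead_lab_of_ne S y (s.bead S p x) hpq h4, bead_lab_self, bead_lab_of_ne S y s hpq h4]
    · rw [bead_σ, bead_lab_of_ne S y (s.bead S p x) (Ne.symm h) h5, bead_lab_partner,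
        bead_lab_of_ne S y s (Ne.symm h) h5]
    · intro r h h'
      rw [bead_σ] at h'
      have h7 := bead_lab_of_ne S x s h h'
      by_cases a : r = q
      · subst a
        rw [bead_lab_self, h7, bead_lab_self]
      · by_cases b : r = s.σ q
        · subst b
          have h6 := bead_lab_partner S q y (s.bead S p x)
          rw [bead_σ] at h6
          rw [h6, bead_lab_partner, h7]
        · rw [bead_lab_of_ne S y (s.bead S p x) a b, bead_lab_of_ne S y s a b, h7]

theorem relabel_bead (S : H ≃ₗ[k] H) (e : P ≃ Q) (p : P) (x : H) (s : Beaded H P) :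
    (s.bead S p x).relabel e = (s.relabel e).bead S (e p) x := by
  refine bead_ext S (e p) x _ _ rfl ?_ ?_ ?_
  · simp [relabel]
  · simp [relabel, Matching.relabel]
  · intro q h h'
    simp only [relabel, Matching.relabel, Equiv.symm_apply_apply] at h'
    simp only [relabel]
    exact bead_lab_of_ne _ _ _ (fun e' => h (by rw [← e', Equiv.apply_symm_apply]))
      (fun e' => h' (by rw [← e', Equiv.apply_symm_apply]))

theorem relabel_relabel (e : P ≃ Q) (e' : Q ≃ R) (s : Beaded H P) :
    (s.relabel e).relabel e' = s.relabel (e.trans e') := by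
  ext r
  · simp [relabel, Matching.relabel]
  · simp [relabel]

theorem relabel_refl (s : Beaded H P) : s.relabel (Equiv.refl P) = s := by
  ext r <;> rfl

theorem cap_bead (S : H ≃ₗ[k] H) (Ginv : H) (q : Q) (x : H) (s : Beaded H Q) :
    (s.bead S q x).cap Ginv = (s.cap Ginv).bead S (.inr q) x := by
  refine bead_ext S _ x _ _ rfl (bead_lab_self S q x s) (bead_lab_partner S q x s) ?_
  rintro ((_ | _) | r) h h'
  · rfl
  · rfl
  · exact bead_lab_of_ne _ _ _ (fun e => h (by rw [e])) (fun e => h' (by rw [e]; rfl))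

theorem cap_relabel (Ginv : H) (e : Q ≃ R) (s : Beaded H Q) :
    (s.relabel e).cap Ginv = (s.cap Ginv).relabel (Equiv.sumCongr (Equiv.refl _) e) := by
  ext r
  · rcases r with (_ | _) | r <;> rfl
  · rcases r with (_ | _) | r <;> rfl

/-- The label at the right leg already contains `G⁻¹`; there the two sides agree because of `hG`. -/
theorem cap_slide (S : H ≃ₗ[k] H) (Ginv x : H) (hG : x * Ginv = Ginv * S (S x))
    (s : Beaded H Q) :
    (s.cap Ginv).bead S (.inl (.inl ())) (S x) = (s.cap Ginv).bead S (.inl (.inr ())) x := by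
  ext r
  · rfl
  · rcases r with (_ | _) | r <;> simp [bead, cap, Matching.cap, hG]

theorem cup_cap (S : H ≃ₗ[k] H) (G Ginv x : H) (s : Beaded H Q) :
    ((s.cap Ginv).bead S (.inl (.inr ())) x).cup G = s := by
  ext r
  · rfl
  · simp [bead, cap, cup, Matching.cap]

theorem cupScalar_cap (S : H ≃ₗ[k] H) (l : H →ₗ[k] k) (Ginv x : H) (s : Beaded H Q) :
    ((s.cap Ginv).bead S (.inl (.inr ())) x).cupScalar S l = l (S (S x)) := by
  simp [bead, cap, cupScalar, Matching.cap]

/-- If the minimum merges two arcs, `S²` arises as the bead passes the factor `G` of the merged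
label. The closing of a component affects only `cupScalar`. -/
theorem cup_slide (S : H ≃ₗ[k] H) (G x : H) (hG : G * x = S (S x) * G)
    (s : Beaded H ((Unit ⊕ Unit) ⊕ Q)) :
    (s.bead S (.inl (.inl ())) x).cup G = (s.bead S (.inl (.inr ())) (S x)).cup G := by
  have pa := bead_lab_partner S (.inl (.inl ())) x s
  have pb := bead_lab_partner S (.inl (.inr ())) (S x) s
  have sa := bead_lab_self S (.inl (.inl ())) x s
  ext r
  · rfl
  · have hi := s.invol (.inr r)
    rcases h : s.σ (.inr r) with (⟨⟨⟩⟩ | ⟨⟨⟩⟩) | r'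
    · rw [h] at hi
      rw [hi] at pa
      have h1 : (s.bead S (.inl (.inr ())) (S x)).lab (.inr r) = s.lab (.inr r) :=
        bead_lab_of_ne _ _ _ (by simp) (by intro e; rw [e, s.invol] at h; simp at h)
      have h2 : (s.bead S (.inl (.inl ())) x).lab (.inl (.inr ())) = s.lab (.inl (.inr ())) :=
        bead_lab_of_ne _ _ _ (by simp) (by rw [hi]; simp)
      simp [cup, h, h1, h2, pa, mul_assoc]
    · rw [h] at hi
      rw [hi] at pb
      have h1 : (s.bead S (.inl (.inl ())) x).lab (.inr r) = s.lab (.inr r) :=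
        bead_lab_of_ne _ _ _ (by simp) (by intro e; rw [e, s.invol] at h; simp at h)
      have h2 : (s.bead S (.inl (.inr ())) (S x)).lab (.inl (.inl ())) = s.lab (.inl (.inl ())) :=
        bead_lab_of_ne _ _ _ (by simp) (by rw [hi]; simp)
      simp only [cup, bead_σ, h, h1, h2, pb, sa]
      rw [mul_assoc _ G, ← mul_assoc G, hG]
      simp only [mul_assoc]
    · have h1 : (s.bead S (.inl (.inl ())) x).lab (.inr r) = s.lab (.inr r) :=
        bead_lab_of_ne _ _ _ (by simp) (by intro e; rw [e, s.invol] at h; simp at h)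
      have h2 : (s.bead S (.inl (.inr ())) (S x)).lab (.inr r) = s.lab (.inr r) :=
        bead_lab_of_ne _ _ _ (by simp) (by intro e; rw [e, s.invol] at h; simp at h)
      simp [cup, h, h1, h2]

theorem cupScalar_slide (S : H ≃ₗ[k] H) (l : H →ₗ[k] k) (x : H)
    (hl : ∀ z, l (S (x * z)) = l (S (z * S (S x))))
    (s : Beaded H ((Unit ⊕ Unit) ⊕ Q)) :
    (s.bead S (.inl (.inl ())) x).cupScalar S l =
      (s.bead S (.inl (.inr ())) (S x)).cupScalar S l := by
  have sa := bead_lab_self S (.inl (.inl ())) x s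
  have pb := bead_lab_partner S (.inl (.inr ())) (S x) s
  by_cases h : s.σ (.inl (.inl ())) = .inl (.inr ())
  · have hi := s.invol (.inl (.inl ()))
    rw [h] at hi
    rw [hi] at pb
    simp only [cupScalar, bead_σ, h, if_true, sa, pb, hl]
  · simp [cupScalar, h]

/-- A strand joined to the left leg of a maximum on its left by a minimum. -/
def kinkEquiv (Q : Type) : (Unit ⊕ Unit) ⊕ (Unit ⊕ Q) ≃ (Unit ⊕ Unit) ⊕ (Unit ⊕ Q) where
  toFun
    | .inl (.inl _) => .inl (.inl ())
    | .inl (.inr _) => .inr (.inl ())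
    | .inr (.inl _) => .inl (.inr ())
    | .inr (.inr q) => .inr (.inr q)
  invFun
    | .inl (.inl _) => .inl (.inl ())
    | .inl (.inr _) => .inr (.inl ())
    | .inr (.inl _) => .inl (.inr ())
    | .inr (.inr q) => .inr (.inr q)
  left_inv := by rintro ((_ | _) | (_ | _)) <;> rfl
  right_inv := by rintro ((_ | _) | (_ | _)) <;> rfl

/-- The new free end is the right leg of the maximum, with label `G⁻¹`. At the far end the merging
rule contributes `G`, as a bead `G⁻¹` does because `S(G⁻¹) = G`. -/
theorem cup_kink (S : H ≃ₗ[k] H) (G Ginv : H) (hS : S Ginv = G) (s : Beaded H (Unit ⊕ Q)) :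
    ((s.cap Ginv).relabel (kinkEquiv Q)).cup G = s.bead S (.inl ()) Ginv := by
  have hi := s.invol (.inl ())
  have hp := bead_lab_partner S (.inl ()) Ginv s
  rcases h : s.σ (.inl ()) with ⟨⟨⟩⟩ | q
  · exact absurd h (s.ne _)
  rw [h] at hi hp
  refine bead_ext S _ _ _ _ ?_ ?_ ?_ ?_
  · funext r
    rcases r with ⟨⟨⟩⟩ | r
    · simp [cup, cap, relabel, Matching.cup, Matching.cupFun, Matching.cap, Matching.relabel,
        kinkEquiv, h]
    · have hr := s.invol (.inr r)
      rcases h' : s.σ (.inr r) with ⟨⟨⟩⟩ | r'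
      · simp [cup, cap, relabel, Matching.cup, Matching.cupFun, Matching.cap, Matching.relabel,
          kinkEquiv, h']
      · simp [cup, cap, relabel, Matching.cup, Matching.cupFun, Matching.cap, Matching.relabel,
          kinkEquiv, h']
  · simp [cup, cap, relabel, Matching.cap, Matching.relabel, kinkEquiv]
  · rw [h]
    simp [cup, cap, relabel, Matching.cap, Matching.relabel, kinkEquiv, hi, hS]
  · rintro (⟨⟨⟩⟩ | r) hr hr'
    · exact absurd rfl hr
    · rcases h' : s.σ (.inr r) with ⟨⟨⟩⟩ | r'
      · exact absurd (by rw [← h', s.invol]) hr'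
      · simp [cup, cap, relabel, Matching.cap, Matching.relabel, kinkEquiv, h']

theorem cupScalar_kink (S : H ≃ₗ[k] H) (l : H →ₗ[k] k) (Ginv : H) (s : Beaded H (Unit ⊕ Q)) :
    ((s.cap Ginv).relabel (kinkEquiv Q)).cupScalar S l = 1 := by
  simp [cupScalar, cap, relabel, Matching.cap, Matching.relabel, kinkEquiv]

end Beaded

end
end Hennings

/-! ### Operators on formal sums of diagrams, and beads on bundles -/

namespace Hennings

noncomputable section

namespace Skein
variable {k H : Type*} [Field k] [Ring H] [Algebra k H] {P Q R : Type}

@[simp] theorem relabel_of (e : P ≃ Q) (s : Beaded H P) :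
    relabel e (of k s) = of k (s.relabel e) := by
  simp [relabel]

@[simp] theorem bead_of (S : H ≃ₗ[k] H) (p : P) (x : H) (s : Beaded H P) :
    bead S p x (of k s) = of k (s.bead S p x) := by
  simp [bead]

@[simp] theorem cap_of (Ginv : H) (s : Beaded H Q) : cap Ginv (of k s) = of k (s.cap Ginv) := by
  simp [cap]

@[simp] theorem cup_of (S : H ≃ₗ[k] H) (l : H →ₗ[k] k) (G : H)
    (s : Beaded H ((Unit ⊕ Unit) ⊕ Q)) :
    cup S l G (of k s) = s.cupScalar S l • of k (s.cup G) := by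
  simp [cup]

theorem ind {V : Type*} [AddCommGroup V] [Module k V] {f g : Skein k H P →ₗ[k] V}
    (h : ∀ s, f (of k s) = g (of k s)) (x : Skein k H P) : f x = g x :=
  LinearMap.congr_fun (hom_ext h) x

instance (D : QuasiHopf k H) (p : P) : IsLeg (bead (k := k) D.S p) where
  map_one' := hom_ext fun s => by simp [Beaded.bead_one]
  map_mul' x y := hom_ext fun s => by simp [Beaded.bead_mul]

theorem relabel_relabel (e : P ≃ Q) (e' : Q ≃ R) (x : Skein k H P) :
    relabel e' (relabel e x) = relabel (e.trans e') x :=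
  ind (f := relabel e' ∘ₗ relabel e) (fun s => by simp [Beaded.relabel_relabel]) x

theorem relabel_eq_self (e : P ≃ P) (he : ∀ p, e p = p) (x : Skein k H P) : relabel e x = x := by
  obtain rfl : e = Equiv.refl P := Equiv.ext he
  exact ind (g := LinearMap.id) (fun s => by simp [Beaded.relabel_refl]) x

theorem relabel_congr {e e' : P ≃ Q} (he : ∀ p, e p = e' p) (x : Skein k H P) :
    relabel e x = relabel e' x := by
  rw [Equiv.ext he]

theorem relabel_bead (S : H ≃ₗ[k] H) (e : P ≃ Q) (p : P) (h : H) (x : Skein k H P) :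
    relabel e (bead S p h x) = bead S (e p) h (relabel e x) :=
  ind (f := relabel e ∘ₗ bead S p h) (g := bead S (e p) h ∘ₗ relabel e)
    (fun s => by simp [Beaded.relabel_bead]) x

theorem cap_bead (S : H ≃ₗ[k] H) (Ginv : H) (q : Q) (h : H) (x : Skein k H Q) :
    cap Ginv (bead S q h x) = bead S (.inr q) h (cap Ginv x) :=
  ind (f := cap Ginv ∘ₗ bead S q h)
    (g := LinearMap.comp (bead S (Sum.inr q : (Unit ⊕ Unit) ⊕ Q) h) (cap Ginv))
    (fun s => by simp [Beaded.cap_bead]) x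

theorem cap_relabel (Ginv : H) (e : Q ≃ R) (x : Skein k H Q) :
    cap Ginv (relabel e x) = relabel (Equiv.sumCongr (Equiv.refl _) e) (cap Ginv x) :=
  ind (f := cap Ginv ∘ₗ relabel e) (g := relabel (Equiv.sumCongr (Equiv.refl _) e) ∘ₗ cap Ginv)
    (fun s => by simp [Beaded.cap_relabel]) x

/-- Transport of operators along a bijection of the end points. -/
def push {M : Type*} [AddCommMonoid M] [Module k M] (e : P ≃ Q)
    (f : M →ₗ[k] Module.End k (Skein k H P)) : M →ₗ[k] Module.End k (Skein k H Q) where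
  toFun m := relabel e ∘ₗ f m ∘ₗ relabel e.symm
  map_add' x y := by ext; simp
  map_smul' a x := by ext; simp

section
variable {M N : Type*} [AddCommMonoid M] [Module k M] [AddCommMonoid N] [Module k N] (e : P ≃ Q)

theorem relabel_apply (f : M →ₗ[k] Module.End k (Skein k H P)) (m : M) (x : Skein k H P) :
    relabel e (f m x) = push e f m (relabel e x) := by
  change _ = relabel e (f m (relabel e.symm (relabel e x)))
  rw [relabel_relabel, relabel_eq_self _ (by simp)]

theorem push_two (f : M →ₗ[k] Module.End k (Skein k H P))
    (g : N →ₗ[k] Module.End k (Skein k H P)) : push e (two f g) = two (push e f) (push e g) := by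
  refine TensorProduct.ext' fun x y => LinearMap.ext fun z => ?_
  simp only [two_tmul, Module.End.mul_apply]
  change relabel e (two f g (x ⊗ₜ y) _) = relabel e (f x _)
  rw [two_tmul, Module.End.mul_apply]
  congr 2
  change _ = relabel e.symm (relabel e _)
  rw [relabel_relabel, relabel_eq_self _ (by simp)]
  rfl

theorem push_bead (S : H ≃ₗ[k] H) (p : P) : push e (bead S p) = bead S (e p) := by
  refine LinearMap.ext fun h => LinearMap.ext fun x => ?_
  change relabel e (bead S p h _) = _
  rw [relabel_bead, relabel_relabel, relabel_eq_self _ (by simp)]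

theorem relabel_two (f : M →ₗ[k] Module.End k (Skein k H P))
    (g : N →ₗ[k] Module.End k (Skein k H P)) (t : M ⊗[k] N) (x : Skein k H P) :
    relabel e (two f g t x) = two (push e f) (push e g) t (relabel e x) := by
  rw [relabel_apply, push_two]

variable (D : QuasitriangularQuasiHopf k H)

theorem push_cop (f g : H →ₗ[k] Module.End k (Skein k H P)) :
    push e (D.cop f g) = D.cop (push e f) (push e g) := by
  refine LinearMap.ext fun h => ?_
  exact LinearMap.congr_fun (push_two e f g) (D.comul h)

theorem relabel_Ph (f g h : H →ₗ[k] Module.End k (Skein k H P)) (x : Skein k H P) :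
    relabel e (D.Ph f g h x) = D.Ph (push e f) (push e g) (push e h) (relabel e x) := by
  rw [QuasiBialgebra.Ph, relabel_two, push_two]; rfl

theorem relabel_PhI (f g h : H →ₗ[k] Module.End k (Skein k H P)) (x : Skein k H P) :
    relabel e (D.PhI f g h x) = D.PhI (push e f) (push e g) (push e h) (relabel e x) := by
  rw [QuasiBialgebra.PhI, relabel_two, push_two]; rfl

theorem relabel_Br (s : Bool) (f g : H →ₗ[k] Module.End k (Skein k H P)) (x : Skein k H P) :
    relabel e (D.Br s f g x) = D.Br s (push e f) (push e g) (relabel e x) := by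
  rw [QuasitriangularQuasiHopf.Br, relabel_two]; rfl

end

end Skein

/-- The map `ι` is injective. -/
class Inj {P Q : Type} (ι : P → Q) : Prop where
  inj' : Function.Injective ι

/-- The maps `ι` and `κ` have disjoint images. -/
class Disj {P P' Q : Type} (ι : P → Q) (κ : P' → Q) : Prop where
  disj' : ∀ p q, ι p ≠ κ q

section
variable {P P' Q R : Type}

instance (ι : P → Q) [Inj ι] : Inj (fun p => (Sum.inl (ι p) : Q ⊕ R)) :=
  ⟨fun _ _ h => Inj.inj' (Sum.inl_injective h)⟩

instance (ι : P → Q) [Inj ι] : Inj (fun p => (Sum.inr (ι p) : R ⊕ Q)) :=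
  ⟨fun _ _ h => Inj.inj' (Sum.inr_injective h)⟩

instance : Inj (Sum.inl : P → P ⊕ R) := ⟨Sum.inl_injective⟩

instance : Inj (Sum.inr : P → R ⊕ P) := ⟨Sum.inr_injective⟩

instance : Disj (Sum.inl : P → P ⊕ Q) Sum.inr := ⟨fun _ _ => by simp⟩

instance (ι : P → R) : Disj (fun p => (Sum.inr (ι p) : Q ⊕ R)) Sum.inl := ⟨fun _ _ => by simp⟩

instance (ι : P → R) (κ : P' → Q) : Disj (fun p => (Sum.inl (ι p) : R ⊕ Q))
    (fun p => Sum.inr (κ p)) := ⟨fun _ _ => by simp⟩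

instance (ι : P → R) (κ : P' → Q) : Disj (fun p => (Sum.inr (κ p) : R ⊕ Q))
    (fun p => Sum.inl (ι p)) := ⟨fun _ _ => by simp⟩

instance (ι : P → Q) (κ : P' → Q) [Disj ι κ] : Disj (fun p => (Sum.inl (ι p) : Q ⊕ R))
    (fun p => Sum.inl (κ p)) := ⟨fun p q h => Disj.disj' p q (Sum.inl_injective h)⟩

instance (ι : P → Q) (κ : P' → Q) [Disj ι κ] : Disj (fun p => (Sum.inr (ι p) : R ⊕ Q))
    (fun p => Sum.inr (κ p)) := ⟨fun p q h => Disj.disj' p q (Sum.inr_injective h)⟩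

end

namespace NormalizedUnimodular
open QuasiBialgebra QuasiHopf QuasitriangularQuasiHopf
variable {k H : Type*} [Field k] [Ring H] [Algebra k H] (D : NormalizedUnimodular k H)
  {P Q R : Type}

theorem commuting_bead_bead (p q : P) (h : p ≠ q) :
    Commuting (Skein.bead (k := k) D.S p) (Skein.bead D.S q) :=
  ⟨fun x y => Skein.hom_ext fun s => by simp [Beaded.bead_comm D.S h.symm y x s]⟩

/-- With `bundle_pt` and `bundle_tensor`, this builds the beads on bundles from single beads by
`eps` and `cop`, so they are legs and the calculus of `Ph` and `Br` applies to them. -/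
theorem bundle_unit (ι : Pts .unit → P) : D.bundle .unit ι = D.eps _ := by
  refine LinearMap.ext fun h => ?_
  rw [eps_apply, Algebra.algebraMap_eq_smul_one]
  rfl

theorem bundle_pt (ι : Pts .pt → P) : D.bundle .pt ι = Skein.bead D.S (ι ()) := rfl

theorem bundle_tensor (A B : Brac) (ι : Pts (.tensor A B) → P) : D.bundle (.tensor A B) ι =
    D.cop (D.bundle A fun p => ι (.inl p)) (D.bundle B fun p => ι (.inr p)) := rfl

theorem commuting_bundle_bead (A : Brac) (ι : Pts A → P) (q : P) (h : ∀ p, ι p ≠ q) :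
    Commuting (D.bundle A ι) (Skein.bead D.S q) := by
  induction A with
  | unit => rw [bundle_unit]; infer_instance
  | pt => exact D.commuting_bead_bead _ _ (h ())
  | tensor A B hA hB =>
    rw [bundle_tensor]
    have := hA (fun p => ι (.inl p)) fun p => h (.inl p)
    have := hB (fun p => ι (.inr p)) fun p => h (.inr p)
    infer_instance

theorem commuting_bundle_bundle (A B : Brac) (ι : Pts A → P) (κ : Pts B → P)
    (h : ∀ p q, ι p ≠ κ q) : Commuting (D.bundle A ι) (D.bundle B κ) := by
  induction A with
  | unit => rw [bundle_unit]; infer_instance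
  | pt =>
    have := D.commuting_bundle_bead B κ (ι ()) fun p => (h () p).symm
    rw [bundle_pt]
    infer_instance
  | tensor A A' hA hA' =>
    rw [bundle_tensor]
    have := hA (fun p => ι (.inl p)) fun p => h (.inl p)
    have := hA' (fun p => ι (.inr p)) fun p => h (.inr p)
    infer_instance

theorem isLeg_bundle (A : Brac) (ι : Pts A → P) (h : Function.Injective ι) :
    IsLeg (D.bundle A ι) := by
  induction A with
  | unit => rw [bundle_unit]; infer_instance
  | pt => rw [bundle_pt]; infer_instance
  | tensor A B hA hB =>
    have := hA (fun p => ι (.inl p)) fun p q e => Sum.inl_injective (h e)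
    have := hB (fun p => ι (.inr p)) fun p q e => Sum.inr_injective (h e)
    have := D.commuting_bundle_bundle A B (fun p => ι (.inl p)) (fun p => ι (.inr p))
      fun p q e => by simpa using h e
    rw [bundle_tensor]
    infer_instance

instance (A : Brac) (ι : Pts A → P) [Inj ι] : IsLeg (D.bundle A ι) :=
  D.isLeg_bundle A ι Inj.inj'

instance (A B : Brac) (ι : Pts A → P) (κ : Pts B → P) [Disj ι κ] :
    Commuting (D.bundle A ι) (D.bundle B κ) := D.commuting_bundle_bundle A B ι κ Disj.disj'

instance (A : Brac) (ι : Pts A → P) (q : P) [h : Disj ι (fun _ : Unit => q)] :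
    Commuting (D.bundle A ι) (Skein.bead D.S q) :=
  D.commuting_bundle_bead A ι q fun p => h.disj' p ()

instance (p q : P) [h : Disj (fun _ : Unit => p) (fun _ : Unit => q)] :
    Commuting (Skein.bead (k := k) D.S p) (Skein.bead D.S q) :=
  D.commuting_bead_bead p q (h.disj' () ())

theorem push_bundle (e : P ≃ Q) (A : Brac) (ι : Pts A → P) :
    Skein.push e (D.bundle A ι) = D.bundle A fun p => e (ι p) := by
  induction A with
  | unit =>
    refine LinearMap.ext fun h => LinearMap.ext fun x => ?_
    change Skein.relabel e (D.counit h • Skein.relabel e.symm x) = D.counit h • x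
    rw [map_smul, Skein.relabel_relabel, Skein.relabel_eq_self _ (by simp)]
  | pt => exact Skein.push_bead e D.S (ι ())
  | tensor A B hA hB => rw [bundle_tensor, Skein.push_cop, hA, hB]; rfl

theorem relabel_bundle (e : P ≃ Q) (A : Brac) (ι : Pts A → P) (h : H) (x : Skein k H P) :
    Skein.relabel e (D.bundle A ι h x) = D.bundle A (fun p => e (ι p)) h (Skein.relabel e x) := by
  rw [Skein.relabel_apply, push_bundle]

theorem cap_bundle (A : Brac) (ι : Pts A → Q) (h : H) (x : Skein k H Q) :
    Skein.cap D.Ginv (D.bundle A ι h x) =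
      D.bundle A (fun p => .inr (ι p)) h (Skein.cap D.Ginv x) := by
  induction A generalizing h x with
  | unit =>
    change Skein.cap D.Ginv (D.counit h • x) = D.counit h • Skein.cap D.Ginv x
    rw [map_smul]
  | pt => exact Skein.cap_bead D.S D.Ginv (ι ()) h x
  | tensor A B hA hB =>
    rw [bundle_tensor, bundle_tensor, cop_apply, cop_apply]
    induction D.comul h using TensorProduct.induction_on with
    | zero => simp
    | add s t hs ht => simp only [map_add, LinearMap.add_apply, hs, ht]
    | tmul y z => rw [two_tmul, two_tmul, Module.End.mul_apply, Module.End.mul_apply, hA, hB]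

theorem cap_slide (h : H) (x : Skein k H Q) :
    Skein.bead D.S (.inl (.inl ())) (D.S h) (Skein.cap D.Ginv x) =
      Skein.bead D.S (.inl (.inr ())) h (Skein.cap D.Ginv x) :=
  Skein.ind
    (f := LinearMap.comp (Skein.bead D.S (Sum.inl (Sum.inl ()) : (Unit ⊕ Unit) ⊕ Q) (D.S h))
      (Skein.cap D.Ginv))
    (g := LinearMap.comp (Skein.bead D.S (Sum.inl (Sum.inr ()) : (Unit ⊕ Unit) ⊕ Q) h)
      (Skein.cap D.Ginv))
    (fun s => by simp [Beaded.cap_slide D.S D.Ginv h (D.mul_Ginv h)]) x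

theorem cap_slide_symm (h : H) (x : Skein k H Q) :
    Skein.bead D.S (.inl (.inl ())) h (Skein.cap D.Ginv x) =
      Skein.bead D.S (.inl (.inr ())) (D.S.symm h) (Skein.cap D.Ginv x) := by
  rw [← cap_slide, S_S_symm]

/-- Two arcs that merge require `G h = S²(h) G`, a component that closes the twisted trace property
of `λ`. -/
theorem cup_slide [Module.Finite k H] (h : H) (x : Skein k H ((Unit ⊕ Unit) ⊕ Q)) :
    Skein.cup D.S D.coint D.G (Skein.bead D.S (.inl (.inl ())) h x) =
      Skein.cup D.S D.coint D.G (Skein.bead D.S (.inl (.inr ())) (D.S h) x) := by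
  refine Skein.ind (f := Skein.cup D.S D.coint D.G ∘ₗ Skein.bead D.S (.inl (.inl ())) h)
    (g := Skein.cup D.S D.coint D.G ∘ₗ Skein.bead D.S (.inl (.inr ())) (D.S h)) (fun s => ?_) x
  have hl : ∀ z, D.coint (D.S (h * z)) = D.coint (D.S (z * D.S (D.S h))) := fun z => by
    rw [D.S_mul, D.S_mul, D.coint_S_mul (D.S (D.S h)), S_symm_S]
  simp only [LinearMap.comp_apply, Skein.bead_of, Skein.cup_of]
  rw [Beaded.cup_slide D.S D.G h (D.G_mul h), Beaded.cupScalar_slide D.S D.coint h hl]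

theorem cup_cap [Module.Finite k H] (h : H) (x : Skein k H Q) :
    Skein.cup D.S D.coint D.G (Skein.bead D.S (.inl (.inr ())) h (Skein.cap D.Ginv x)) =
      D.coint h • x := by
  refine Skein.ind (f := Skein.cup D.S D.coint D.G ∘ₗ
    LinearMap.comp (Skein.bead D.S (Sum.inl (Sum.inr ()) : (Unit ⊕ Unit) ⊕ Q) h)
      (Skein.cap D.Ginv)) (g := D.coint h • LinearMap.id) (fun s => ?_) x
  simp [Beaded.cup_cap, Beaded.cupScalar_cap, coint_S_S]

theorem cup_kink (x : Skein k H (Unit ⊕ Q)) :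
    Skein.cup D.S D.coint D.G (Skein.relabel (Beaded.kinkEquiv Q) (Skein.cap D.Ginv x)) =
      Skein.bead D.S (.inl ()) D.Ginv x := by
  refine Skein.ind (f := Skein.cup D.S D.coint D.G ∘ₗ Skein.relabel (Beaded.kinkEquiv Q) ∘ₗ
    Skein.cap D.Ginv) (g := Skein.bead D.S (Sum.inl () : Unit ⊕ Q) D.Ginv) (fun s => ?_) x
  simp [Beaded.cup_kink _ _ _ D.S_Ginv, Beaded.cupScalar_kink]

end NormalizedUnimodular

end
end Hennings

namespace Hennings

noncomputable section

/-! ### Evaluation of composite diagrams -/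

namespace NormalizedUnimodular
open QuasiBialgebra QuasiHopf QuasitriangularQuasiHopf
variable {k H : Type*} [Field k] [Ring H] [Algebra k H] (D : NormalizedUnimodular k H)

section
variable {P P' Q : Type}

theorem exchange_inl (p : P) : exchange P P' Q (.inl p) = .inr (.inl p) := rfl

theorem exchange_inr_inl (p : P') : exchange P P' Q (.inr (.inl p)) = .inl p := rfl

theorem exchange_inr_inr (q : Q) : exchange P P' Q (.inr (.inr q)) = .inr (.inr q) := rfl

end

theorem run_comp {A B C : Brac} (T : Tangle A B) (U : Tangle B C) (Q : Type)
    (x : Skein k H (Pts A ⊕ Q)) : D.run (T.comp U) Q x = D.run U Q (D.run T Q x) := rfl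

theorem run_id (A : Brac) (Q : Type) (x : Skein k H (Pts A ⊕ Q)) :
    D.run (.id A) Q x = x := rfl

theorem run_tensor {A B A' B' : Brac} (T : Tangle A B) (U : Tangle A' B') (Q : Type)
    (x : Skein k H ((Pts A ⊕ Pts A') ⊕ Q)) : D.run (T.tensor U) Q x =
      Skein.relabel (Equiv.sumAssoc (Pts B) (Pts B') Q).symm
        (Skein.relabel (exchange (Pts B') (Pts B) Q) (D.run U (Pts B ⊕ Q)
          (Skein.relabel (exchange (Pts B) (Pts A') Q) (D.run T (Pts A' ⊕ Q)
            (Skein.relabel (Equiv.sumAssoc (Pts A) (Pts A') Q) x))))) := rfl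

theorem run_tensor_id {A B : Brac} (T : Tangle A B) (C : Brac) (Q : Type)
    (x : Skein k H ((Pts A ⊕ Pts C) ⊕ Q)) : D.run (T.tensor (.id C)) Q x =
      Skein.relabel (Equiv.sumAssoc (Pts B) (Pts C) Q).symm (D.run T (Pts C ⊕ Q)
        (Skein.relabel (Equiv.sumAssoc (Pts A) (Pts C) Q) x)) := by
  rw [run_tensor, run_id, Skein.relabel_relabel _ (exchange (Pts C) (Pts B) Q), Skein.relabel_eq_self]
  rintro (_ | _ | _) <;> rfl

theorem run_id_tensor {A B : Brac} (C : Brac) (T : Tangle A B) (Q : Type)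
    (x : Skein k H ((Pts C ⊕ Pts A) ⊕ Q)) : D.run ((Tangle.id C).tensor T) Q x =
      Skein.relabel ((exchange (Pts B) (Pts C) Q).trans (Equiv.sumAssoc (Pts C) (Pts B) Q).symm)
        (D.run T (Pts C ⊕ Q) (Skein.relabel
          ((Equiv.sumAssoc (Pts C) (Pts A) Q).trans (exchange (Pts C) (Pts A) Q)) x)) := by
  rw [run_tensor, run_id, Skein.relabel_relabel, Skein.relabel_relabel]

theorem run_assoc (A B C : Brac) (Q : Type) (x : Skein k H (((Pts A ⊕ Pts B) ⊕ Pts C) ⊕ Q)) :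
    D.run (.assoc A B C) Q x =
      D.Ph (D.bundle A fun p => .inl (.inl p)) (D.bundle B fun p => .inl (.inr (.inl p)))
        (D.bundle C fun p => .inl (.inr (.inr p)))
        (Skein.relabel (Equiv.sumCongr (Equiv.sumAssoc (Pts A) (Pts B) (Pts C)) (Equiv.refl Q))
          x) := rfl

theorem run_assocInv (A B C : Brac) (Q : Type) (x : Skein k H ((Pts A ⊕ (Pts B ⊕ Pts C)) ⊕ Q)) :
    D.run (.assocInv A B C) Q x =
      Skein.relabel (Equiv.sumCongr (Equiv.sumAssoc (Pts A) (Pts B) (Pts C)).symm (Equiv.refl Q))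
      (D.PhI (D.bundle A fun p => .inl (.inl p)) (D.bundle B fun p => .inl (.inr (.inl p)))
        (D.bundle C fun p => .inl (.inr (.inr p))) x) := rfl

theorem run_lunit (A : Brac) (Q : Type) (x : Skein k H ((Empty ⊕ Pts A) ⊕ Q)) :
    D.run (.lunit A) Q x =
      Skein.relabel (Equiv.sumCongr (Equiv.emptySum Empty (Pts A)) (Equiv.refl Q)) x := rfl

theorem run_lunitInv (A : Brac) (Q : Type) (x : Skein k H (Pts A ⊕ Q)) :
    D.run (.lunitInv A) Q x =
      Skein.relabel (Equiv.sumCongr (Equiv.emptySum Empty (Pts A)).symm (Equiv.refl Q)) x := rfl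

theorem run_runit (A : Brac) (Q : Type) (x : Skein k H ((Pts A ⊕ Empty) ⊕ Q)) :
    D.run (.runit A) Q x =
      Skein.relabel (Equiv.sumCongr (Equiv.sumEmpty (Pts A) Empty) (Equiv.refl Q)) x := rfl

theorem run_runitInv (A : Brac) (Q : Type) (x : Skein k H (Pts A ⊕ Q)) :
    D.run (.runitInv A) Q x =
      Skein.relabel (Equiv.sumCongr (Equiv.sumEmpty (Pts A) Empty).symm (Equiv.refl Q)) x := rfl

theorem run_cap (Q : Type) (x : Skein k H (Empty ⊕ Q)) : D.run .cap Q x =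
    Skein.bead D.S (.inl (.inl ())) D.β
      (Skein.cap D.Ginv (Skein.relabel (Equiv.emptySum Empty Q) x)) := rfl

theorem run_cup (Q : Type) (x : Skein k H ((Unit ⊕ Unit) ⊕ Q)) : D.run .cup Q x =
    Skein.relabel (Equiv.emptySum Empty Q).symm (Skein.cup D.S D.coint D.G
      (Skein.bead D.S (.inl (.inr ())) D.α x)) := rfl

/-- The beads of `c⁻¹` lie below the flat crossing. Carried above it they exchange strands, which is
the flip in `R₂₁⁻¹`. -/
theorem run_cross (s : Bool) (Q : Type) (x : Skein k H ((Unit ⊕ Unit) ⊕ Q)) :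
    D.run (.cross s) Q x = Skein.relabel (swapPts Q)
      (D.Br s (Skein.bead D.S (.inl (.inl ()))) (Skein.bead D.S (.inl (.inr ()))) x) := by
  cases s
  · have : Commuting (Skein.bead (k := k) D.S (.inl (.inl ()) : (Unit ⊕ Unit) ⊕ Q))
        (Skein.bead D.S (.inl (.inr ()))) := D.commuting_bead_bead _ _ (by simp)
    rw [Skein.relabel_Br, Skein.push_bead, Skein.push_bead]
    exact (LinearMap.congr_fun (D.Br_false _ _) _).symm
  · rfl

/-- The inductive step is a hexagon, whose associators are the changes of brackets in the diagram;
the empty bundle is the braiding with a counit. -/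
theorem run_crossBundle (s : Bool) (A : Brac) (Q : Type)
    (x : Skein k H ((Unit ⊕ Pts A) ⊕ Q)) : D.run (Tangle.crossBundle s A) Q x =
      Skein.relabel (Equiv.sumCongr (Equiv.sumComm Unit (Pts A)) (Equiv.refl Q))
        (D.Br s (Skein.bead D.S (.inl (.inl ()))) (D.bundle A fun p => .inl (.inr p)) x) := by
  induction A generalizing Q with
  | unit =>
    rw [bundle_unit, Br_eps_right, Tangle.crossBundle, run_comp, run_runit, run_lunitInv,
      Skein.relabel_relabel]
    refine Skein.relabel_congr ?_ x
    rintro ((_ | _) | _) <;> first | rfl | contradiction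
  | pt => exact D.run_cross s Q x
  | tensor A B hA hB =>
    rw [bundle_tensor, Tangle.crossBundle]
    -- All relabellings are moved innermost, renaming the legs they pass. What remains is the
    -- hexagon and an identity of bijections.
    simp -index only [run_comp, run_assocInv, run_tensor_id, hA, run_assoc, run_id_tensor, hB,
      Skein.relabel_Br, Skein.relabel_Ph, Skein.relabel_PhI, push_bundle, Skein.push_bead,
      bundle_pt, Skein.relabel_relabel, Skein.push_cop, Equiv.sumCongr_apply, Sum.map_inl,
      Sum.map_inr, Equiv.sumComm_apply, Sum.swap_inl, Sum.swap_inr, Equiv.sumAssoc_apply_inl_inl,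
      Equiv.sumAssoc_apply_inl_inr, Equiv.sumAssoc_apply_inr, Equiv.sumAssoc_symm_apply_inl,
      Equiv.sumAssoc_symm_apply_inr_inl, Equiv.sumAssoc_symm_apply_inr_inr, Equiv.refl_apply,
      Equiv.trans_apply, exchange_inl, exchange_inr_inl, exchange_inr_inr]
    have key : ∀ (a : H →ₗ[k] Module.End k (Skein k H (((Pts A ⊕ Pts B) ⊕ Unit) ⊕ Q))) (b f)
        [IsLeg a] [IsLeg b] [IsLeg f] [Commuting f a] [Commuting f b] [Commuting a b] (y),
        D.PhI a b f (D.Br s f b (D.Ph a f b (D.Br s f a (D.PhI f a b y)))) =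
          D.Br s f (D.cop a b) y := by
      intro a b f _ _ _ _ _ _ y
      rw [Br_hexagon_right]
      rfl
    refine (key (D.bundle A fun p => .inl (.inl (.inl p)))
      (D.bundle B fun p => .inl (.inl (.inr p))) (Skein.bead D.S (.inl (.inr ()))) _).trans ?_
    congr 1
    refine Skein.relabel_congr ?_ x
    rintro ((_ | _ | _) | _) <;> rfl

theorem run_crossBundles (s : Bool) (A B : Brac) (Q : Type)
    (x : Skein k H ((Pts A ⊕ Pts B) ⊕ Q)) : D.run (Tangle.crossBundles s A B) Q x =
      Skein.relabel (Equiv.sumCongr (Equiv.sumComm (Pts A) (Pts B)) (Equiv.refl Q))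
        (D.Br s (D.bundle A fun p => .inl (.inl p)) (D.bundle B fun p => .inl (.inr p)) x) := by
  induction A generalizing Q with
  | unit =>
    have : IsLeg (D.bundle B fun p => (.inl (.inr p) : (Pts .unit ⊕ Pts B) ⊕ Q)) :=
      D.isLeg_bundle B _ fun _ _ e => Sum.inr_injective (Sum.inl_injective e)
    rw [bundle_unit, Br_eps_left, Tangle.crossBundles, run_comp, run_lunit, run_runitInv,
      Skein.relabel_relabel]
    refine Skein.relabel_congr ?_ x
    rintro ((_ | _) | _) <;> first | rfl | contradiction
  | pt => exact D.run_crossBundle s B Q x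
  | tensor A A' hA hA' =>
    rw [bundle_tensor, Tangle.crossBundles]
    simp -index only [run_comp, run_assocInv, run_tensor_id, hA, run_assoc, run_id_tensor, hA',
      Skein.relabel_Br, Skein.relabel_Ph, Skein.relabel_PhI, push_bundle, Skein.push_bead,
      bundle_pt, Skein.relabel_relabel, Skein.push_cop, Equiv.sumCongr_apply, Sum.map_inl,
      Sum.map_inr, Equiv.sumComm_apply, Sum.swap_inl, Sum.swap_inr, Equiv.sumAssoc_apply_inl_inl,
      Equiv.sumAssoc_apply_inl_inr, Equiv.sumAssoc_apply_inr, Equiv.sumAssoc_symm_apply_inl,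
      Equiv.sumAssoc_symm_apply_inr_inl, Equiv.sumAssoc_symm_apply_inr_inr, Equiv.refl_apply,
      Equiv.trans_apply, exchange_inl, exchange_inr_inl, exchange_inr_inr]
    have key : ∀ (b : H →ₗ[k] Module.End k (Skein k H ((Pts B ⊕ (Pts A ⊕ Pts A')) ⊕ Q))) (a a')
        [IsLeg a] [IsLeg a'] [IsLeg b] [Commuting a a'] [Commuting a b] [Commuting a' b] (y),
        D.Ph b a a' (D.Br s a b (D.PhI a b a' (D.Br s a' b (D.Ph a a' b y)))) =
          D.Br s (D.cop a a') b y := by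
      intro b a a' _ _ _ _ _ _ y
      rw [Br_hexagon_left]
      rfl
    refine (key (D.bundle B fun p => .inl (.inl p)) (D.bundle A fun p => .inl (.inr (.inl p)))
      (D.bundle A' fun p => .inl (.inr (.inr p))) _).trans ?_
    congr 1
    refine Skein.relabel_congr ?_ x
    rintro (((_ | _) | _) | _) <;> rfl

end NormalizedUnimodular

end
end Hennings

/-! ### Kinks -/

namespace Hennings

noncomputable section

namespace NormalizedUnimodular
open QuasiBialgebra QuasiHopf QuasitriangularQuasiHopf
variable {k H : Type*} [Field k] [Ring H] [Algebra k H] (D : NormalizedUnimodular k H)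

theorem bead_bead {P : Type} (p : P) (x y : H) (z : Skein k H P) :
    Skein.bead D.S p x (Skein.bead D.S p y z) = Skein.bead D.S p (x * y) z := by
  rw [leg_mul, Module.End.mul_apply]

theorem bead_comm {P : Type} {p q : P} (h : p ≠ q) (x y : H) (z : Skein k H P) :
    Skein.bead D.S p x (Skein.bead D.S q y z) = Skein.bead D.S q y (Skein.bead D.S p x z) := by
  have := D.commuting_bead_bead p q h
  exact LinearMap.congr_fun (leg_comm (Skein.bead D.S p) (Skein.bead D.S q) x y) z

/-- Removing a kink decorated by the beads of its crossing, its maximum, its minimum and of the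
change of brackets. -/
theorem cup_kink_beads [Module.Finite k H] {Q : Type} (q : H ⊗[k] H) (t : H ⊗[k] (H ⊗[k] H))
    (x : Skein k H (Unit ⊕ Q)) :
    Skein.cup D.S D.coint D.G (Skein.bead D.S (.inl (.inr ())) D.α
      (two (Skein.bead D.S (.inl (.inr ()))) (Skein.bead D.S (.inl (.inl ()))) q
        (two (Skein.bead D.S (.inl (.inr ()))) (two (Skein.bead D.S (.inl (.inl ())))
          (Skein.bead D.S (.inr (.inl ())))) t (Skein.bead D.S (.inl (.inl ())) D.β
            (Skein.relabel (Beaded.kinkEquiv Q) (Skein.cap D.Ginv x)))))) =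
    Skein.bead D.S (.inl ()) (D.Ginv * evalAlpha D.S D.α (QuasiHopf.flip q *
      QuasiHopf.flip (TensorProduct.map LinearMap.id (evalBeta D.S D.β) t))) x := by
  induction t using TensorProduct.induction_on with
  | zero => simp
  | add u v hu hv => simp only [map_add, mul_add, LinearMap.add_apply, hu, hv]
  | tmul X t =>
  induction t using TensorProduct.induction_on with
  | zero => simp
  | add u v hu hv =>
    simp only [map_add, mul_add, LinearMap.add_apply, TensorProduct.tmul_add, hu, hv]
  | tmul Y Z =>
  induction q using TensorProduct.induction_on with
  | zero => simp
  | add u v hu hv => simp only [map_add, add_mul, mul_add, LinearMap.add_apply, hu, hv]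
  | tmul r₁ r₂ =>
  have e1 : Skein.bead D.S (.inr (.inl ())) Z
      (Skein.relabel (Beaded.kinkEquiv Q) (Skein.cap D.Ginv x)) =
      Skein.bead D.S (.inl (.inl ())) (D.S Z)
      (Skein.relabel (Beaded.kinkEquiv Q) (Skein.cap D.Ginv x)) := by
    have := congrArg (Skein.relabel (Beaded.kinkEquiv Q)) (D.cap_slide Z x)
    rw [Skein.relabel_bead, Skein.relabel_bead] at this
    exact this.symm
  have e2 : ∀ w, Skein.bead D.S (.inl (.inr ())) w
      (Skein.relabel (Beaded.kinkEquiv Q) (Skein.cap D.Ginv x)) =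
      Skein.relabel (Beaded.kinkEquiv Q) (Skein.cap D.Ginv (Skein.bead D.S (.inl ()) w x)) := by
    intro w
    rw [Skein.cap_bead, Skein.relabel_bead]
    rfl
  have hba : (Sum.inl (Sum.inr ()) : (Unit ⊕ Unit) ⊕ (Unit ⊕ Q)) ≠ .inl (.inl ()) := by simp
  have hra : (Sum.inr (Sum.inl ()) : (Unit ⊕ Unit) ⊕ (Unit ⊕ Q)) ≠ .inl (.inl ()) := by simp
  simp only [two_tmul, Module.End.mul_apply, TensorProduct.map_tmul, LinearMap.id_apply,
    evalBeta_tmul, flip_tmul, Algebra.TensorProduct.tmul_mul_tmul, evalAlpha_tmul]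
  -- All beads on the left leg pass the minimum as `S` of their product; the bare curl that remains
  -- contributes `G⁻¹`.
  rw [D.bead_comm hra, e1, bead_bead, bead_bead, bead_bead, D.bead_comm hba X, bead_bead,
    D.bead_comm hba, cup_slide, bead_bead, bead_bead, e2, cup_kink, bead_bead]
  simp only [mul_assoc]

/-- The beads of the crossing, of `Φ⁻¹` and of the two extrema combine to exactly the contraction
defining `us s`. -/
theorem run_kink [Module.Finite k H] (s : Bool) (Q : Type) (x : Skein k H (Unit ⊕ Q)) :
    D.run (Tangle.kink s) Q x = Skein.bead D.S (.inl ()) (D.Ginv * D.us s) x := by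
  rw [Tangle.kink]
  simp -index only [run_comp, run_assocInv, run_tensor_id, run_assoc, run_id_tensor, run_lunit,
      run_runitInv, run_cap, run_cup, run_cross,
      Skein.relabel_Br, Skein.relabel_Ph, Skein.relabel_PhI, push_bundle, Skein.push_bead,
      Skein.relabel_bead, Skein.cap_relabel,
      bundle_pt, Skein.relabel_relabel, Skein.push_cop, Equiv.sumCongr_apply, Sum.map_inl,
      Sum.map_inr, Equiv.sumComm_apply, Sum.swap_inl, Sum.swap_inr, Equiv.sumAssoc_apply_inl_inl,
      Equiv.sumAssoc_apply_inl_inr, Equiv.sumAssoc_apply_inr, Equiv.sumAssoc_symm_apply_inl,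
      Equiv.sumAssoc_symm_apply_inr_inl, Equiv.sumAssoc_symm_apply_inr_inr, Equiv.refl_apply,
      Equiv.trans_apply, exchange_inl, exchange_inr_inl, exchange_inr_inr]
  refine (Skein.relabel_eq_self (k := k) (H := H) (P := Unit ⊕ Q) _ ?_ _).trans ?_
  · rintro (_ | _) <;> rfl
  · refine Eq.trans ?_ (D.cup_kink_beads (D.rs s) D.phiInv x)
    rw [Skein.relabel_congr (e' := Beaded.kinkEquiv Q) ?_ (Skein.cap D.Ginv x)]
    · rfl
    · rintro ((_ | _) | _ | _) <;> rfl

end NormalizedUnimodular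

end
end Hennings

namespace Hennings

noncomputable section

/-! ### Circles around bundles of strands -/

namespace NormalizedUnimodular
open QuasiBialgebra QuasiHopf QuasitriangularQuasiHopf
variable {k H : Type*} [Field k] [Ring H] [Algebra k H] (D : NormalizedUnimodular k H)

theorem flip_rs_mul_rs (s : Bool) :
    D.qL * (QuasiHopf.flip (D.rs s) * D.rs s) * D.pL = D.Omega s := by
  cases s
  · rw [rs, flip_flip]
    rfl
  · rfl

section
variable {P : Type} {A : Brac} (ι : Pts A → P) [Inj ι]

/-- `X β` on the left leg passes over the maximum as `S⁻¹(X β)` and meets `Y`; with `Z` on the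
bundle this is `p_L`. -/
theorem phi_cap (x : Skein k H P) :
    D.Ph (Skein.bead D.S (.inl (.inl ()))) (Skein.bead D.S (.inl (.inr ())))
        (D.bundle A fun p => .inr (ι p)) (Skein.bead D.S (.inl (.inl ())) D.β
          (Skein.cap D.Ginv x)) =
      two (Skein.bead D.S (.inl (.inr ()))) (D.bundle A fun p => .inr (ι p)) D.pL
        (Skein.cap D.Ginv x) := by
  have cLR : Commuting (Skein.bead (k := k) D.S (.inl (.inl ()) : (Unit ⊕ Unit) ⊕ P))
    (Skein.bead D.S (.inl (.inr ()))) := D.commuting_bead_bead _ _ (by simp)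
  have caL : Commuting (D.bundle A fun p => (.inr (ι p) : (Unit ⊕ Unit) ⊕ P))
    (Skein.bead D.S (.inl (.inl ()))) := D.commuting_bundle_bead _ _ _ (by simp)
  have caR : Commuting (D.bundle A fun p => (.inr (ι p) : (Unit ⊕ Unit) ⊕ P))
    (Skein.bead D.S (.inl (.inr ()))) := D.commuting_bundle_bead _ _ _ (by simp)
  rw [Ph, pL, phi]
  generalize (D.Phi : H ⊗[k] (H ⊗[k] H)) = t
  induction t using TensorProduct.induction_on with
  | zero => simp
  | add u v hu hv => simp only [map_add, LinearMap.add_apply, hu, hv]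
  | tmul X t =>
  induction t using TensorProduct.induction_on with
  | zero => simp
  | add u v hu hv => simp only [map_add, LinearMap.add_apply, TensorProduct.tmul_add, hu, hv]
  | tmul Y Z =>
    simp only [two_tmul, TensorProduct.assoc_symm_tmul, TensorProduct.map_tmul,
      LinearMap.comp_apply, LinearMap.mulRight_apply, flip_tmul, LinearMap.mul'_apply,
      LinearMap.id_apply, LinearEquiv.coe_coe]
    rw [← mul_assoc, cLR.comm' X Y, mul_assoc, ← caL.comm' Z X, leg_mul, mul_assoc,
      ← caR.comm' Z (D.S.symm _)]
    simp only [Module.End.mul_apply]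
    rw [bead_bead, cap_slide_symm]

/-- `X` passes the minimum as `S(X)` and meets `α Y`; with `Z` on the bundle this is `q_L`. -/
theorem cup_phiInv [Module.Finite k H] (y : Skein k H ((Unit ⊕ Unit) ⊕ P)) :
    Skein.cup D.S D.coint D.G (Skein.bead D.S (.inl (.inr ())) D.α
      (D.PhI (Skein.bead D.S (.inl (.inl ()))) (Skein.bead D.S (.inl (.inr ())))
        (D.bundle A fun p => .inr (ι p)) y)) =
      Skein.cup D.S D.coint D.G
        (two (Skein.bead D.S (.inl (.inr ()))) (D.bundle A fun p => .inr (ι p)) D.qL y) := by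
  rw [PhI, qL, phiInv]
  generalize ((D.Phi⁻¹ : (H ⊗[k] (H ⊗[k] H))ˣ) : H ⊗[k] (H ⊗[k] H)) = t
  induction t using TensorProduct.induction_on with
  | zero => simp
  | add u v hu hv => simp only [map_add, LinearMap.add_apply, hu, hv]
  | tmul X t =>
  induction t using TensorProduct.induction_on with
  | zero => simp
  | add u v hu hv => simp only [map_add, LinearMap.add_apply, TensorProduct.tmul_add, hu, hv]
  | tmul Y Z =>
    simp only [two_tmul, TensorProduct.assoc_symm_tmul, TensorProduct.map_tmul, evalAlpha_tmul,
      LinearMap.id_apply, Module.End.mul_apply]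
    rw [D.bead_comm (by simp), cup_slide, bead_bead, bead_bead]

theorem cup_two_cap [Module.Finite k H] (t : H ⊗[k] H) (x : Skein k H P) :
    Skein.cup D.S D.coint D.G
        (two (Skein.bead D.S (.inl (.inr ()))) (D.bundle A fun p => .inr (ι p)) t
          (Skein.cap D.Ginv x)) =
      D.bundle A ι (slice D.coint t) x := by
  induction t using TensorProduct.induction_on with
  | zero => simp
  | add u v hu hv => simp only [map_add, LinearMap.add_apply, hu, hv]
  | tmul y z =>
    rw [two_tmul, Module.End.mul_apply, ← cap_bundle, cup_cap]
    simp [slice]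

/-- Evaluation of a circle around a bundle of strands. -/
theorem cup_circle [Module.Finite k H] (s : Bool) (z : H) (hz : ∀ h, z * h = h * z)
    (hS : D.S z = z) (x : Skein k H P) :
    Skein.cup D.S D.coint D.G (Skein.bead D.S (.inl (.inr ())) D.α
      (D.PhI (Skein.bead D.S (.inl (.inl ()))) (Skein.bead D.S (.inl (.inr ())))
        (D.bundle A fun p => .inr (ι p))
      (D.Br s (D.bundle A fun p => .inr (ι p)) (Skein.bead D.S (.inl (.inr ())))
      (D.Br s (Skein.bead D.S (.inl (.inr ()))) (D.bundle A fun p => .inr (ι p))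
      (Skein.bead D.S (.inl (.inl ())) z
      (D.Ph (Skein.bead D.S (.inl (.inl ()))) (Skein.bead D.S (.inl (.inr ())))
        (D.bundle A fun p => .inr (ι p)) (Skein.bead D.S (.inl (.inl ())) D.β
          (Skein.cap D.Ginv x)))))))) =
      D.bundle A ι (slice D.coint ((z ⊗ₜ[k] (1 : H)) * D.Omega s)) x := by
  have cLR : Commuting (Skein.bead (k := k) D.S (.inl (.inl ()) : (Unit ⊕ Unit) ⊕ P))
    (Skein.bead D.S (.inl (.inr ()))) := D.commuting_bead_bead _ _ (by simp)
  have caL : Commuting (D.bundle A fun p => (.inr (ι p) : (Unit ⊕ Unit) ⊕ P))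
    (Skein.bead D.S (.inl (.inl ()))) := D.commuting_bundle_bead _ _ _ (by simp)
  have caR : Commuting (D.bundle A fun p => (.inr (ι p) : (Unit ⊕ Unit) ⊕ P))
    (Skein.bead D.S (.inl (.inr ()))) := D.commuting_bundle_bead _ _ _ (by simp)
  have hc : Commuting (two (Skein.bead D.S (.inl (.inr ())))
      (D.bundle A fun p => (.inr (ι p) : (Unit ⊕ Unit) ⊕ P)))
    (Skein.bead D.S (.inl (.inl ()))) := inferInstance
  have hz' : ∀ t : H ⊗[k] H, z ⊗ₜ[k] (1 : H) * t = t * z ⊗ₜ[k] (1 : H) := fun t => by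
    induction t using TensorProduct.induction_on with
    | zero => simp
    | add u v hu hv => rw [mul_add, hu, hv, add_mul]
    | tmul y w => simp [hz y]
  -- The bead passes over the maximum unchanged, since `S⁻¹(z) = z`.
  have hz'' : Skein.bead D.S (.inl (.inl ())) z (Skein.cap D.Ginv x) =
      two (Skein.bead D.S (.inl (.inr ()))) (D.bundle A fun p => .inr (ι p)) (z ⊗ₜ[k] (1 : H))
        (Skein.cap D.Ginv x) := by
    rw [cap_slide_symm, two_tmul, leg_one, mul_one, D.S.symm_apply_eq.2 hS.symm]
  rw [phi_cap, ← Module.End.mul_apply (Skein.bead D.S _ z),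
    ← hc.comm', Module.End.mul_apply, hz'', cup_phiInv, Br, Br,
    ← two_flip _ _ (D.rs s)]
  simp only [← Module.End.mul_apply, ← leg_mul]
  rw [cup_two_cap, ← flip_rs_mul_rs, hz']
  simp only [mul_assoc]

end

theorem run_circle [Module.Finite k H] (s : Bool) (A : Brac) (z : H) (hz : ∀ h, z * h = h * z)
    (hS : D.S z = z) (Q : Type) (x : Skein k H (Pts A ⊕ Q)) :
    D.run (Tangle.circleBottom s A) Q (Skein.bead D.S (.inl (.inl ())) z
      (D.run (Tangle.circleTop A) Q x)) =
      D.bundle A (fun p => .inl p) (slice D.coint ((z ⊗ₜ[k] (1 : H)) * D.Omega s)) x := by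
  rw [Tangle.circleBottom, Tangle.circleTop]
  simp -index only [run_comp, run_assocInv, run_tensor_id, run_assoc, run_id_tensor, run_lunit,
      run_lunitInv, run_cap, run_cup, run_crossBundle, run_crossBundles,
      Skein.relabel_Br, Skein.relabel_Ph, Skein.relabel_PhI, push_bundle, Skein.push_bead,
      Skein.relabel_bead, Skein.cap_relabel,
      bundle_pt, Skein.relabel_relabel, Skein.push_cop, Equiv.sumCongr_apply, Sum.map_inl,
      Sum.map_inr, Equiv.sumComm_apply, Sum.swap_inl, Sum.swap_inr, Equiv.sumAssoc_apply_inl_inl,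
      Equiv.sumAssoc_apply_inl_inr, Equiv.sumAssoc_apply_inr, Equiv.sumAssoc_symm_apply_inl,
      Equiv.sumAssoc_symm_apply_inr_inl, Equiv.sumAssoc_symm_apply_inr_inr, Equiv.refl_apply,
      Equiv.trans_apply, exchange_inl, exchange_inr_inl, exchange_inr_inr]
  rw [← D.cup_circle (fun p => (.inl p : Pts A ⊕ Q)) s z hz hS x]
  refine (Skein.relabel_eq_self (k := k) (H := H) (P := Pts A ⊕ Q) _ ?_ _).trans ?_
  · rintro (_ | _) <;> rfl
  · rw [Skein.relabel_eq_self (k := k) (H := H) (P := (Unit ⊕ Unit) ⊕ (Pts A ⊕ Q)) _ ?_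
      (Skein.cap D.Ginv x)]
    rintro ((_ | _) | _ | _) <;> rfl

end NormalizedUnimodular

end
end Hennings

namespace Hennings

noncomputable section

/-! ### The Fenn-Rourke move -/

namespace NormalizedUnimodular
open QuasiBialgebra QuasiHopf QuasitriangularQuasiHopf RibbonQuasiHopf
variable {k H : Type*} [Field k] [Ring H] [Algebra k H] (D : NormalizedUnimodular k H)

/-- The bead `v` or `v⁻¹` on a strand with a kink. -/
def twistElt (s : Bool) : H := if s then (D.v : H) else D.vInv

theorem Ginv_mul_us (s : Bool) : D.Ginv * D.us s = D.twistElt s := by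
  cases s
  · exact D.Ginv_mul_us_false D.isUnit_α
  · exact D.Ginv_mul_us_true

theorem twistElt_central (s : Bool) (h : H) : D.twistElt s * h = h * D.twistElt s := by
  cases s
  · exact D.vInv_central h
  · exact D.v_central h

theorem S_twistElt (s : Bool) : D.S (D.twistElt s) = D.twistElt s := by
  cases s
  · exact D.S_vInv
  · exact D.S_v

/-- The double braiding has the sign opposite to the kink's, which is the reason for the crossings
`!s` in `fullTwist s` and makes the induction on bundles work. -/
theorem comul_twistElt (s : Bool) : D.comul (D.twistElt s) =
    QuasiHopf.flip (D.rs (!s)) * D.rs (!s) * (D.twistElt s ⊗ₜ D.twistElt s) := by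
  cases s
  · refine (D.comul_vInv D.isUnit_α D.isUnit_f).trans ?_
    rw [tmul_vInv_central]
    rfl
  · refine (D.comul_v D.isUnit_α D.isUnit_f).trans ?_
    rw [tmul_v_central, Bool.not_true, rs, flip_flip]
    rfl

theorem run_fullTwist [Module.Finite k H] (s : Bool) (A : Brac) (Q : Type)
    (x : Skein k H (Pts A ⊕ Q)) :
    D.run (Tangle.fullTwist s A) Q x = D.bundle A (fun p => .inl p) (D.twistElt s) x := by
  induction A generalizing Q with
  | unit =>
    have h : D.counit (D.twistElt s) = 1 := by
      cases s
      · exact D.counit_vInv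
      · exact D.counit_v
    rw [bundle_unit, eps_apply, h, map_one]
    rfl
  | pt => rw [← Ginv_mul_us]; exact D.run_kink s Q x
  | tensor A B hA hB =>
    rw [bundle_tensor, Tangle.fullTwist]
    simp -index only [run_comp, run_tensor, hA, hB, run_crossBundles,
      Skein.relabel_Br, push_bundle, Skein.push_bead, relabel_bundle,
      bundle_pt, Skein.relabel_relabel, Skein.push_cop, Equiv.sumCongr_apply, Sum.map_inl,
      Sum.map_inr, Equiv.sumComm_apply, Sum.swap_inl, Sum.swap_inr, Equiv.sumAssoc_apply_inl_inl,
      Equiv.sumAssoc_apply_inl_inr, Equiv.sumAssoc_apply_inr, Equiv.sumAssoc_symm_apply_inl,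
      Equiv.sumAssoc_symm_apply_inr_inl, Equiv.sumAssoc_symm_apply_inr_inr, Equiv.refl_apply,
      Equiv.trans_apply, exchange_inl, exchange_inr_inl, exchange_inr_inr]
    have key : ∀ (a b : H →ₗ[k] Module.End k (Skein k H ((Pts A ⊕ Pts B) ⊕ Q)))
        [IsLeg a] [IsLeg b] [Commuting a b] (y),
        D.Br (!s) b a (D.Br (!s) a b (b (D.twistElt s) (a (D.twistElt s) y))) =
          D.cop a b (D.twistElt s) y := by
      intro a b _ _ _ y
      rw [cop_apply, comul_twistElt, leg_mul, leg_mul, two_tmul, two_flip, leg_comm a b]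
      rfl
    refine (key (D.bundle A fun p => .inl (.inl p)) (D.bundle B fun p => .inl (.inr p)) _).trans ?_
    congr 1
    refine Skein.relabel_eq_self _ ?_ x
    rintro ((_ | _) | _) <;> rfl

/-- The kink on the circle is a central bead fixed by `S`, so this is a case of `run_circle`. -/
theorem run_encircled [Module.Finite k H] (s : Bool) (A : Brac) (Q : Type)
    (x : Skein k H (Pts A ⊕ Q)) :
    D.run (Tangle.encircled s A) Q x = D.bundle A (fun p => .inl p)
      (slice D.coint ((D.twistElt s ⊗ₜ[k] (1 : H)) * D.Omega (!s))) x := by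
  rw [← D.run_circle (!s) A _ (D.twistElt_central s) (D.S_twistElt s), Tangle.encircled]
  rw [run_comp, run_comp]
  congr 1
  simp -index only [run_tensor_id, run_kink, Skein.relabel_bead, Skein.relabel_relabel,
    Ginv_mul_us, Equiv.sumAssoc_symm_apply_inl]
  congr 1
  refine Skein.relabel_eq_self _ ?_ _
  rintro ((_ | _ | _) | _) <;> rfl

theorem cup_bead_cap [Module.Finite k H] {Q : Type} (z : H) (x : Skein k H Q) :
    Skein.cup D.S D.coint D.G (Skein.bead D.S (.inl (.inr ())) D.α
      (Skein.bead D.S (.inl (.inl ())) z (Skein.bead D.S (.inl (.inl ())) D.β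
        (Skein.cap D.Ginv x)))) = D.coint (D.α * D.S.symm (z * D.β)) • x := by
  rw [bead_bead, cap_slide_symm, bead_bead, cup_cap]

/-- The separate circle closes up by `cup_bead_cap`. Its value takes the stated form because
`v^{±1}` is central and fixed by `S`. -/
theorem run_unlinked [Module.Finite k H] (s : Bool) (A : Brac) (Q : Type)
    (x : Skein k H (Pts A ⊕ Q)) :
    D.run (Tangle.unlinked s A) Q x = D.coint (D.α * D.twistElt s * D.S.symm D.β) •
      D.bundle A (fun p => .inl p) (D.twistElt (!s)) x := by
  have h : D.α * D.twistElt s * D.S.symm D.β = D.α * D.S.symm (D.twistElt s * D.β) := by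
    rw [S_symm_mul, D.S.symm_apply_eq.2 (D.S_twistElt s).symm, mul_assoc, twistElt_central]
  rw [h, ← run_fullTwist, Tangle.unlinked, run_comp]
  generalize D.run (Tangle.fullTwist (!s) A) Q x = y
  rw [← cup_bead_cap]
  simp -index only [run_comp, run_tensor_id, run_id_tensor, run_kink, run_cap, run_cup, run_runit,
      run_runitInv, Ginv_mul_us, Skein.relabel_bead, Skein.cap_relabel,
      Skein.relabel_relabel, Equiv.sumCongr_apply, Sum.map_inl,
      Sum.map_inr, Equiv.sumComm_apply, Sum.swap_inl, Sum.swap_inr, Equiv.sumAssoc_apply_inl_inl,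
      Equiv.sumAssoc_apply_inl_inr, Equiv.sumAssoc_apply_inr, Equiv.sumAssoc_symm_apply_inl,
      Equiv.sumAssoc_symm_apply_inr_inl, Equiv.sumAssoc_symm_apply_inr_inr, Equiv.refl_apply,
      Equiv.trans_apply, exchange_inl, exchange_inr_inl, exchange_inr_inr]
  refine (Skein.relabel_eq_self (k := k) (H := H) (P := Pts A ⊕ Q) _ ?_ _).trans ?_
  · rintro (_ | _) <;> rfl
  · rw [Skein.relabel_eq_self (k := k) (H := H) (P := (Unit ⊕ Unit) ⊕ (Pts A ⊕ Q)) _ ?_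
      (Skein.cap D.Ginv y)]
    rintro ((_ | _) | _ | _) <;> rfl

/-- The slice formulas enter here: the circle leaves a multiple of `v^{∓1}` on the bundle, which is
the bead of the full twist on the other side of the move. -/
theorem run_encircled_eq [Module.Finite k H] (s : Bool) (A : Brac) (Q : Type) :
    D.run (Tangle.encircled s A) Q = D.coint (D.α * D.twistElt s * D.S.symm D.β) •
      D.bundle A (fun p => .inl p) (D.twistElt (!s)) := by
  refine LinearMap.ext fun x => ?_
  rw [run_encircled]
  cases s
  · have h : slice D.coint ((D.twistElt false ⊗ₜ[k] (1 : H)) * D.Omega (!false)) = _ :=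
      D.slice_vInv_mul_M
    rw [h, map_smul]
    rfl
  · have h : slice D.coint ((D.twistElt true ⊗ₜ[k] (1 : H)) * D.Omega (!true)) = _ :=
      D.slice_v_mul_Minv
    rw [h, map_smul]
    rfl

theorem run_unlinked_eq [Module.Finite k H] (s : Bool) (A : Brac) (Q : Type) :
    D.run (Tangle.unlinked s A) Q = D.coint (D.α * D.twistElt s * D.S.symm D.β) •
      D.bundle A (fun p => .inl p) (D.twistElt (!s)) :=
  LinearMap.ext fun x => D.run_unlinked s A Q x

/-- The evaluation of bracketed tangle diagrams is invariant under the Fenn-Rourke move. -/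
theorem run_eq_of_fennRourke [Module.Finite k H] {A B : Brac} {T T' : Tangle A B}
    (h : Tangle.FennRourke T T') (Q : Type) : D.run T Q = D.run T' Q := by
  induction h generalizing Q with
  | move s A => rw [run_encircled_eq, run_unlinked_eq]
  | comp_top U _ ih => simp only [run, ih]
  | comp_bottom U _ ih => simp only [run, ih]
  | tensor_left U _ ih => simp only [run, ih]
  | tensor_right U _ ih => simp only [run, ih]

end NormalizedUnimodular

end
end Hennings

theorem lemma4p16 {k H : Type*} [Field k] [CharZero k] [Ring H] [Algebra k H] [Module.Finite k H]
    (D : Hennings.NormalizedUnimodular k H) :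
    -- `λ(v⁻¹ Ω¹) Ω² = λ(α v⁻¹ S⁻¹(β)) v` for `Ω = q_L M p_L`
    (Hennings.slice D.coint ((D.vInv ⊗ₜ[k] (1 : H)) * (D.qL * D.M * D.pL)) =
      D.coint (D.α * D.vInv * D.S.symm D.β) • (D.v : H)) ∧
    -- the same with the opposite crossings
    (Hennings.slice D.coint (((D.v : H) ⊗ₜ[k] (1 : H)) * (D.qL * D.Minv * D.pL)) =
      D.coint (D.α * (D.v : H) * D.S.symm D.β) • D.vInv) ∧
    -- strands encircled by a closed component with a bead `a` carry `λ(a Ω¹) Δ_A(Ω²)`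
    (∀ a : H, (∀ h : H, a * h = h * a) → D.S a = a →
      ∀ (s : Bool) (A : Hennings.Brac) (Q : Type),
        D.run (Hennings.Tangle.circleBottom s A) Q ∘ₗ
            Hennings.Skein.bead D.S (.inl (.inl ())) a ∘ₗ
            D.run (Hennings.Tangle.circleTop A) Q =
          D.bundle A (fun p => .inl p)
            (Hennings.slice D.coint ((a ⊗ₜ[k] (1 : H)) * D.Omega s))) ∧
    -- the two sides of the move with framing `-1`
    (∀ (A : Hennings.Brac) (Q : Type),
      D.run (Hennings.Tangle.encircled false A) Q =
          D.coint (D.α * D.vInv * D.S.symm D.β) • D.bundle A (fun p => .inl p) (D.v : H) ∧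
      D.run (Hennings.Tangle.unlinked false A) Q =
          D.coint (D.α * D.vInv * D.S.symm D.β) • D.bundle A (fun p => .inl p) (D.v : H)) ∧
    -- the two sides of the move with framing `+1`
    (∀ (A : Hennings.Brac) (Q : Type),
      D.run (Hennings.Tangle.encircled true A) Q =
          D.coint (D.α * (D.v : H) * D.S.symm D.β) • D.bundle A (fun p => .inl p) D.vInv ∧
      D.run (Hennings.Tangle.unlinked true A) Q =
          D.coint (D.α * (D.v : H) * D.S.symm D.β) • D.bundle A (fun p => .inl p) D.vInv) ∧
    -- invariance of the evaluation under the move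
    (∀ (m n : ℕ) (T T' : Hennings.EvenTangle m n),
      Hennings.Tangle.FennRourke T.1 T'.1 → D.Xi T = D.Xi T') := by
  refine ⟨D.slice_vInv_mul_M, D.slice_v_mul_Minv, fun a ha hS s A Q => LinearMap.ext fun x =>
    D.run_circle s A a ha hS Q x, fun A Q => ⟨D.run_encircled_eq false A Q,
    D.run_unlinked_eq false A Q⟩, fun A Q => ⟨D.run_encircled_eq true A Q,
    D.run_unlinked_eq true A Q⟩, fun m n T T' h => ?_⟩
  rw [Hennings.NormalizedUnimodular.Xi, Hennings.NormalizedUnimodular.Xi,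
    D.run_eq_of_fennRourke h]
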